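/- **Conventions.** All graphs called *oriented* are finite, connected and non-empty; loops and multiple edges are allowed, and graphs are considered up to isomorphism. For $K\ge 0$, a *$K$-graph operation* is an oriented graph with $K$ ordered edges and two (possibly equal) distinguished vertices, an input and an output. They form an operad $\mathcal G$: $g\circ(g_1,\dots,g_K)$ is obtained by replacing the $i$-th edge of $g$ by $g_i$ (input of $g_i$ at the source, output at the target), and $S_K$ acts by reordering edges. A *$\mathcal G$-algebra* is a complex vector space $\mathcal A$ with $K$-linear maps $Z_g:\mathcal A^K\to\mathcal A$ for all $g\in\mathcal G_K$, $K\ge 0$, compatible with composition and reordering, $Z_g$ being the identity when $g$ is a single edge from the input to the output; its unit is $\mathbb I=Z_g()$ for $g$ a single vertex. A *$\mathcal G$-subalgebra* is a linear subspace stable under all $Z_g$. A *$\mathcal G^*$-algebra* has moreover an antilinear involution with $Z_g(a_1,\dots,a_K)^*=Z_{g^*}(a_1^*,\dots,a_K^*)$, where $g^*$ is $g$ with edges reversed and input and output exchanged. For a set $X$ and $n\ge 0$, an *$n$-graph monomial* over $X$ is an oriented graph with edges labelled by $X$ and an $n$-tuple of (not necessarily distinct) vertices, its outputs; $\mathbb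 C\mathcal G^{(n)}\langle X\rangle$ is the space of their formal complex linear combinations, the *$n$-graph polynomials*. An *algebraic space of traffics* is a $\mathcal G$-algebra $\mathcal A$ with a linear form $\Phi$ such that $\Phi(\mathbb I)=1$ and such that $\Phi\circ Z_g=\Phi\circ Z_{g'}$ whenever $g'$ is obtained from $g$ by identifying its input and its output and then choosing any one vertex as both input and output. Its *distribution of traffics* is the linear form $\tau$ on $\mathbb C\mathcal G^{(0)}\langle\mathcal A\rangle$ whose value on a $0$-graph monomial with edges $e_1,\dots,e_K$ labelled $\gamma(e_1),\dots,\gamma(e_K)$ is $\Phi(Z_g(\gamma(e_1),\dots,\gamma(e_K)))$, where $g$ is the graph with these ordered edges and any vertex as input and output. A *space of traffics* is an algebraic space of traffics which is a $\mathcal G^*$-algebra and satisfies $\tau[t|t^*]\ge 0$ for all $n\ge 1$ and all $n$-graph polynomials $t$ over $\mathcal A$; here $t|s$ is the bilinear extension of merging the $i$-th outputs of $t$ and $s$ for each $i$, and $t\mapsto t^*$ is the antilinear extension of reversing edges and taking the adjoints of the labels. **Traffic independence.** For a linear form $\tau$ on $\mathbb C\mathcal G^{(0)}\langle X\rangle$,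 its *injective version* $\tau^0$ is the linear form determined by $\tau[t]=\sum_{\pi}\tau^0[t^\pi]$ for every $0$-graph monomial $t$, the sum being over all partitions $\pi$ of the vertices, where $t^\pi$ is $t$ with the vertices of each block identified. Given sets $X_j$ and linear forms $\tau_j$ on $\mathbb C\mathcal G^{(0)}\langle X_j\rangle$ with value $1$ at the one-vertex graph without edges ($j\in J$), their *free product* is the linear form $\star_{j}\tau_j$ on $\mathbb C\mathcal G^{(0)}\langle\bigsqcup_j X_j\rangle$ with $$(\star_j\tau_j)^0[T]=\mathbf 1(\bar T\text{ is a tree})\prod_{S}\tau_{j(S)}^0[S]$$ for every $0$-graph monomial $T$. Here $S$ runs over the coloured components of $T$ (the maximal connected subgraphs with at least one edge whose labels all lie in one $X_j$, $j=:j(S)$), and $\bar T$ is the bipartite graph whose vertices are the coloured components and the connectors (the vertices of $T$ lying in at least two components), a component being adjacent to the connectors it contains; the empty $\bar T$ counts as a tree. A family $(\mathcal A_j)_{j\in J}$ of $\mathcal G$-subalgebras of $(\mathcal A,\tau)$ is *traffic independent* if on $\mathbb C\mathcal G^{(0)}\langle\bigsqcup_j\mathcal A_j\rangle$ (the index $j$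 of each label being remembered) $\tau$ coincides with $\star_j\tau_j$, where $\tau_j$ is the restriction of $\tau$ to $\mathbb C\mathcal G^{(0)}\langle\mathcal A_j\rangle$. **Bigraphs.** For $L,n\ge0$ and $\mathbf d=(d_1,\dots,d_L)$ with all $d_\ell\ge 1$, $\mathcal G^{(n)}_{L,\mathbf d}$ is the set of finite connected bipartite simple graphs $g$ on $L$ ordered vertices called inputs and a finite set of vertices called connectors, such that the $\ell$-th input has degree $d_\ell$ and its edges are ordered, together with $n$ distinct ordered connectors called outputs, all other connectors having degree at least $2$. For $t_\ell\in\mathbb C\mathcal G^{(d_\ell)}\langle\mathcal A\rangle$, $T_g(t_1\otimes\dots\otimes t_L)\in\mathbb C\mathcal G^{(n)}\langle\mathcal A\rangle$ is the multilinear extension of the operation replacing the $\ell$-th input of $g$ by the monomial $t_\ell$ and identifying its $k$-th output with the connector at the end of the $k$-th edge around this input. A sequence $t_\ell\in\mathbb C\mathcal G^{(d_\ell)}\langle\mathcal A_{j_\ell}\rangle$, $1\le\ell\le L$, is *$g$-alternated* if $j_p\ne j_q$ whenever the $p$-th and $q$-th inputs, $p\neq q$, are neighbours of a same connector. An $n$-graph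 polynomial $t$ over $\mathcal A$ is *reduced* if either $n=1$ and $\tau(\tilde t)=0$, where $\tilde t$ is $t$ with its output forgotten, or $n\ge 2$ and $\Delta_\pi(t)=0$ for every partition $\pi$ of $\{1,\dots,n\}$ other than the partition into singletons, where $\Delta_\pi$ is the linear extension of identifying the outputs of a monomial according to $\pi$. **Proposition 3.11.** Let $(\mathcal A,\tau)$ be a space of traffics and $(\mathcal A_j)_{j\in J}$ a family of $\mathcal G$-subalgebras of $\mathcal A$. Then $(\mathcal A_j)_{j\in J}$ is traffic independent if and only if for all $L$ and $\mathbf d$, every bigraph $g\in\mathcal G^{(0)}_{L,\mathbf d}$ without outputs, all $j_1,\dots,j_L\in J$ and every $g$-alternated sequence $(t_1,\dots,t_L)$ of reduced graph polynomials $t_\ell\in\mathbb C\mathcal G^{(d_\ell)}\langle\mathcal A_{j_\ell}\rangle$, $$\tau\big[T_g(t_1\otimes\cdots\otimes t_L)\big]=0.$$ -/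

import Mathlib

universe u v w

namespace Traffic

/-! Finite connected oriented multigraphs (loops and multiple edges are allowed). -/

/-- There is an edge from `a` to `b`. -/
def EdgeStep {V E : Type} (src tgt : E → V) (a b : V) : Prop :=
  ∃ e, src e = a ∧ tgt e = b

/-- Connectedness (of the underlying unoriented graph); a connected graph has a vertex. -/
structure IsConn {V E : Type} (src tgt : E → V) : Prop where
  nonempty : Nonempty V
  joined : ∀ a b, Relation.EqvGen (EdgeStep src tgt) a b

theorem EqvGen.map {α β : Type} {r : α → α → Prop} {s : β → β → Prop} (f : α → β)
    (h : ∀ a b, r a b → Relation.EqvGen s (f a) (f b)) {a b : α}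
    (hab : Relation.EqvGen r a b) : Relation.EqvGen s (f a) (f b) := by
  induction hab with
  | rel x y hxy => exact h x y hxy
  | refl x => exact Relation.EqvGen.refl _
  | symm x y _ ih => exact Relation.EqvGen.symm _ _ ih
  | trans x y z _ _ ih1 ih2 => exact Relation.EqvGen.trans _ _ _ ih1 ih2

/-- A graph obtained by gluing vertices is connected as soon as any two vertices are joined
by edges and gluings. -/
theorem IsConn.of_glue {V E : Type} {src tgt : E → V} [Nonempty V] (r : V → V → Prop)
    (h : ∀ a b, Relation.EqvGen (fun a b => r a b ∨ EdgeStep src tgt a b) a b) :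
    IsConn (fun e => Quot.mk r (src e)) (fun e => Quot.mk r (tgt e)) := by
  refine ⟨‹Nonempty V›.map (Quot.mk r), fun a b => ?_⟩
  induction a using Quot.ind with | mk a => ?_
  induction b using Quot.ind with | mk b => ?_
  refine EqvGen.map (Quot.mk r) ?_ (h a b)
  rintro a b (hr | ⟨e, rfl, rfl⟩)
  · rw [Quot.sound hr]; exact Relation.EqvGen.refl _
  · exact Relation.EqvGen.rel _ _ ⟨e, rfl, rfl⟩

theorem IsConn.quot {V E : Type} {src tgt : E → V} (hc : IsConn src tgt) (r : V → V → Prop) :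
    IsConn (fun e => Quot.mk r (src e)) (fun e => Quot.mk r (tgt e)) := by
  have := hc.1
  refine IsConn.of_glue r fun a b => ?_
  exact EqvGen.map (r := EdgeStep src tgt) id
    (fun x y h => Relation.EqvGen.rel _ _ (Or.inr h)) (hc.2 a b)

theorem EdgeStep.swap {V E : Type} {src tgt : E → V} {a b : V}
    (h : EdgeStep src tgt a b) : Relation.EqvGen (EdgeStep tgt src) a b := by
  obtain ⟨e, rfl, rfl⟩ := h
  exact Relation.EqvGen.symm _ _ (Relation.EqvGen.rel _ _ ⟨e, rfl, rfl⟩)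

theorem IsConn.swap {V E : Type} {src tgt : E → V} (hc : IsConn src tgt) : IsConn tgt src :=
  ⟨hc.1, fun a b => EqvGen.map id (fun _ _ h => h.swap) (hc.2 a b)⟩

/-! ### The operad of graph operations -/

/-- A `K`-graph operation: a finite connected oriented graph with `K` ordered edges, an input
`inp` and an output `out`, not necessarily distinct. -/
structure GraphOp (K : ℕ) : Type 1 where
  V : Type
  finV : Finite V
  src : Fin K → V
  tgt : Fin K → V
  inp : V
  out : V
  conn : IsConn src tgt

namespace GraphOp

/-- Isomorphism of graph operations. Graph operations are considered up to isomorphism. -/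
def Iso {K : ℕ} (g h : GraphOp K) : Prop :=
  ∃ f : g.V ≃ h.V, (∀ i, f (g.src i) = h.src i) ∧ (∀ i, f (g.tgt i) = h.tgt i) ∧
    f g.inp = h.inp ∧ f g.out = h.out

/-- The operation with one vertex and no edge. -/
def point : GraphOp 0 where
  V := Unit
  finV := inferInstance
  src := fun _ => ()
  tgt := fun _ => ()
  inp := ()
  out := ()
  conn := ⟨⟨()⟩, fun _ _ => Relation.EqvGen.refl _⟩

/-- The identity: two vertices and one edge, from the input `false` to the output `true`. -/
def ident : GraphOp 1 where
  V := Bool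
  finV := inferInstance
  src := fun _ => false
  tgt := fun _ => true
  inp := false
  out := true
  conn := by
    have h : Relation.EqvGen (EdgeStep (fun _ : Fin 1 => false) (fun _ => true)) false true :=
      Relation.EqvGen.rel _ _ ⟨0, rfl, rfl⟩
    refine ⟨⟨false⟩, fun a b => ?_⟩
    cases a <;> cases b
    · exact Relation.EqvGen.refl _
    · exact h
    · exact Relation.EqvGen.symm _ _ h
    · exact Relation.EqvGen.refl _

/-- The gluing relation of the composition: the input of the graph replacing the edge `i` is
glued to the source of `i`, and its output to the target of `i`. -/
inductive CompRel {K : ℕ} (g : GraphOp K) {L : Fin K → ℕ} (h : ∀ i, GraphOp (L i)) :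
    (g.V ⊕ Σ i, (h i).V) → (g.V ⊕ Σ i, (h i).V) → Prop
  | src (i : Fin K) : CompRel g h (Sum.inl (g.src i)) (Sum.inr ⟨i, (h i).inp⟩)
  | tgt (i : Fin K) : CompRel g h (Sum.inl (g.tgt i)) (Sum.inr ⟨i, (h i).out⟩)

/-- The composition `g ∘ (h₁, …, h_K)`: the `i`-th edge of `g` is replaced by `h i`. The edges
are ordered lexicographically, those of `h₁` first. -/
def comp {K : ℕ} (g : GraphOp K) {L : Fin K → ℕ} (h : ∀ i, GraphOp (L i)) :
    GraphOp (∑ i, L i) where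
  V := Quot (CompRel g h)
  finV := by
    have := g.finV
    have := fun i => (h i).finV
    infer_instance
  src := fun m => Quot.mk _ (Sum.inr ⟨(finSigmaFinEquiv.symm m).1,
    (h (finSigmaFinEquiv.symm m).1).src (finSigmaFinEquiv.symm m).2⟩)
  tgt := fun m => Quot.mk _ (Sum.inr ⟨(finSigmaFinEquiv.symm m).1,
    (h (finSigmaFinEquiv.symm m).1).tgt (finSigmaFinEquiv.symm m).2⟩)
  inp := Quot.mk _ (Sum.inl g.inp)
  out := Quot.mk _ (Sum.inl g.out)
  conn := by
    let s : Fin (∑ i, L i) → (g.V ⊕ Σ i, (h i).V) := fun m =>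
      Sum.inr ⟨(finSigmaFinEquiv.symm m).1,
        (h (finSigmaFinEquiv.symm m).1).src (finSigmaFinEquiv.symm m).2⟩
    let t : Fin (∑ i, L i) → (g.V ⊕ Σ i, (h i).V) := fun m =>
      Sum.inr ⟨(finSigmaFinEquiv.symm m).1,
        (h (finSigmaFinEquiv.symm m).1).tgt (finSigmaFinEquiv.symm m).2⟩
    let R := fun a b => CompRel g h a b ∨ EdgeStep s t a b
    have : Nonempty (g.V ⊕ Σ i, (h i).V) := ⟨Sum.inl g.inp⟩
    have inner : ∀ i (x y : (h i).V),
        Relation.EqvGen R (Sum.inr ⟨i, x⟩) (Sum.inr ⟨i, y⟩) := by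
      intro i x y
      refine EqvGen.map (fun x => (Sum.inr ⟨i, x⟩ : g.V ⊕ Σ i, (h i).V)) ?_ ((h i).conn.2 x y)
      rintro _ _ ⟨e, rfl, rfl⟩
      refine Relation.EqvGen.rel _ _ (Or.inr ⟨finSigmaFinEquiv ⟨i, e⟩, ?_, ?_⟩)
      · simp only [s]; rw [Equiv.symm_apply_apply]
      · simp only [t]; rw [Equiv.symm_apply_apply]
    have outer : ∀ x y : g.V, Relation.EqvGen R (Sum.inl x) (Sum.inl y) := by
      intro x y
      refine EqvGen.map (fun x => (Sum.inl x : g.V ⊕ Σ i, (h i).V)) ?_ (g.conn.2 x y)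
      rintro _ _ ⟨e, rfl, rfl⟩
      refine Relation.EqvGen.trans _ _ _
        (Relation.EqvGen.rel _ _ (Or.inl (CompRel.src e))) ?_
      refine Relation.EqvGen.trans _ _ _ (inner e _ (h e).out) ?_
      exact Relation.EqvGen.symm _ _ (Relation.EqvGen.rel _ _ (Or.inl (CompRel.tgt e)))
    have cross : ∀ i (x : (h i).V) (y : g.V),
        Relation.EqvGen R (Sum.inl y) (Sum.inr ⟨i, x⟩) := by
      intro i x y
      refine Relation.EqvGen.trans _ _ _ (outer y (g.src i)) ?_
      refine Relation.EqvGen.trans _ _ _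
        (Relation.EqvGen.rel _ _ (Or.inl (CompRel.src i))) (inner i _ _)
    refine IsConn.of_glue (src := s) (tgt := t) (CompRel g h) ?_
    rintro (x | ⟨i, x⟩) (y | ⟨k, y⟩)
    · exact outer x y
    · exact cross k y x
    · exact Relation.EqvGen.symm _ _ (cross i x y)
    · exact Relation.EqvGen.trans _ _ _
        (Relation.EqvGen.symm _ _ (cross i x g.inp)) (cross k y g.inp)

/-- The action of the symmetric group: `g ∘ σ` has ordered edges `e_{σ⁻¹(1)}, …, e_{σ⁻¹(K)}`. -/
def perm {K : ℕ} (g : GraphOp K) (σ : Equiv.Perm (Fin K)) : GraphOp K where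
  V := g.V
  finV := g.finV
  src := fun i => g.src (σ⁻¹ i)
  tgt := fun i => g.tgt (σ⁻¹ i)
  inp := g.inp
  out := g.out
  conn := ⟨g.conn.1, fun a b => EqvGen.map id
    (fun _ _ h => Relation.EqvGen.rel _ _ (by
      obtain ⟨e, rfl, rfl⟩ := h
      exact ⟨σ e, by simp, by simp⟩)) (g.conn.2 a b)⟩

/-- The involution: reverse the edges and exchange the input and the output. -/
def adjoint {K : ℕ} (g : GraphOp K) : GraphOp K where
  V := g.V
  finV := g.finV
  src := g.tgt
  tgt := g.src
  inp := g.out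
  out := g.inp
  conn := g.conn.swap

/-- The operation `Δ ∘ g`, where `Δ` has one vertex and one edge: the input and the output of
`g` are identified. -/
def diag {K : ℕ} (g : GraphOp K) : GraphOp K where
  V := Quot (fun a b => a = g.inp ∧ b = g.out)
  finV := by
    have := g.finV
    infer_instance
  src := fun i => Quot.mk _ (g.src i)
  tgt := fun i => Quot.mk _ (g.tgt i)
  inp := Quot.mk _ g.inp
  out := Quot.mk _ g.out
  conn := g.conn.quot _

/-- The same graph, with input and output both placed at the vertex `x`. -/
def rootAt {K : ℕ} (g : GraphOp K) (x : g.V) : GraphOp K where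
  V := g.V
  finV := g.finV
  src := g.src
  tgt := g.tgt
  inp := x
  out := x
  conn := g.conn

end GraphOp

/-- A `𝒢`-algebra: a complex vector space with an action of the operad of graph operations. -/
class GAlgebra (A : Type u) [AddCommGroup A] [Module ℂ A] where
  /-- the multilinear map `Z_g` -/
  Z : ∀ {K : ℕ}, GraphOp K → MultilinearMap ℂ (fun _ : Fin K => A) A
  Z_iso : ∀ {K : ℕ} (g h : GraphOp K), g.Iso h → Z g = Z h
  Z_ident : ∀ a : Fin 1 → A, Z GraphOp.ident a = a 0
  Z_comp : ∀ {K : ℕ} (g : GraphOp K) {L : Fin K → ℕ} (h : ∀ i, GraphOp (L i))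
    (a : ∀ i, Fin (L i) → A),
    Z g (fun i => Z (h i) (a i)) =
      Z (g.comp h) (fun m => a (finSigmaFinEquiv.symm m).1 (finSigmaFinEquiv.symm m).2)
  Z_perm : ∀ {K : ℕ} (g : GraphOp K) (σ : Equiv.Perm (Fin K)) (a : Fin K → A),
    Z g a = Z (g.perm σ) (fun i => a (σ⁻¹ i))

/-- The unit `𝕀 = Z_0(1)` of a `𝒢`-algebra. -/
def GAlgebra.unit (A : Type u) [AddCommGroup A] [Module ℂ A] [GAlgebra A] : A :=
  GAlgebra.Z GraphOp.point (fun i => i.elim0)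

/-- A `𝒢*`-algebra: a `𝒢`-algebra with a compatible antilinear involution. -/
class GStarAlgebra (A : Type u) [AddCommGroup A] [Module ℂ A] [StarAddMonoid A]
    [StarModule ℂ A] extends GAlgebra A where
  star_Z : ∀ {K : ℕ} (g : GraphOp K) (a : Fin K → A),
    star (Z g a) = Z g.adjoint (fun i => star (a i))

/-- A subspace is a `𝒢`-subalgebra if it is stable by the action of `𝒢`. -/
def IsGSubalgebra {A : Type u} [AddCommGroup A] [Module ℂ A] [GAlgebra A]
    (S : Submodule ℂ A) : Prop :=
  ∀ (K : ℕ) (g : GraphOp K) (a : Fin K → A), (∀ i, a i ∈ S) → GAlgebra.Z g a ∈ S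

/-! ### Graph monomials and graph polynomials -/

/-- A concrete `n`-graph monomial with labels in `X`: a finite connected oriented graph, with
edges labelled by `X` and a tuple of `n` (not necessarily distinct) vertices, the outputs. -/
structure PreMonomial (X : Type u) (n : ℕ) : Type (max 1 u) where
  V : Type
  E : Type
  finV : Finite V
  finE : Finite E
  src : E → V
  tgt : E → V
  label : E → X
  out : Fin n → V
  conn : IsConn src tgt

namespace PreMonomial

variable {X : Type u} {Y : Type v} {n : ℕ}

/-- Isomorphism of labelled graphs with outputs. -/
def Iso (t s : PreMonomial X n) : Prop :=
  ∃ (f : t.V ≃ s.V) (h : t.E ≃ s.E), (∀ e, f (t.src e) = s.src (h e)) ∧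
    (∀ e, f (t.tgt e) = s.tgt (h e)) ∧ (∀ e, t.label e = s.label (h e)) ∧
    (∀ i, f (t.out i) = s.out i)

instance setoid (X : Type u) (n : ℕ) : Setoid (PreMonomial X n) where
  r := Iso
  iseqv := by
    refine ⟨fun t => ⟨Equiv.refl _, Equiv.refl _, by simp⟩, ?_, ?_⟩
    · rintro t s ⟨f, h, h1, h2, h3, h4⟩
      refine ⟨f.symm, h.symm, fun e => ?_, fun e => ?_, fun e => ?_, fun i => ?_⟩
      · rw [Equiv.symm_apply_eq, h1, Equiv.apply_symm_apply]
      · rw [Equiv.symm_apply_eq, h2, Equiv.apply_symm_apply]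
      · rw [h3, Equiv.apply_symm_apply]
      · rw [Equiv.symm_apply_eq, h4]
    · rintro t s r ⟨f, h, h1, h2, h3, h4⟩ ⟨f', h', h1', h2', h3', h4'⟩
      exact ⟨f.trans f', h.trans h', by simp [h1, h1'], by simp [h2, h2'],
        by simp [h3, h3'], by simp [h4, h4']⟩

/-- Relabelling of the edges. -/
def mapLabel (f : X → Y) (t : PreMonomial X n) : PreMonomial Y n :=
  { t with label := fun e => f (t.label e) }

/-- Forget the outputs. -/
def forget (t : PreMonomial X n) : PreMonomial X 0 :=
  { t with out := fun i => i.elim0 }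

/-- The graph obtained by identifying the vertices related by `r`. -/
def glue (t : PreMonomial X n) (r : t.V → t.V → Prop) : PreMonomial X n where
  V := Quot r
  E := t.E
  finV := by
    have := t.finV
    infer_instance
  finE := t.finE
  src := fun e => Quot.mk r (t.src e)
  tgt := fun e => Quot.mk r (t.tgt e)
  label := t.label
  out := fun i => Quot.mk r (t.out i)
  conn := t.conn.quot r

/-- The quotient `t^π` of `t` by a partition `π` of its vertices; partitions of a set are
encoded by equivalence relations. -/
def quotient (t : PreMonomial X n) (π : Setoid t.V) : PreMonomial X n :=
  t.glue (fun a b => π a b)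

/-- The quotient of `t` by a partition `π` of its tuple of outputs. -/
def glueOut (π : Setoid (Fin n)) (t : PreMonomial X n) : PreMonomial X n :=
  t.glue (fun a b => ∃ i k, π i k ∧ t.out i = a ∧ t.out k = b)

/-- The adjoint `t*`: reverse the edges and take the adjoints of the labels. -/
def adjoint [Star X] (t : PreMonomial X n) : PreMonomial X n :=
  { t with
    src := t.tgt
    tgt := t.src
    label := fun e => star (t.label e)
    conn := t.conn.swap }

/-- The graph `t | s` without outputs, obtained by merging the `i`-th outputs of `t` and `s` for
each `i`. It is connected because there is at least one output. -/
def merge (t s : PreMonomial X (n + 1)) : PreMonomial X 0 where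
  V := Quot (fun a b : t.V ⊕ s.V => ∃ i, a = Sum.inl (t.out i) ∧ b = Sum.inr (s.out i))
  E := t.E ⊕ s.E
  finV := by
    have := t.finV
    have := s.finV
    infer_instance
  finE := by
    have := t.finE
    have := s.finE
    infer_instance
  src := fun e => Quot.mk _ (Sum.map t.src s.src e)
  tgt := fun e => Quot.mk _ (Sum.map t.tgt s.tgt e)
  label := Sum.elim t.label s.label
  out := fun i => i.elim0
  conn := by
    have : Nonempty (t.V ⊕ s.V) := ⟨Sum.inl (t.out 0)⟩
    refine IsConn.of_glue (src := Sum.map t.src s.src) (tgt := Sum.map t.tgt s.tgt) _ ?_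
    set R := fun a b : t.V ⊕ s.V =>
      (∃ i, a = Sum.inl (t.out i) ∧ b = Sum.inr (s.out i)) ∨
        EdgeStep (Sum.map t.src s.src) (Sum.map t.tgt s.tgt) a b with hR
    have h1 : ∀ x y, Relation.EqvGen R (Sum.inl x) (Sum.inl y) := fun x y =>
      EqvGen.map Sum.inl (by
        rintro _ _ ⟨e, rfl, rfl⟩
        exact Relation.EqvGen.rel _ _ (Or.inr ⟨Sum.inl e, rfl, rfl⟩)) (t.conn.2 x y)
    have h2 : ∀ x y, Relation.EqvGen R (Sum.inr x) (Sum.inr y) := fun x y =>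
      EqvGen.map Sum.inr (by
        rintro _ _ ⟨e, rfl, rfl⟩
        exact Relation.EqvGen.rel _ _ (Or.inr ⟨Sum.inr e, rfl, rfl⟩)) (s.conn.2 x y)
    have h3 : ∀ x y, Relation.EqvGen R (Sum.inl x) (Sum.inr y) := fun x y =>
      Relation.EqvGen.trans _ _ _ (h1 x (t.out 0)) (Relation.EqvGen.trans _ _ _
        (Relation.EqvGen.rel _ _ (Or.inl ⟨0, rfl, rfl⟩)) (h2 (s.out 0) y))
    rintro (x | x) (y | y)
    · exact h1 x y
    · exact h3 x y
    · exact Relation.EqvGen.symm _ _ (h3 y x)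
    · exact h2 x y

theorem mapLabel_iso (f : X → Y) {t s : PreMonomial X n} (h : t ≈ s) :
    t.mapLabel f ≈ s.mapLabel f := by
  obtain ⟨a, b, h1, h2, h3, h4⟩ := h
  exact ⟨a, b, h1, h2, fun e => congrArg f (h3 e), h4⟩

theorem forget_iso {t s : PreMonomial X n} (h : t ≈ s) : t.forget ≈ s.forget := by
  obtain ⟨a, b, h1, h2, h3, h4⟩ := h
  exact ⟨a, b, h1, h2, h3, fun i => i.elim0⟩

theorem glueOut_iso (π : Setoid (Fin n)) {t s : PreMonomial X n} (h : t ≈ s) :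
    t.glueOut π ≈ s.glueOut π := by
  obtain ⟨a, b, h1, h2, h3, h4⟩ := h
  refine ⟨Quot.congr a ?_, b, fun e => ?_, fun e => ?_, h3, fun i => ?_⟩
  · intro x y
    refine exists_congr fun i => exists_congr fun k => and_congr_right fun _ => ?_
    rw [← h4, ← h4, a.apply_eq_iff_eq, a.apply_eq_iff_eq]
  · exact congrArg (Quot.mk _) (h1 e)
  · exact congrArg (Quot.mk _) (h2 e)
  · exact congrArg (Quot.mk _) (h4 i)

theorem adjoint_iso [Star X] {t s : PreMonomial X n} (h : t ≈ s) :
    t.adjoint ≈ s.adjoint := by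
  obtain ⟨a, b, h1, h2, h3, h4⟩ := h
  exact ⟨a, b, h2, h1, fun e => congrArg star (h3 e), h4⟩

theorem merge_iso {t t' s s' : PreMonomial X (n + 1)} (h : t ≈ t') (h' : s ≈ s') :
    t.merge s ≈ t'.merge s' := by
  obtain ⟨a, b, h1, h2, h3, h4⟩ := h
  obtain ⟨a', b', h1', h2', h3', h4'⟩ := h'
  refine ⟨Quot.congr (Equiv.sumCongr a a') ?_, Equiv.sumCongr b b', ?_, ?_, ?_,
    fun i => i.elim0⟩
  · intro x y
    refine exists_congr fun i => ?_
    rw [← h4, ← h4']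
    rcases x with x | x <;> rcases y with y | y <;> simp
  · rintro (e | e)
    · exact congrArg (fun x => Quot.mk _ (Sum.inl x)) (h1 e)
    · exact congrArg (fun x => Quot.mk _ (Sum.inr x)) (h1' e)
  · rintro (e | e)
    · exact congrArg (fun x => Quot.mk _ (Sum.inl x)) (h2 e)
    · exact congrArg (fun x => Quot.mk _ (Sum.inr x)) (h2' e)
  · rintro (e | e)
    · exact h3 e
    · exact h3' e

end PreMonomial

/-- `n`-graph monomials with labels in `X`, up to isomorphism. -/
def GraphMonomial (X : Type u) (n : ℕ) : Type (max 1 u) :=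
  Quotient (PreMonomial.setoid X n)

namespace GraphMonomial

variable {X : Type u} {Y : Type v} {n : ℕ}

/-- The isomorphism class of a labelled graph. -/
def mk (t : PreMonomial X n) : GraphMonomial X n := Quotient.mk _ t

/-- A representative of an isomorphism class. -/
noncomputable def rep (m : GraphMonomial X n) : PreMonomial X n := Quotient.out m

def mapLabel (f : X → Y) : GraphMonomial X n → GraphMonomial Y n :=
  Quotient.map (PreMonomial.mapLabel f) fun _ _ h => PreMonomial.mapLabel_iso f h

def forget : GraphMonomial X n → GraphMonomial X 0 :=
  Quotient.map PreMonomial.forget fun _ _ h => PreMonomial.forget_iso h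

def glueOut (π : Setoid (Fin n)) : GraphMonomial X n → GraphMonomial X n :=
  Quotient.map (PreMonomial.glueOut π) fun _ _ h => PreMonomial.glueOut_iso π h

def adjoint [Star X] : GraphMonomial X n → GraphMonomial X n :=
  Quotient.map PreMonomial.adjoint fun _ _ h => PreMonomial.adjoint_iso h

def merge : GraphMonomial X (n + 1) → GraphMonomial X (n + 1) → GraphMonomial X 0 :=
  Quotient.map₂ PreMonomial.merge fun _ _ h _ _ h' => PreMonomial.merge_iso h h'

end GraphMonomial

/-- The space `ℂ𝒢⁽ⁿ⁾⟨X⟩` of `n`-graph polynomials: formal complex linear combinations of `n`-graph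
monomials. (Also when `X` is a vector space, the labels are formal.) -/
abbrev GraphPoly (X : Type u) (n : ℕ) : Type (max 1 u) := GraphMonomial X n →₀ ℂ

namespace GraphPoly

variable {X : Type u} {Y : Type v} {n : ℕ}

/-- Linear extension of the relabelling of edges. -/
noncomputable def mapLabel (f : X → Y) : GraphPoly X n →ₗ[ℂ] GraphPoly Y n :=
  Finsupp.lmapDomain ℂ ℂ (GraphMonomial.mapLabel f)

/-- Linear extension of the map forgetting the outputs. -/
noncomputable def forget : GraphPoly X n →ₗ[ℂ] GraphPoly X 0 :=
  Finsupp.lmapDomain ℂ ℂ GraphMonomial.forget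

/-- The linear map `Δ_π`, for a partition `π` of `{1, …, n}`. -/
noncomputable def glueOut (π : Setoid (Fin n)) : GraphPoly X n →ₗ[ℂ] GraphPoly X n :=
  Finsupp.lmapDomain ℂ ℂ (GraphMonomial.glueOut π)

/-- The antilinear extension of `t ↦ t*`. -/
noncomputable def adjoint [Star X] (t : GraphPoly X n) : GraphPoly X n :=
  t.sum fun m c => Finsupp.single m.adjoint (star c)

/-- The bilinear extension of `(t, s) ↦ t | s`. -/
noncomputable def merge (t s : GraphPoly X (n + 1)) : GraphPoly X 0 :=
  t.sum fun m c => s.sum fun m' c' => Finsupp.single (m.merge m') (c * c')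

end GraphPoly

/-! ### Spaces of traffics -/

/-- An algebraic space of traffics: a `𝒢`-algebra with a unital, input-independent linear
functional. -/
structure AlgTrafficSpace (A : Type u) [AddCommGroup A] [Module ℂ A] [GAlgebra A] where
  Φ : A →ₗ[ℂ] ℂ
  unital : Φ (GAlgebra.unit A) = 1
  input_indep : ∀ {K : ℕ} (g : GraphOp K) (x : g.diag.V) (a : Fin K → A),
    Φ (GAlgebra.Z g a) = Φ (GAlgebra.Z (g.diag.rootAt x) a)

/-- The graph operation of a graph `t`, for an enumeration of its edges and a vertex chosen as
input and output. -/
def PreMonomial.toOp {X : Type u} {n K : ℕ} (t : PreMonomial X n) (e : Fin K ≃ t.E) (x : t.V) :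
    GraphOp K where
  V := t.V
  finV := t.finV
  src := fun i => t.src (e i)
  tgt := fun i => t.tgt (e i)
  inp := x
  out := x
  conn := ⟨⟨x⟩, fun a b => EqvGen.map id (fun _ _ h => Relation.EqvGen.rel _ _ (by
    obtain ⟨f, rfl, rfl⟩ := h
    exact ⟨e.symm f, by simp, by simp⟩)) (t.conn.2 a b)⟩

/-- An arbitrary enumeration of the edges. -/
noncomputable def PreMonomial.enum {X : Type u} {n : ℕ} (t : PreMonomial X n) :
    Fin (Nat.card t.E) ≃ t.E :=
  have := t.finE
  (Finite.equivFin t.E).symm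

namespace AlgTrafficSpace

variable {A : Type u} [AddCommGroup A] [Module ℂ A] [GAlgebra A] (T : AlgTrafficSpace A)

/-- The value `Φ(Z_g(γ(e₁) ⊗ ⋯ ⊗ γ(e_K)))` of the distribution of traffics at a graph, computed
with an enumeration of the edges and a vertex chosen as input and output. -/
noncomputable def eval {n K : ℕ} (t : PreMonomial A n) (e : Fin K ≃ t.E) (x : t.V) : ℂ :=
  T.Φ (GAlgebra.Z (t.toOp e x) fun i => t.label (e i))

/-- The distribution of traffics `τ : ℂ𝒢⁽⁰⁾⟨A⟩ → ℂ`; the enumeration of the edges and the vertex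
chosen as input and output are arbitrary. -/
noncomputable def τ : GraphPoly A 0 →ₗ[ℂ] ℂ :=
  Finsupp.linearCombination ℂ fun m : GraphMonomial A 0 =>
    T.eval m.rep m.rep.enum (Classical.choice m.rep.conn.1)

end AlgTrafficSpace

theorem PreMonomial.toOp_diag_iso {X : Type u} {n K : ℕ} (t : PreMonomial X n)
    (e : Fin K ≃ t.E) (x z : t.V) :
    (t.toOp e z).Iso ((t.toOp e x).diag.rootAt (Quot.mk _ z)) := by
  refine ⟨⟨fun v => Quot.mk _ v, Quot.lift id ?_, fun _ => rfl, ?_⟩, fun _ => rfl,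
    fun _ => rfl, rfl, rfl⟩
  · exact fun a b h => h.1.trans h.2.symm
  · exact fun q => Quot.inductionOn q fun _ => rfl

namespace AlgTrafficSpace
variable {A : Type u} [AddCommGroup A] [Module ℂ A] [GAlgebra A] (T : AlgTrafficSpace A)

theorem eval_root {n K : ℕ} (t : PreMonomial A n) (e : Fin K ≃ t.E) (x y : t.V) :
    T.eval t e x = T.eval t e y := by
  have h : ∀ z, T.eval t e z = T.eval t e x := by
    intro z
    unfold eval
    rw [T.input_indep (t.toOp e x) (Quot.mk _ z)]
    refine congrArg T.Φ ?_
    refine congrArg (fun z : MultilinearMap ℂ (fun _ : Fin K => A) A => z _)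
      (GAlgebra.Z_iso _ _ ?_)
    refine PreMonomial.toOp_diag_iso t e x z
  rw [h y]

theorem eval_enum {n K : ℕ} (t : PreMonomial A n) (e e' : Fin K ≃ t.E) (x : t.V) :
    T.eval t e x = T.eval t e' x := by
  unfold eval
  let σ : Equiv.Perm (Fin K) := e.trans e'.symm
  rw [GAlgebra.Z_perm (t.toOp e x) σ]
  have h1 : ∀ i, e (σ⁻¹ i) = e' i := by
    intro i
    simp [σ, Equiv.Perm.inv_def]
  simp_rw [h1]
  refine congrArg T.Φ ?_
  refine congrArg (fun z : MultilinearMap ℂ (fun _ : Fin K => A) A => z _) (GAlgebra.Z_iso _ _ ?_)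
  exact ⟨Equiv.refl _, fun i => congrArg t.src (h1 i), fun i => congrArg t.tgt (h1 i), rfl, rfl⟩

theorem eval_iso {n K K0 : ℕ} {s t : PreMonomial A n} (f : s.V ≃ t.V) (h : s.E ≃ t.E)
    (h1 : ∀ e, f (s.src e) = t.src (h e)) (h2 : ∀ e, f (s.tgt e) = t.tgt (h e))
    (h3 : ∀ e, s.label e = t.label (h e)) (e0 : Fin K0 ≃ s.E) (e : Fin K ≃ t.E)
    (x0 : s.V) (x : t.V) : T.eval s e0 x0 = T.eval t e x := by
  have hK : K0 = K := by
    simpa using Nat.card_congr ((e0.trans h).trans e.symm)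
  subst hK
  rw [T.eval_enum s e0 (e.trans h.symm) x0, T.eval_root t e x (f x0)]
  unfold eval
  have h4 : ∀ i, h ((e.trans h.symm) i) = e i := by simp
  simp_rw [h3, h4]
  refine congrArg T.Φ ?_
  refine congrArg (fun z : MultilinearMap ℂ (fun _ => A) A => z _) (GAlgebra.Z_iso _ _ ?_)
  refine ⟨f, fun i => ?_, fun i => ?_, rfl, rfl⟩
  · exact (h1 _).trans (congrArg t.src (h4 i))
  · exact (h2 _).trans (congrArg t.tgt (h4 i))

/-- The distribution of traffics does not depend on the choices in its definition. -/
theorem τ_single {K : ℕ} (t : PreMonomial A 0) (e : Fin K ≃ t.E) (x : t.V) :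
    T.τ (Finsupp.single (GraphMonomial.mk t) 1) = T.eval t e x := by
  unfold τ
  rw [Finsupp.linearCombination_single, one_smul]
  obtain ⟨f, h, h1, h2, h3, -⟩ :
      PreMonomial.Iso (GraphMonomial.mk t).rep t := Quotient.exact (Quotient.out_eq (GraphMonomial.mk t))
  exact T.eval_iso f h h1 h2 h3 _ e _ x


end AlgTrafficSpace

open scoped ComplexOrder in
/-- A space of traffics: an algebraic space of traffics on a `𝒢*`-algebra whose distribution of
traffics satisfies the positivity condition. -/
structure TrafficSpace (A : Type u) [AddCommGroup A] [Module ℂ A] [StarAddMonoid A]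
    [StarModule ℂ A] [GStarAlgebra A] extends AlgTrafficSpace A where
  positivity : ∀ {n : ℕ} (t : GraphPoly A (n + 1)), 0 ≤ toAlgTrafficSpace.τ (t.merge t.adjoint)

/-! ### Injective version, free product and traffic independence -/

noncomputable instance PreMonomial.fintypeSetoid {X : Type u} {n : ℕ} (t : PreMonomial X n) :
    Fintype (Setoid t.V) :=
  have := t.finV
  have : Finite (Setoid t.V) :=
    Finite.of_injective (fun (π : Setoid t.V) (a b : t.V) => π a b)
      fun _ _ h => Setoid.ext fun a b => iff_of_eq (congrFun (congrFun h a) b)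
  Fintype.ofFinite _

open Classical in
/-- The Möbius function between the partition into singletons and `π`, in the poset of partitions
of the vertex set. -/
noncomputable def PreMonomial.mob {X : Type u} {n : ℕ} (t : PreMonomial X n)
    (π : Setoid t.V) : ℂ :=
  letI : LocallyFiniteOrder (Setoid t.V) := Fintype.toLocallyFiniteOrder
  IncidenceAlgebra.mu ℂ (⊥ : Setoid t.V) π

/-- The injective version `τ⁰` of a linear form `τ` on `0`-graph polynomials. -/
noncomputable def injVersion {X : Type u} (τ : GraphPoly X 0 →ₗ[ℂ] ℂ) :
    GraphPoly X 0 →ₗ[ℂ] ℂ :=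
  Finsupp.linearCombination ℂ fun m : GraphMonomial X 0 =>
    ∑ π : Setoid m.rep.V, m.rep.mob π *
      τ (Finsupp.single (GraphMonomial.mk (m.rep.quotient π)) 1)

/-- The bipartite simple graph on `α ⊕ β` whose edges are given by `R`. -/
def bipartiteGraph {α : Type} {β : Type} (R : α → β → Prop) : SimpleGraph (α ⊕ β) where
  Adj
    | Sum.inl a, Sum.inr b => R a b
    | Sum.inr b, Sum.inl a => R a b
    | _, _ => False
  symm := ⟨by rintro (a | b) (a' | b') h <;> exact h⟩
  loopless := ⟨by rintro (a | b) h <;> exact h⟩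

namespace PreMonomial

variable {J : Type v} {X : J → Type u} (t : PreMonomial (Σ j, X j) 0)

/-- The edge `e` is incident to the vertex `x`. -/
def Incident {Y : Type w} {n : ℕ} (t : PreMonomial Y n) (e : t.E) (x : t.V) : Prop :=
  t.src e = x ∨ t.tgt e = x

/-- Two edges with the same colour and a common vertex. -/
def SameComp (e f : t.E) : Prop :=
  (t.label e).1 = (t.label f).1 ∧ ∃ x, t.Incident e x ∧ t.Incident f x

/-- The coloured components: the maximal connected subgraphs with at least one edge, all edges of
which have the same colour. They are encoded by their sets of edges. -/
def Component : Type := Quot t.SameComp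

instance : Finite t.Component :=
  have := t.finE
  inferInstanceAs (Finite (Quot t.SameComp))

/-- The coloured component of an edge. -/
def compOf (e : t.E) : t.Component := Quot.mk _ e

/-- The colour of a component. -/
def color (S : t.Component) : J :=
  Quot.lift (fun e => (t.label e).1) (fun _ _ h => h.1) S

/-- The vertex `x` belongs to the component `S`. -/
def Mem (S : t.Component) (x : t.V) : Prop :=
  ∃ e, t.compOf e = S ∧ t.Incident e x

/-- The connectors: the vertices which belong to at least two components. -/
def IsConnector (x : t.V) : Prop :=
  ∃ S S' : t.Component, S ≠ S' ∧ t.Mem S x ∧ t.Mem S' x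

/-- The graph of coloured components. -/
def compGraph : SimpleGraph (t.Component ⊕ {x : t.V // t.IsConnector x}) :=
  bipartiteGraph fun S x => t.Mem S x.1

/-- A label of colour `j`, as an element of `X j`. -/
def castLabel {j : J} (y : Σ j, X j) (h : y.1 = j) : X j := h ▸ y.2

theorem color_compOf (e : t.E) : t.color (t.compOf e) = (t.label e).1 := rfl

/-- A coloured component, as a graph labelled by the set of its colour. -/
def component (S : t.Component) : PreMonomial (X (t.color S)) 0 where
  V := {x : t.V // t.Mem S x}
  E := {e : t.E // t.compOf e = S}
  finV := by
    have := t.finV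
    infer_instance
  finE := by
    have := t.finE
    infer_instance
  src := fun e => ⟨t.src e.1, e.1, e.2, Or.inl rfl⟩
  tgt := fun e => ⟨t.tgt e.1, e.1, e.2, Or.inr rfl⟩
  label := fun e => castLabel (t.label e.1) (by rw [← t.color_compOf, e.2])
  out := fun i => i.elim0
  conn := by
    set R := EdgeStep (fun e : {e : t.E // t.compOf e = S} =>
        (⟨t.src e.1, e.1, e.2, Or.inl rfl⟩ : {x : t.V // t.Mem S x}))
        (fun e => ⟨t.tgt e.1, e.1, e.2, Or.inr rfl⟩) with hR
    have one : ∀ (e : t.E) (he : t.compOf e = S) (x y : t.V) (hx : t.Incident e x)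
        (hy : t.Incident e y), Relation.EqvGen R ⟨x, e, he, hx⟩ ⟨y, e, he, hy⟩ := by
      intro e he x y hx hy
      have key : Relation.EqvGen R ⟨t.src e, e, he, Or.inl rfl⟩ ⟨t.tgt e, e, he, Or.inr rfl⟩ :=
        Relation.EqvGen.rel _ _ ⟨⟨e, he⟩, rfl, rfl⟩
      rcases hx with rfl | rfl <;> rcases hy with rfl | rfl
      · exact Relation.EqvGen.refl _
      · exact key
      · exact Relation.EqvGen.symm _ _ key
      · exact Relation.EqvGen.refl _
    have main : ∀ e f : t.E, Relation.EqvGen t.SameComp e f → ∀ (he : t.compOf e = S)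
        (hf : t.compOf f = S) (x y : t.V) (hx : t.Incident e x) (hy : t.Incident f y),
        Relation.EqvGen R ⟨x, e, he, hx⟩ ⟨y, f, hf, hy⟩ := by
      intro e f hef
      induction hef with
      | rel e f h =>
        intro he hf x y hx hy
        obtain ⟨-, z, hz, hz'⟩ := h
        exact Relation.EqvGen.trans _ _ _ (one e he x z hx hz) (one f hf z y hz' hy)
      | refl e =>
        intro he hf x y hx hy
        exact one e he x y hx hy
      | symm e f _ ih =>
        intro he hf x y hx hy
        exact Relation.EqvGen.symm _ _ (ih hf he y x hy hx)
      | trans e f k h1 h2 ih1 ih2 =>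
        intro he hk x y hx hy
        have hf : t.compOf f = S := by
          rw [← he]; exact (Quot.eqvGen_sound h1).symm
        exact Relation.EqvGen.trans _ _ _ (ih1 he hf x (t.src f) hx (Or.inl rfl))
          (ih2 hf hk _ y (Or.inl rfl) hy)
    refine ⟨?_, ?_⟩
    · induction S using Quot.ind with
      | mk e => exact ⟨⟨t.src e, e, rfl, Or.inl rfl⟩⟩
    · rintro ⟨x, e, he, hx⟩ ⟨y, f, hf, hy⟩
      exact main e f (Quot.eqvGen_exact (he.trans hf.symm)) he hf x y hx hy

end PreMonomial

section FreeProduct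

variable {J : Type v} {X : J → Type u}

open Classical in
/-- The injective version of the free product `⋆ⱼ τⱼ`, at a graph `t`. Since `t` is connected, so is
its graph of coloured components, which is hence a tree exactly when it has no cycle (for the graph
with one vertex and no edge it is empty, and the value is `1`). -/
noncomputable def freeProductInj (τ : ∀ j, GraphPoly (X j) 0 →ₗ[ℂ] ℂ)
    (t : PreMonomial (Σ j, X j) 0) : ℂ :=
  letI : Fintype t.Component := Fintype.ofFinite _
  if t.compGraph.IsAcyclic then
    ∏ S : t.Component,
      injVersion (τ (t.color S)) (Finsupp.single (GraphMonomial.mk (t.component S)) 1)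
  else 0

/-- The free product `⋆ⱼ τⱼ` of linear forms on `0`-graph polynomials. -/
noncomputable def freeProduct (τ : ∀ j, GraphPoly (X j) 0 →ₗ[ℂ] ℂ) :
    GraphPoly (Σ j, X j) 0 →ₗ[ℂ] ℂ :=
  Finsupp.linearCombination ℂ fun m : GraphMonomial (Σ j, X j) 0 =>
    ∑ π : Setoid m.rep.V, freeProductInj τ (m.rep.quotient π)

end FreeProduct

/-- Traffic independence of a family of `𝒢`-subalgebras, with respect to the distribution of
traffics `τ`: on graphs with edges labelled by the disjoint union of the `S j`, the distribution `τ`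
is the free product of its restrictions to the `S j`. -/
def TrafficIndep {A : Type u} [AddCommGroup A] [Module ℂ A] (τ : GraphPoly A 0 →ₗ[ℂ] ℂ)
    {J : Type v} (S : J → Submodule ℂ A) : Prop :=
  τ ∘ₗ GraphPoly.mapLabel (fun y : Σ j, S j => (y.2 : A)) =
    freeProduct (X := fun j => S j) fun j => τ ∘ₗ GraphPoly.mapLabel (fun a : S j => (a : A))

/-! ### Bigraph operations -/

/-- An `(L, n)`-bigraph operation whose inputs have degrees `d`: a finite connected bipartite graph
on `L` ordered inputs and a set `C` of connectors, with an ordering of the edges around each input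
(`nbr ℓ k` is the connector at the end of the `k`-th edge around the input `ℓ`), and `n` distinct
ordered connectors, the outputs; the other connectors have degree at least `2`. -/
structure BigraphOp (L : ℕ) (d : Fin L → ℕ) (n : ℕ) : Type 1 where
  C : Type
  finC : Finite C
  d_pos : ∀ ℓ, 0 < d ℓ
  nbr : ∀ ℓ, Fin (d ℓ) → C
  nbr_inj : ∀ ℓ, Function.Injective (nbr ℓ)
  out : Fin n → C
  out_inj : Function.Injective out
  conn : (bipartiteGraph fun (ℓ : Fin L) (c : C) => ∃ k, nbr ℓ k = c).Connected
  two_le_degree : ∀ c : C, (∀ i, out i ≠ c) → 2 ≤ {ℓ : Fin L | ∃ k, nbr ℓ k = c}.ncard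

namespace BigraphOp

variable {L : ℕ} {d : Fin L → ℕ} {n : ℕ} {X : Type u}

/-- The gluing relation of `T_g`: the `k`-th output of the graph replacing the input `ℓ` is glued to
the `k`-th neighbour of `ℓ`. -/
inductive SubstRel (g : BigraphOp L d n) (t : ∀ ℓ, PreMonomial X (d ℓ)) :
    (g.C ⊕ Σ ℓ, (t ℓ).V) → (g.C ⊕ Σ ℓ, (t ℓ).V) → Prop
  | mk (ℓ : Fin L) (k : Fin (d ℓ)) :
      SubstRel g t (Sum.inl (g.nbr ℓ k)) (Sum.inr ⟨ℓ, (t ℓ).out k⟩)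

/-- The `n`-graph monomial `T_g(t₁ ⊗ ⋯ ⊗ t_L)`, for graph monomials `t₁, …, t_L`. -/
def subst (g : BigraphOp L d n) (t : ∀ ℓ, PreMonomial X (d ℓ)) : PreMonomial X n where
  V := Quot (SubstRel g t)
  E := Σ ℓ, (t ℓ).E
  finV := by
    have := g.finC
    have := fun ℓ => (t ℓ).finV
    infer_instance
  finE := by
    have := fun ℓ => (t ℓ).finE
    infer_instance
  src := fun e => Quot.mk _ (Sum.inr ⟨e.1, (t e.1).src e.2⟩)
  tgt := fun e => Quot.mk _ (Sum.inr ⟨e.1, (t e.1).tgt e.2⟩)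
  label := fun e => (t e.1).label e.2
  out := fun i => Quot.mk _ (Sum.inl (g.out i))
  conn := by
    let s : (Σ ℓ, (t ℓ).E) → (g.C ⊕ Σ ℓ, (t ℓ).V) := fun e => Sum.inr ⟨e.1, (t e.1).src e.2⟩
    let r : (Σ ℓ, (t ℓ).E) → (g.C ⊕ Σ ℓ, (t ℓ).V) := fun e => Sum.inr ⟨e.1, (t e.1).tgt e.2⟩
    let R := fun a b => SubstRel g t a b ∨ EdgeStep s r a b
    let p : Fin L ⊕ g.C → (g.C ⊕ Σ ℓ, (t ℓ).V) :=
      Sum.elim (fun ℓ => Sum.inr ⟨ℓ, (t ℓ).out ⟨0, g.d_pos ℓ⟩⟩) Sum.inl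
    have inner : ∀ ℓ (x y : (t ℓ).V),
        Relation.EqvGen R (Sum.inr ⟨ℓ, x⟩) (Sum.inr ⟨ℓ, y⟩) := by
      intro ℓ x y
      refine EqvGen.map (fun x => (Sum.inr ⟨ℓ, x⟩ : g.C ⊕ Σ ℓ, (t ℓ).V)) ?_ ((t ℓ).conn.2 x y)
      rintro _ _ ⟨e, rfl, rfl⟩
      exact Relation.EqvGen.rel _ _ (Or.inr ⟨⟨ℓ, e⟩, rfl, rfl⟩)
    have edge : ∀ ℓ k, Relation.EqvGen R (p (Sum.inl ℓ)) (p (Sum.inr (g.nbr ℓ k))) := by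
      intro ℓ k
      exact Relation.EqvGen.trans _ _ _ (inner ℓ _ ((t ℓ).out k))
        (Relation.EqvGen.symm _ _ (Relation.EqvGen.rel _ _ (Or.inl (SubstRel.mk ℓ k))))
    have adj : ∀ a b, (bipartiteGraph fun (ℓ : Fin L) (c : g.C) => ∃ k, g.nbr ℓ k = c).Adj a b →
        Relation.EqvGen R (p a) (p b) := by
      rintro (a | a) (b | b) h
      · exact h.elim
      · obtain ⟨k, rfl⟩ := h
        exact edge a k
      · obtain ⟨k, rfl⟩ := h
        exact Relation.EqvGen.symm _ _ (edge b k)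
      · exact h.elim
    have walk : ∀ a b, Relation.EqvGen R (p a) (p b) := by
      intro a b
      obtain ⟨q⟩ := g.conn.preconnected a b
      induction q with
      | nil => exact Relation.EqvGen.refl _
      | cons h _ ih => exact Relation.EqvGen.trans _ _ _ (adj _ _ h) ih
    have base : ∀ z, ∃ a, Relation.EqvGen R z (p a) := by
      rintro (c | ⟨ℓ, x⟩)
      · exact ⟨Sum.inr c, Relation.EqvGen.refl _⟩
      · exact ⟨Sum.inl ℓ, inner ℓ _ _⟩
    have : Nonempty (g.C ⊕ Σ ℓ, (t ℓ).V) := g.conn.nonempty.map p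
    refine IsConn.of_glue (src := s) (tgt := r) (SubstRel g t) fun z z' => ?_
    obtain ⟨a, ha⟩ := base z
    obtain ⟨b, hb⟩ := base z'
    exact Relation.EqvGen.trans _ _ _ ha
      (Relation.EqvGen.trans _ _ _ (walk a b) (Relation.EqvGen.symm _ _ hb))

theorem subst_iso (g : BigraphOp L d n) {t s : ∀ ℓ, PreMonomial X (d ℓ)} (h : ∀ ℓ, t ℓ ≈ s ℓ) :
    g.subst t ≈ g.subst s := by
  choose a b h1 h2 h3 h4 using h
  refine ⟨Quot.congr (Equiv.sumCongr (Equiv.refl _) (Equiv.sigmaCongrRight a)) ?_,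
    Equiv.sigmaCongrRight b, ?_, ?_, ?_, fun _ => rfl⟩
  · intro x y
    constructor
    · rintro ⟨ℓ, k⟩
      have := SubstRel.mk (g := g) (t := s) ℓ k
      rw [← h4] at this
      exact this
    · intro h
      generalize hx : (Equiv.sumCongr (Equiv.refl _) (Equiv.sigmaCongrRight a)) x = x' at h
      generalize hy : (Equiv.sumCongr (Equiv.refl _) (Equiv.sigmaCongrRight a)) y = y' at h
      obtain ⟨ℓ, k⟩ := h
      rw [← Equiv.eq_symm_apply] at hx hy
      subst hx hy
      have := SubstRel.mk (g := g) (t := t) ℓ k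
      have e : (a ℓ).symm ((s ℓ).out k) = (t ℓ).out k := by
        rw [Equiv.symm_apply_eq, h4]
      rw [← e] at this
      exact this
  · rintro ⟨ℓ, e⟩
    exact congrArg (fun x => Quot.mk (SubstRel g s) (Sum.inr ⟨ℓ, x⟩)) (h1 ℓ e)
  · rintro ⟨ℓ, e⟩
    exact congrArg (fun x => Quot.mk (SubstRel g s) (Sum.inr ⟨ℓ, x⟩)) (h2 ℓ e)
  · rintro ⟨ℓ, e⟩
    exact h3 ℓ e

/-- `T_g` on isomorphism classes; it does not depend on the representatives. -/
noncomputable def substMonomial (g : BigraphOp L d n) (m : ∀ ℓ, GraphMonomial X (d ℓ)) :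
    GraphMonomial X n :=
  GraphMonomial.mk (g.subst fun ℓ => (m ℓ).rep)

theorem substMonomial_mk (g : BigraphOp L d n) (t : ∀ ℓ, PreMonomial X (d ℓ)) :
    g.substMonomial (fun ℓ => GraphMonomial.mk (t ℓ)) = GraphMonomial.mk (g.subst t) :=
  Quotient.sound (g.subst_iso fun ℓ => Quotient.exact (Quotient.out_eq (GraphMonomial.mk (t ℓ))))

/-- `T_g(t₁ ⊗ ⋯ ⊗ t_L)` for graph polynomials: the multilinear extension. -/
noncomputable def apply (g : BigraphOp L d n) (t : ∀ ℓ, GraphPoly X (d ℓ)) : GraphPoly X n :=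
  ∑ m ∈ Fintype.piFinset fun ℓ => (t ℓ).support,
    Finsupp.single (g.substMonomial m) (∏ ℓ, t ℓ (m ℓ))

/-- A sequence of graph polynomials, the `ℓ`-th one with labels of colour `γ ℓ`, is `g`-alternated
if two distinct inputs which are neighbours of a same connector have distinct colours. -/
def Alternated (g : BigraphOp L d n) {J : Type v} (γ : Fin L → J) : Prop :=
  ∀ p q : Fin L, p ≠ q → (∃ k l, g.nbr p k = g.nbr q l) → γ p ≠ γ q

end BigraphOp

/-- Graph polynomials which are reduced with respect to a linear form `φ` on `1`-graph polynomials.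
The partition into singletons is `⊥`. -/
def IsReduced {X : Type u} (φ : GraphPoly X 1 →ₗ[ℂ] ℂ) : (n : ℕ) → GraphPoly X n → Prop
  | 0, _ => False
  | 1, t => φ t = 0
  | n + 2, t => ∀ π : Setoid (Fin (n + 2)), π ≠ ⊥ → GraphPoly.glueOut π t = 0

/-- The linear form `φ(t) = τ(t̃)`, where `t̃` is obtained from `t` by forgetting the output. -/
noncomputable def AlgTrafficSpace.φ {A : Type u} [AddCommGroup A] [Module ℂ A] [GAlgebra A]
    (T : AlgTrafficSpace A) : GraphPoly A 1 →ₗ[ℂ] ℂ :=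
  T.τ ∘ₗ GraphPoly.forget

end Traffic

namespace Traffic

open Finset

/-! ### Contractions of labelled graphs -/

/-! Both implications reduce to one fact about the free product: it vanishes at every alternated
substitution of reduced polynomials (`multiSum_freeProduct_eq_zero`).

For that fact, write the free product at `T_g(t₁ ⊗ ⋯ ⊗ t_L)` as the sum, over all partitions `σ` of
the vertices, of the weight of the quotient: a product over coloured components if these form a
tree, and zero otherwise (`freeProduct_single`). Sort the `σ` by the partitions `θ ℓ` which they
induce on the outputs of each piece. If some `θ ℓ` is not `⊥`, the corresponding partial sum sees `t
ℓ` only through `Δ_{θ ℓ}(t ℓ)`, which is zero (`inducedSum_update`, `multiSum_eq_zero`).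

There remain the `σ` which keep the outputs of every piece distinct. Then `g` maps to the graph of
components, and this map is locally injective: around an input because outputs stay distinct, around
a connector because neighbours have different colours. A locally injective map from a connected
graph to a forest is injective. Hence `g` is a tree, and `σ` identifies vertices of two pieces only
through a common connector (`exists_nbr_of_isAcyclic`). So `σ` amounts to a family of partitions of
the pieces, and the sum factorizes (`sum_treeWeight_subst`). A tree has a leaf, which cannot be a
connector since connectors have degree at least two. It is thus an input of degree one, whose factor
is `τ(t̃) = 0`.

Conversely, the difference between `τ` and the free product vanishes at alternated substitutions of
reduced polynomials and on graphs of one colour. Any other graph is the substitution of its coloured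
components, with the connectors as outputs, into its own graph of components. Each component is the
leading term of a reduced polynomial whose other monomials have fewer edges or identified outputs
(`exists_isReduced`). Expanding by multilinearity expresses the value at the graph through values at
strictly smaller graphs, and induction on the number of vertices and edges concludes
(`eq_zero_of_alternated`). -/

theorem mk_quotient_eq {V : Type} (π : Setoid V) {a b : V} :
    Quot.mk (fun a b => π a b) a = Quot.mk (fun a b => π a b) b ↔ π a b :=
  Quotient.eq (r := π)

namespace PreMonomial

variable {X : Type u} {n : ℕ}

/-- A contraction of labelled graphs: a surjection on the vertices and a bijection on the edges. -/
structure Contraction (t s : PreMonomial X n) where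
  vtx : t.V → s.V
  edge : t.E ≃ s.E
  surj : Function.Surjective vtx
  src : ∀ e, vtx (t.src e) = s.src (edge e)
  tgt : ∀ e, vtx (t.tgt e) = s.tgt (edge e)
  label : ∀ e, t.label e = s.label (edge e)
  out : ∀ i, vtx (t.out i) = s.out i

namespace Contraction

theorem exists_of_iso {t s : PreMonomial X n} (h : t ≈ s) :
    ∃ c : Contraction t s, Function.Injective c.vtx := by
  obtain ⟨f, h, h1, h2, h3, h4⟩ := h
  exact ⟨⟨f, h, f.surjective, h1, h2, h3, h4⟩, f.injective⟩

theorem iso {t s : PreMonomial X n} (c : Contraction t s) (hc : Function.Injective c.vtx) :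
    t ≈ s :=
  ⟨Equiv.ofBijective c.vtx ⟨hc, c.surj⟩, c.edge, c.src, c.tgt, c.label, c.out⟩

/-- Gluing vertices is a contraction. -/
def ofGlue (t : PreMonomial X n) (r : t.V → t.V → Prop) : Contraction t (t.glue r) where
  vtx := Quot.mk r
  edge := Equiv.refl _
  surj := Quot.mk_surjective
  src _ := rfl
  tgt _ := rfl
  label _ := rfl
  out _ := rfl

/-- A contraction after another one. -/
def trans {t s r : PreMonomial X n} (c : Contraction t s) (d : Contraction s r) :
    Contraction t r where
  vtx := d.vtx ∘ c.vtx
  edge := c.edge.trans d.edge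
  surj := d.surj.comp c.surj
  src e := by simp [c.src, d.src]
  tgt e := by simp [c.tgt, d.tgt]
  label e := by simp [c.label, d.label]
  out e := by simp [c.out, d.out]

/-- A contraction is a bijection on edges, so its target is determined up to isomorphism by which
vertices of the source it identifies. -/
theorem iso_of_ker {t s r : PreMonomial X n} (c : Contraction t s) (d : Contraction t r)
    (h : ∀ a b, c.vtx a = c.vtx b ↔ d.vtx a = d.vtx b) : s ≈ r := by
  have key : ∀ a, d.vtx (Function.surjInv c.surj (c.vtx a)) = d.vtx a := fun a =>
    (h _ _).1 (Function.surjInv_eq c.surj _)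
  have key' : ∀ x, c.vtx (Function.surjInv c.surj x) = x := Function.surjInv_eq c.surj
  refine Contraction.iso ⟨fun x => d.vtx (Function.surjInv c.surj x), c.edge.symm.trans d.edge,
    ?_, ?_, ?_, ?_, ?_⟩ ?_
  · intro y
    obtain ⟨a, rfl⟩ := d.surj y
    exact ⟨c.vtx a, key a⟩
  · intro e
    obtain ⟨e, rfl⟩ := c.edge.surjective e
    rw [← c.src, key]
    simp [d.src]
  · intro e
    obtain ⟨e, rfl⟩ := c.edge.surjective e
    rw [← c.tgt, key]
    simp [d.tgt]
  · intro e
    obtain ⟨e, rfl⟩ := c.edge.surjective e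
    rw [← c.label]
    simp [d.label]
  · intro i
    rw [← c.out, key, d.out]
  · intro x y hxy
    rw [← key' x, ← key' y]
    exact (h _ _).2 hxy

/-- The quotient by a partition, as a contraction. -/
def ofQuotient (t : PreMonomial X n) (π : Setoid t.V) : Contraction t (t.quotient π) :=
  ofGlue t _

theorem ofQuotient_vtx (t : PreMonomial X n) (π : Setoid t.V) (a b : t.V) :
    (ofQuotient t π).vtx a = (ofQuotient t π).vtx b ↔ π a b :=
  mk_quotient_eq π

theorem quotient_comap_iso {t s : PreMonomial X n} (c : Contraction t s) (σ : Setoid s.V) :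
    t.quotient (σ.comap c.vtx) ≈ s.quotient σ :=
  iso_of_ker (ofQuotient t _) (c.trans (ofQuotient s σ)) fun a b => by
    rw [ofQuotient_vtx]
    exact (ofQuotient_vtx s σ _ _).symm

theorem ker_le_comap {t s : PreMonomial X n} (c : Contraction t s) (σ : Setoid s.V) :
    Setoid.ker c.vtx ≤ σ.comap c.vtx := by
  intro a b h
  rw [Setoid.comap_rel, Setoid.ker_def.1 h]

/-- Pulling back partitions along a contraction is a bijection onto the partitions coarser than its
kernel. Sums over partitions of a quotient thus become sums over an upper set of partitions of the
original graph. -/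
theorem sum_comap {t s : PreMonomial X n} (c : Contraction t s) (P : Setoid t.V → Prop)
    [DecidablePred P] [DecidablePred fun σ : Setoid s.V => P (σ.comap c.vtx)]
    (hP : ∀ σ, P σ → Setoid.ker c.vtx ≤ σ) (f : Setoid t.V → ℂ) :
    ∑ σ : Setoid s.V with P (σ.comap c.vtx), f (σ.comap c.vtx) = ∑ σ : Setoid t.V with P σ, f σ := by
  refine Finset.sum_bij (fun σ _ => σ.comap c.vtx) ?_ ?_ ?_ ?_
  · intro σ hσ
    simpa using hσ
  · intro σ _ ρ _ h
    exact Setoid.comap_injective _ c.surj h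
  · intro σ hσ
    have hσ : P σ := by simpa using hσ
    refine ⟨σ.map c.vtx, ?_, Setoid.comap_map_of_ker_le _ _ (hP σ hσ)⟩
    simpa [Setoid.comap_map_of_ker_le _ _ (hP σ hσ)] using hσ
  · intro σ _
    rfl

theorem sum_of_iso {t s : PreMonomial X n} (h : t ≈ s) (F : PreMonomial X n → ℂ)
    (hF : ∀ t s, t ≈ s → F t = F s) :
    ∑ σ : Setoid t.V, F (t.quotient σ) = ∑ σ : Setoid s.V, F (s.quotient σ) := by
  classical
  obtain ⟨c, hc⟩ := exists_of_iso h
  have := c.sum_comap (fun _ => True) (fun σ _ => by rw [Setoid.ker_eq_bot_iff.2 hc]; exact bot_le)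
    fun σ => F (t.quotient σ)
  simp only [Finset.filter_true] at this
  rw [← this]
  exact Finset.sum_congr rfl fun σ _ => hF _ _ (c.quotient_comap_iso σ)

end Contraction

end PreMonomial

/-! ### Möbius inversion -/

/-- The recursion defining the Möbius function involves only the interval between its arguments, and
`e` identifies `β` with the upper set of `e ⊥`. The induction is on the size of the interval below
`b`. -/
theorem mu_bot_eq {α β : Type} [PartialOrder α] [LocallyFiniteOrder α] [DecidableEq α]
    [PartialOrder β] [OrderBot β] [LocallyFiniteOrder β] [DecidableEq β] (e : β ↪o α)
    (he : ∀ a, e ⊥ ≤ a → ∃ b, e b = a) (b : β) :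
    IncidenceAlgebra.mu ℂ (⊥ : β) b = IncidenceAlgebra.mu ℂ (e ⊥) (e b) := by
  have hwf : WellFounded (fun a b : β => (Icc ⊥ a).card < (Icc ⊥ b).card) :=
    InvImage.wf _ Nat.lt_wfRel.wf
  induction b using hwf.induction with
  | _ b ih =>
    rw [IncidenceAlgebra.mu_apply, IncidenceAlgebra.mu_apply]
    refine if_congr (e.apply_eq_iff_eq _ _).symm rfl (congrArg _ ?_)
    refine Finset.sum_bij (fun x _ => e x) ?_ ?_ ?_ ?_
    · intro x hx
      have hx := Finset.mem_Ico.1 hx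
      exact Finset.mem_Ico.2 ⟨e.le_iff_le.2 hx.1, e.lt_iff_lt.2 hx.2⟩
    · intro x _ y _ h
      exact e.injective h
    · intro a ha
      have ha := Finset.mem_Ico.1 ha
      obtain ⟨x, rfl⟩ := he a ha.1
      exact ⟨x, Finset.mem_Ico.2 ⟨bot_le, e.lt_iff_lt.1 ha.2⟩, rfl⟩
    · intro x hx
      refine ih x (Finset.card_lt_card ?_)
      have hx := Finset.mem_Ico.1 hx
      exact Finset.Icc_ssubset_Icc_right bot_le le_rfl hx.2

/-- A locally finite structure on the finite poset of partitions of the vertices. -/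
noncomputable instance PreMonomial.locallyFiniteOrderSetoid {X : Type u} {n : ℕ}
    (t : PreMonomial X n) : LocallyFiniteOrder (Setoid t.V) :=
  letI := Classical.decEq (Setoid t.V)
  letI := Classical.decRel (fun a b : Setoid t.V => a ≤ b)
  letI := Classical.decRel (fun a b : Setoid t.V => a < b)
  Fintype.toLocallyFiniteOrder

open Classical in
-- Locally finite structures on a given order coincide, so the one chosen inside `mob` may be
-- replaced by the instance.
theorem PreMonomial.mob_eq {X : Type u} {n : ℕ} (t : PreMonomial X n) (π : Setoid t.V) :
    t.mob π = IncidenceAlgebra.mu ℂ (⊥ : Setoid t.V) π := by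
  unfold PreMonomial.mob
  congr!

open Classical in
-- Partitions of the contracted graph form the upper set of the kernel, so Möbius functions on all
-- quotients of `t` can be computed in the single poset of partitions of `t`.
theorem PreMonomial.Contraction.mob_comap {X : Type u} {n : ℕ} {t s : PreMonomial X n}
    (c : Contraction t s) (σ : Setoid s.V) :
    s.mob σ = IncidenceAlgebra.mu ℂ (Setoid.ker c.vtx) (σ.comap c.vtx) := by
  rw [PreMonomial.mob_eq]
  have hle : ∀ a b : Setoid s.V, a.comap c.vtx ≤ b.comap c.vtx ↔ a ≤ b := by
    intro a b
    constructor
    · intro h x y hxy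
      obtain ⟨x, rfl⟩ := c.surj x
      obtain ⟨y, rfl⟩ := c.surj y
      exact h hxy
    · intro h x y hxy
      exact h hxy
  let e : Setoid s.V ↪o Setoid t.V :=
    ⟨⟨Setoid.comap c.vtx, Setoid.comap_injective _ c.surj⟩, hle _ _⟩
  have hbot : e ⊥ = Setoid.ker c.vtx := Setoid.ext fun x y => Iff.rfl
  have := mu_bot_eq e (fun a ha => ⟨a.map c.vtx, Setoid.comap_map_of_ker_le _ _ (hbot ▸ ha)⟩) σ
  rw [this, hbot]
  rfl

/-! ### The injective version and Möbius inversion over quotients -/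

open PreMonomial

variable {X : Type u}

theorem GraphMonomial.mk_rep {n : ℕ} (m : GraphMonomial X n) : GraphMonomial.mk m.rep = m :=
  Quotient.out_eq m

theorem GraphMonomial.rep_mk {n : ℕ} (t : PreMonomial X n) : (GraphMonomial.mk t).rep ≈ t :=
  Quotient.exact (Quotient.out_eq (GraphMonomial.mk t))

theorem GraphMonomial.mk_eq {n : ℕ} {t s : PreMonomial X n} :
    GraphMonomial.mk t = GraphMonomial.mk s ↔ t ≈ s :=
  Quotient.eq

/-- The definition uses an arbitrary representative of the isomorphism class; any other
representative gives the same sum. -/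
theorem injVersion_single (τ : GraphPoly X 0 →ₗ[ℂ] ℂ) (t : PreMonomial X 0) :
    injVersion τ (Finsupp.single (GraphMonomial.mk t) 1) =
      ∑ π : Setoid t.V, t.mob π * τ (Finsupp.single (GraphMonomial.mk (t.quotient π)) 1) := by
  classical
  unfold injVersion
  rw [Finsupp.linearCombination_single, one_smul]
  obtain ⟨c, hc⟩ := Contraction.exists_of_iso (GraphMonomial.rep_mk t)
  have hk := Setoid.ker_eq_bot_iff.2 hc
  have := c.sum_comap (fun _ => True) (fun σ _ => by rw [hk]; exact bot_le)
    fun π => (GraphMonomial.mk t).rep.mob π *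
      τ (Finsupp.single (GraphMonomial.mk ((GraphMonomial.mk t).rep.quotient π)) 1)
  simp only [Finset.filter_true] at this
  rw [← this]
  refine Finset.sum_congr rfl fun σ _ => ?_
  rw [GraphMonomial.mk_eq.2 (c.quotient_comap_iso σ), c.mob_comap, PreMonomial.mob_eq, hk]

/-- A linear form is the sum of its injective version over all the quotients. -/
theorem sum_injVersion_quotient (τ : GraphPoly X 0 →ₗ[ℂ] ℂ) (t : PreMonomial X 0) :
    ∑ π : Setoid t.V, injVersion τ (Finsupp.single (GraphMonomial.mk (t.quotient π)) 1) =
      τ (Finsupp.single (GraphMonomial.mk t) 1) := by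
  classical
  have h1 : ∀ π : Setoid t.V,
      injVersion τ (Finsupp.single (GraphMonomial.mk (t.quotient π)) 1) =
        ∑ ρ : Setoid t.V with π ≤ ρ, IncidenceAlgebra.mu ℂ π ρ *
          τ (Finsupp.single (GraphMonomial.mk (t.quotient ρ)) 1) := by
    intro π
    set c := Contraction.ofQuotient t π with hc
    have hk : Setoid.ker c.vtx = π := Setoid.ext fun a b => Contraction.ofQuotient_vtx t π a b
    rw [injVersion_single, ← c.sum_comap (fun ρ => π ≤ ρ) (fun ρ h => by rwa [hk])]
    rw [Finset.filter_true_of_mem fun σ _ => by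
      have := c.ker_le_comap σ
      rwa [hk] at this]
    refine Finset.sum_congr rfl fun σ _ => ?_
    rw [GraphMonomial.mk_eq.2 (c.quotient_comap_iso σ), c.mob_comap, hk]
  simp_rw [h1, Finset.sum_filter]
  rw [Finset.sum_comm]
  -- After exchanging the sums, the coefficient of the value at `t^ρ` is the sum of `μ(π, ρ)` over
  -- `⊥ ≤ π ≤ ρ`, which is zero unless `ρ = ⊥`.
  have h2 : ∀ ρ : Setoid t.V, (∑ π : Setoid t.V, if π ≤ ρ then IncidenceAlgebra.mu ℂ π ρ *
      τ (Finsupp.single (GraphMonomial.mk (t.quotient ρ)) 1) else 0) =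
      if ρ = ⊥ then τ (Finsupp.single (GraphMonomial.mk (t.quotient ρ)) 1) else 0 := by
    intro ρ
    rw [← Finset.sum_filter, ← Finset.sum_mul]
    have := IncidenceAlgebra.sum_Icc_mu_left (𝕜 := ℂ) (⊥ : Setoid t.V) ρ
    rw [show ({π : Setoid t.V | π ≤ ρ} : Finset (Setoid t.V)) = Icc ⊥ ρ by ext; simp, this]
    by_cases h : ρ = ⊥
    · simp [h]
    · simp [h, Ne.symm h]
  simp_rw [h2]
  rw [Finset.sum_ite_eq' Finset.univ (⊥ : Setoid t.V), if_pos (Finset.mem_univ _)]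
  congr 2
  refine GraphMonomial.mk_eq.2 (Setoid.symm ((Contraction.ofQuotient t ⊥).iso ?_))
  intro a b h
  exact (Contraction.ofQuotient_vtx t ⊥ a b).1 h

end Traffic

namespace Traffic

open Finset PreMonomial

/-! ### Connected graphs -/

/-- The form in which connectedness is used below: `f` may be proposition-valued or set-valued,
which propagates properties from vertex to vertex. -/
theorem IsConn.eq_of_forall_edge {V E : Type} {src tgt : E → V} (hc : IsConn src tgt)
    {α : Type w} (f : V → α) (h : ∀ e, f (src e) = f (tgt e)) (a b : V) : f a = f b := by
  induction hc.2 a b with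
  | rel x y hxy => obtain ⟨e, rfl, rfl⟩ := hxy; exact h e
  | refl x => rfl
  | symm x y _ ih => exact ih.symm
  | trans x y z _ _ ih1 ih2 => exact ih1.trans ih2

theorem IsConn.exists_incident {V E : Type} {src tgt : E → V} (hc : IsConn src tgt)
    [hE : Nonempty E] (x : V) : ∃ e, src e = x ∨ tgt e = x := by
  obtain ⟨e⟩ := hE
  have := hc.eq_of_forall_edge (fun x => ∃ e, src e = x ∨ tgt e = x)
    (fun e => propext ⟨fun _ => ⟨e, Or.inr rfl⟩, fun _ => ⟨e, Or.inl rfl⟩⟩) (src e) x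
  exact this.mp ⟨e, Or.inl rfl⟩

theorem IsConn.subsingleton {V E : Type} {src tgt : E → V} (hc : IsConn src tgt) [IsEmpty E] :
    Subsingleton V :=
  ⟨fun a b => hc.eq_of_forall_edge id isEmptyElim a b⟩

namespace PreMonomial

/-- The graph with one vertex and no edge, all the outputs being at the vertex. -/
def point (X : Type u) (n : ℕ) : PreMonomial X n where
  V := Unit
  E := Empty
  finV := inferInstance
  finE := inferInstance
  src := fun _ => ()
  tgt := fun _ => ()
  label := fun e => e.elim
  out := fun _ => ()
  conn := ⟨⟨()⟩, fun _ _ => Relation.EqvGen.refl _⟩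

instance (X : Type u) (n : ℕ) : IsEmpty (point X n).E :=
  inferInstanceAs (IsEmpty Empty)

theorem iso_point {X : Type u} {n : ℕ} (t : PreMonomial X n) (h : IsEmpty t.E) :
    t ≈ point X n := by
  have := t.conn.subsingleton
  obtain ⟨x⟩ := t.conn.1
  exact ⟨⟨fun _ => (), fun _ => x, fun _ => Subsingleton.elim _ _, fun _ => rfl⟩,
    Equiv.equivOfIsEmpty _ _, isEmptyElim, isEmptyElim, isEmptyElim, fun _ => rfl⟩

end PreMonomial

theorem GraphMonomial.mapLabel_injective {X : Type u} {Y : Type v} {n : ℕ} {f : X → Y}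
    (hf : Function.Injective f) :
    Function.Injective (GraphMonomial.mapLabel f : GraphMonomial X n → GraphMonomial Y n) := by
  intro m m' h
  induction m using Quotient.ind with | _ t => ?_
  induction m' using Quotient.ind with | _ s => ?_
  obtain ⟨a, b, h1, h2, h3, h4⟩ := GraphMonomial.mk_eq.1 h
  exact GraphMonomial.mk_eq.2 ⟨a, b, h1, h2, fun e => hf (h3 e), h4⟩

/-! ### Coloured components as labelled graphs -/

variable {J : Type v} {X : J → Type u}

namespace PreMonomial

theorem sigma_castLabel {j : J} (y : Σ j, X j) (h : y.1 = j) :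
    (⟨j, castLabel y h⟩ : Σ j, X j) = y := by
  subst h
  rfl

variable (t : PreMonomial (Σ j, X j) 0)

/-- A coloured component, the labels remembering their colour. -/
def colored (S : t.Component) : PreMonomial (Σ j, X j) 0 :=
  (t.component S).mapLabel (Sigma.mk (t.color S))

variable {t}

/-- The image of a connected graph whose edges have a single colour lies in one component: edges
sharing a vertex are in the same component, and connectedness does the rest. -/
theorem compOf_eq_of_isConn {V E : Type} {src tgt : E → V} (hc : IsConn src tgt)
    (fV : V → t.V) (fE : E → t.E) (hs : ∀ e, fV (src e) = t.src (fE e))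
    (ht : ∀ e, fV (tgt e) = t.tgt (fE e))
    (hl : ∀ e f, (t.label (fE e)).1 = (t.label (fE f)).1) (e f : E) :
    t.compOf (fE e) = t.compOf (fE f) := by
  have key : ∀ x e f, (src e = x ∨ tgt e = x) → (src f = x ∨ tgt f = x) →
      t.compOf (fE e) = t.compOf (fE f) := by
    intro x e f he hf
    have inc : ∀ e, (src e = x ∨ tgt e = x) → t.Incident (fE e) (fV x) := by
      rintro e (rfl | rfl)
      · exact Or.inl (hs e).symm
      · exact Or.inr (ht e).symm
    exact Quot.sound ⟨hl e f, fV x, inc e he, inc f hf⟩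
  -- The set of components met by the edges at `x` needs no choice of an edge. It is a singleton as
  -- soon as there is such an edge, hence is constant along edges of the source graph.
  have hset : ∀ x e, (src e = x ∨ tgt e = x) →
      {S | ∃ f, (src f = x ∨ tgt f = x) ∧ t.compOf (fE f) = S} = {t.compOf (fE e)} := by
    intro x e he
    ext S
    constructor
    · rintro ⟨f, hf, rfl⟩
      exact key x f e hf he
    · rintro rfl
      exact ⟨e, he, rfl⟩
  have := hc.eq_of_forall_edge
    (fun x => {S | ∃ f, (src f = x ∨ tgt f = x) ∧ t.compOf (fE f) = S})
    (fun e => by rw [hset _ e (Or.inl rfl), hset _ e (Or.inr rfl)]) (src e) (src f)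
  rw [hset _ e (Or.inl rfl), hset _ f (Or.inl rfl)] at this
  exact Set.singleton_injective this

/-- A connected graph mapped injectively onto the edges of a coloured component is isomorphic to
the component. -/
theorem iso_colored (S : t.Component) {s : PreMonomial (Σ j, X j) 0} (fV : s.V → t.V)
    (fE : s.E → t.E) (hV : Function.Injective fV) (hE : Function.Injective fE)
    (hs : ∀ e, fV (s.src e) = t.src (fE e)) (ht : ∀ e, fV (s.tgt e) = t.tgt (fE e))
    (hl : ∀ e, s.label e = t.label (fE e)) (hr : ∀ e, t.compOf e = S ↔ ∃ e', fE e' = e) :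
    s ≈ t.colored S := by
  have : Nonempty s.E := by
    obtain ⟨e, rfl⟩ := Quot.exists_rep S
    obtain ⟨e, -⟩ := (hr e).1 rfl
    exact ⟨e⟩
  have hinc : ∀ x, t.Mem S (fV x) := by
    intro x
    obtain ⟨e, he⟩ := s.conn.exists_incident x
    refine ⟨fE e, (hr _).2 ⟨e, rfl⟩, ?_⟩
    rcases he with rfl | rfl
    · exact Or.inl (hs e).symm
    · exact Or.inr (ht e).symm
  refine ⟨Equiv.ofBijective (fun x => ⟨fV x, hinc x⟩) ⟨?_, ?_⟩,
    Equiv.ofBijective (fun e => ⟨fE e, (hr _).2 ⟨e, rfl⟩⟩) ⟨?_, ?_⟩, ?_, ?_, ?_,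
    fun i => i.elim0⟩
  · intro x y h
    exact hV (Subtype.ext_iff.1 h)
  · rintro ⟨x, e, he, hx⟩
    obtain ⟨e, rfl⟩ := (hr e).1 he
    rcases hx with rfl | rfl
    · exact ⟨s.src e, Subtype.ext (hs e)⟩
    · exact ⟨s.tgt e, Subtype.ext (ht e)⟩
  · intro x y h
    exact hE (Subtype.ext_iff.1 h)
  · rintro ⟨e, he⟩
    obtain ⟨e, rfl⟩ := (hr e).1 he
    exact ⟨e, rfl⟩
  · intro e
    exact Subtype.ext (hs e)
  · intro e
    exact Subtype.ext (ht e)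
  · intro e
    exact (hl e).trans (sigma_castLabel _ _).symm

end PreMonomial

/-! ### Weighted trees of coloured components -/

noncomputable instance (t : PreMonomial (Σ j, X j) 0) : Fintype t.Component :=
  Fintype.ofFinite _

open Classical in
/-- The product of the weights of the coloured components, if they form a tree, and `0`
otherwise. -/
noncomputable def treeWeight (W : GraphMonomial (Σ j, X j) 0 → ℂ)
    (t : PreMonomial (Σ j, X j) 0) : ℂ :=
  if t.compGraph.IsAcyclic then ∏ S : t.Component, W (GraphMonomial.mk (t.colored S)) else 0

variable (W : GraphMonomial (Σ j, X j) 0 → ℂ)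

theorem treeWeight_iso {t s : PreMonomial (Σ j, X j) 0} (h : t ≈ s) :
    treeWeight W t = treeWeight W s := by
  classical
  obtain ⟨f, h, h1, h2, h3, h4⟩ := h
  have inc : ∀ e x, s.Incident (h e) (f x) ↔ t.Incident e x := by
    intro e x
    unfold PreMonomial.Incident
    rw [← h1, ← h2, f.apply_eq_iff_eq, f.apply_eq_iff_eq]
  have same : ∀ e e', t.SameComp e e' ↔ s.SameComp (h e) (h e') := by
    intro e e'
    unfold PreMonomial.SameComp
    rw [← h3, ← h3, ← f.exists_congr_right]
    simp only [inc]
  let q : t.Component ≃ s.Component := Quot.congr h same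
  have hq : ∀ e, q (t.compOf e) = s.compOf (h e) := fun e => rfl
  have mem : ∀ S x, t.Mem S x ↔ s.Mem (q S) (f x) := by
    intro S x
    unfold PreMonomial.Mem
    rw [← h.exists_congr_right]
    refine exists_congr fun e => ?_
    rw [inc, ← hq, q.apply_eq_iff_eq]
  have con : ∀ x, t.IsConnector x ↔ s.IsConnector (f x) := by
    intro x
    unfold PreMonomial.IsConnector
    rw [← q.exists_congr_right]
    refine exists_congr fun S => ?_
    rw [← q.exists_congr_right]
    refine exists_congr fun S' => ?_
    rw [← mem, ← mem, q.injective.ne_iff]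
  let i : t.compGraph ≃g s.compGraph :=
    ⟨Equiv.sumCongr q (Equiv.subtypeEquiv f con), by
      rintro (a | a) (b | b)
      · exact Iff.rfl
      · exact (mem _ _).symm
      · exact (mem _ _).symm
      · exact Iff.rfl⟩
  unfold treeWeight
  refine if_congr i.isAcyclic_iff (Fintype.prod_equiv q _ _ fun S => congrArg W ?_) rfl
  refine GraphMonomial.mk_eq.2 (iso_colored (q S) (fun x => f x.1) (fun e => h e.1) ?_ ?_ ?_ ?_ ?_ ?_)
  · intro x y hxy
    exact Subtype.ext (f.injective hxy)
  · intro x y hxy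
    exact Subtype.ext (h.injective hxy)
  · exact fun e => h1 e.1
  · exact fun e => h2 e.1
  · exact fun e => (sigma_castLabel _ _).trans (h3 e.1)
  · intro e
    obtain ⟨e, rfl⟩ := h.surjective e
    rw [← hq, q.apply_eq_iff_eq]
    constructor
    · intro he
      exact ⟨⟨e, he⟩, rfl⟩
    · rintro ⟨⟨e', he'⟩, h'⟩
      rw [← h.injective h']
      exact he'

/-- There is at most one component and no connector, so the graph of components has at most one
vertex. The hypothesis on `W` covers the graph without edges, whose product is empty. -/
theorem treeWeight_of_monochrome (hW : W (GraphMonomial.mk (point _ 0)) = 1)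
    {t : PreMonomial (Σ j, X j) 0} (ht : ∀ e f, (t.label e).1 = (t.label f).1) :
    treeWeight W t = W (GraphMonomial.mk t) := by
  classical
  have hsub : Subsingleton t.Component := by
    refine ⟨fun S S' => ?_⟩
    obtain ⟨e, rfl⟩ := Quot.exists_rep S
    obtain ⟨f, rfl⟩ := Quot.exists_rep S'
    exact compOf_eq_of_isConn t.conn id id (fun _ => rfl) (fun _ => rfl) ht e f
  have hcon : IsEmpty {x : t.V // t.IsConnector x} :=
    ⟨fun ⟨_, S, S', h, _⟩ => h (Subsingleton.elim S S')⟩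
  have : Subsingleton (t.Component ⊕ {x : t.V // t.IsConnector x}) :=
    (Equiv.sumEmpty t.Component _).injective.subsingleton
  unfold treeWeight
  rw [if_pos .of_subsingleton]
  rcases isEmpty_or_nonempty t.E with hE | ⟨⟨e⟩⟩
  · have : IsEmpty t.Component := ⟨fun S => by
      obtain ⟨e, -⟩ := Quot.exists_rep S
      exact hE.elim e⟩
    rw [Finset.univ_eq_empty, Finset.prod_empty, GraphMonomial.mk_eq.2 (iso_point t hE), hW]
  · rw [Fintype.prod_subsingleton _ (t.compOf e)]
    refine congrArg W (GraphMonomial.mk_eq.2 (Setoid.symm ?_))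
    exact iso_colored _ id id (fun _ _ h => h) (fun _ _ h => h) (fun _ => rfl) (fun _ => rfl)
      (fun _ => rfl) fun f => ⟨fun _ => ⟨f, rfl⟩, fun _ => Subsingleton.elim _ _⟩

/-! ### The free product in terms of weights -/

open Classical in
/-- The weight of a graph of a single colour `j` is the value of the injective version of `τ j`. -/
noncomputable def injWeight (τ : ∀ j, GraphPoly (X j) 0 →ₗ[ℂ] ℂ)
    (M : GraphMonomial (Σ j, X j) 0) : ℂ :=
  if h : ∃ (j : J) (m : GraphMonomial (X j) 0), m.mapLabel (Sigma.mk j) = M then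
    injVersion (τ h.choose) (Finsupp.single h.choose_spec.choose 1)
  else 1

variable (τ : ∀ j, GraphPoly (X j) 0 →ₗ[ℂ] ℂ)

theorem injVersion_point {Y : Type u} (φ : GraphPoly Y 0 →ₗ[ℂ] ℂ)
    (h : φ (Finsupp.single (GraphMonomial.mk (point Y 0)) 1) = 1) :
    injVersion φ (Finsupp.single (GraphMonomial.mk (point Y 0)) 1) = 1 := by
  rw [← sum_injVersion_quotient] at h
  have : Unique (Setoid (point Y 0).V) :=
    ⟨⟨⊥⟩, fun π => Setoid.ext fun a b =>
      ⟨fun _ => Subsingleton.elim (α := Unit) a b, fun _ => Subsingleton.elim (α := Unit) a b ▸ π.refl _⟩⟩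
  rw [Fintype.sum_unique] at h
  rw [← h]
  congr 2
  exact GraphMonomial.mk_eq.2 (Setoid.symm (iso_point ((point Y 0).quotient _)
    (inferInstanceAs (IsEmpty Empty))))

variable {τ}

/-- The colour chosen in `injWeight` is forced by any edge of the graph. Only the graph without
edges comes from several colours, and there all the injective versions take the value `1`. -/
theorem injWeight_mapLabel
    (hτ : ∀ j, τ j (Finsupp.single (GraphMonomial.mk (point (X j) 0)) 1) = 1) {j : J}
    (m : GraphMonomial (X j) 0) :
    injWeight τ (m.mapLabel (Sigma.mk j)) = injVersion (τ j) (Finsupp.single m 1) := by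
  have h : ∃ (k : J) (m' : GraphMonomial (X k) 0),
      m'.mapLabel (Sigma.mk k) = m.mapLabel (Sigma.mk j) := ⟨j, m, rfl⟩
  unfold injWeight
  rw [dif_pos h]
  generalize_proofs h'
  have hm := h'.choose_spec
  generalize h'.choose = m' at hm
  generalize h.choose = k at m' hm
  induction m using Quotient.ind with | _ t => ?_
  induction m' using Quotient.ind with | _ s => ?_
  rcases isEmpty_or_nonempty t.E with hE | ⟨⟨e⟩⟩
  · obtain ⟨a, b, -⟩ := GraphMonomial.mk_eq.1 hm
    have hE' : IsEmpty s.E := ⟨fun e => hE.elim (b e)⟩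
    have e1 : GraphMonomial.mk t = _ := GraphMonomial.mk_eq.2 (iso_point t hE)
    have e2 : GraphMonomial.mk s = _ := GraphMonomial.mk_eq.2 (iso_point s hE')
    change injVersion (τ k) (Finsupp.single (GraphMonomial.mk s) 1) =
      injVersion (τ j) (Finsupp.single (GraphMonomial.mk t) 1)
    rw [e1, e2, injVersion_point _ (hτ _), injVersion_point _ (hτ _)]
  · obtain ⟨a, b, h1, h2, h3, h4⟩ := GraphMonomial.mk_eq.1 hm
    obtain ⟨e, rfl⟩ := b.surjective e
    have := congrArg Sigma.fst (h3 e)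
    change k = j at this
    subst this
    rw [GraphMonomial.mapLabel_injective sigma_mk_injective hm]

theorem freeProductInj_eq
    (hτ : ∀ j, τ j (Finsupp.single (GraphMonomial.mk (point (X j) 0)) 1) = 1)
    (t : PreMonomial (Σ j, X j) 0) : freeProductInj τ t = treeWeight (injWeight τ) t := by
  unfold freeProductInj treeWeight
  congr 1
  exact Finset.prod_congr rfl fun S _ =>
    (injWeight_mapLabel hτ (GraphMonomial.mk (t.component S))).symm

theorem injWeight_point
    (hτ : ∀ j, τ j (Finsupp.single (GraphMonomial.mk (point (X j) 0)) 1) = 1) :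
    injWeight τ (GraphMonomial.mk (point _ 0)) = 1 := by
  by_cases h : Nonempty J
  · obtain ⟨j⟩ := h
    have := injWeight_mapLabel hτ (GraphMonomial.mk (point (X j) 0))
    rw [injVersion_point _ (hτ j)] at this
    rw [← this]
    exact congrArg _ (GraphMonomial.mk_eq.2 (Setoid.symm (iso_point _ (inferInstanceAs (IsEmpty Empty)))))
  -- Without any colour, no monomial has a colour, and the default value `1` of the weight is the
  -- required one.
  · unfold injWeight
    rw [dif_neg]
    rintro ⟨j, -⟩
    exact h ⟨j⟩

theorem freeProduct_single
    (hτ : ∀ j, τ j (Finsupp.single (GraphMonomial.mk (point (X j) 0)) 1) = 1)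
    (t : PreMonomial (Σ j, X j) 0) :
    freeProduct τ (Finsupp.single (GraphMonomial.mk t) 1) =
      ∑ π : Setoid t.V, treeWeight (injWeight τ) (t.quotient π) := by
  unfold freeProduct
  rw [Finsupp.linearCombination_single, one_smul]
  simp_rw [freeProductInj_eq hτ]
  exact Contraction.sum_of_iso (GraphMonomial.rep_mk t) _ fun _ _ h => treeWeight_iso _ h

/-- All the quotients of a graph of one colour are of one colour, so the sum of weights is the
Möbius inversion formula for `τ j`. -/
theorem freeProduct_monochrome
    (hτ : ∀ j, τ j (Finsupp.single (GraphMonomial.mk (point (X j) 0)) 1) = 1) {j : J}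
    (t : PreMonomial (X j) 0) :
    freeProduct τ (Finsupp.single (GraphMonomial.mk (t.mapLabel (Sigma.mk j))) 1) =
      τ j (Finsupp.single (GraphMonomial.mk t) 1) := by
  rw [freeProduct_single hτ, ← sum_injVersion_quotient]
  refine Finset.sum_congr rfl fun π _ => ?_
  rw [treeWeight_of_monochrome _ (injWeight_point hτ) fun _ _ => rfl]
  exact injWeight_mapLabel hτ (GraphMonomial.mk (t.quotient π))

theorem freeProduct_point
    (hτ : ∀ j, τ j (Finsupp.single (GraphMonomial.mk (point (X j) 0)) 1) = 1) :
    freeProduct τ (Finsupp.single (GraphMonomial.mk (point (Σ j, X j) 0)) 1) = 1 := by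
  rw [freeProduct_single hτ]
  have : Unique (Setoid (point (Σ j, X j) 0).V) :=
    ⟨⟨⊥⟩, fun π => Setoid.ext fun a b =>
      ⟨fun _ => Subsingleton.elim (α := Unit) a b, fun _ => Subsingleton.elim (α := Unit) a b ▸ π.refl _⟩⟩
  rw [Fintype.sum_unique, treeWeight_of_monochrome _ (injWeight_point hτ) fun e => Empty.elim e,
    GraphMonomial.mk_eq.2 (iso_point _ (inferInstanceAs (IsEmpty Empty))), injWeight_point hτ]

end Traffic

namespace Traffic

open Finset PreMonomial

/-! ### Acyclic graphs -/

section Acyclic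

variable {U V : Type*} {G : SimpleGraph U} {H : SimpleGraph V}

/-- Local injectivity prevents the image of a path from backtracking: two consecutive edges with the
same image would have the same far endpoint. In a forest, a walk without backtracking is a path. -/
theorem isChain_ne_edges_map (f : G →g H)
    (hf : ∀ v a b, G.Adj v a → G.Adj v b → f a = f b → a = b) {u v : U} (p : G.Walk u v)
    (hp : p.IsPath) : List.IsChain (· ≠ ·) (p.map f).edges := by
  induction p with
  | nil => simp
  | cons h q ih =>
    cases q with
    | nil => simp
    | cons h' q =>
      rw [SimpleGraph.Walk.cons_isPath_iff] at hp
      have := ih hp.1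
      simp only [SimpleGraph.Walk.map_cons, SimpleGraph.Walk.edges_cons] at this ⊢
      refine List.IsChain.cons_cons ?_ this
      intro heq
      rw [Sym2.eq_swap, Sym2.congr_right] at heq
      have := hf _ _ _ h.symm h' heq
      subst this
      exact hp.2 (by simp)

/-- A locally injective homomorphism from a connected graph to an acyclic graph is injective. -/
theorem injective_of_locally_injective (hG : G.Preconnected) (hH : H.IsAcyclic) (f : G →g H)
    (hf : ∀ v a b, G.Adj v a → G.Adj v b → f a = f b → a = b) : Function.Injective f := by
  classical
  intro u v huv
  obtain ⟨p, hp⟩ := (hG u v).exists_isPath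
  have h1 := (hH.isPath_iff_isChain (p.map f)).2 (isChain_ne_edges_map f hf p hp)
  -- Since `f u = f v`, the image is a closed path, hence has length zero.
  have h2 : ((p.map f).copy rfl huv.symm).IsPath :=
    (SimpleGraph.Walk.isPath_copy _ _ _).2 h1
  have h3 := SimpleGraph.Walk.length_eq_zero_iff.2 (SimpleGraph.Walk.isPath_iff_nil.1 h2)
  simp only [SimpleGraph.Walk.length_copy, SimpleGraph.Walk.length_map] at h3
  exact SimpleGraph.Walk.eq_of_length_eq_zero h3

/-- A path of length two between two points of the image of an injective homomorphism comes from a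
path of length two. -/
theorem exists_adj_adj_of_injective (hG : G.Preconnected) (hH : H.IsAcyclic) (f : G →g H)
    (hf : Function.Injective f) {u v : U} (huv : u ≠ v) {w : V} (h1 : H.Adj (f u) w)
    (h2 : H.Adj w (f v)) : ∃ c, f c = w ∧ G.Adj u c ∧ G.Adj c v := by
  classical
  obtain ⟨p, hp⟩ := (hG u v).exists_isPath
  let q : H.Walk (f u) (f v) := SimpleGraph.Walk.cons h1 (SimpleGraph.Walk.cons h2 .nil)
  have hq : q.IsPath := by
    simp only [q, SimpleGraph.Walk.cons_isPath_iff]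
    simp [h1.ne, h2.ne, hf.ne huv]
  -- Paths between two given vertices of a forest are unique.
  have hpq : p.map f = q :=
    congrArg Subtype.val ((hH.subsingleton_path _ _).elim ⟨p.map f, hp.map hf⟩ ⟨q, hq⟩)
  have hlen : p.length = 2 := by
    rw [← SimpleGraph.Walk.length_map f, hpq]
    rfl
  refine ⟨p.getVert 1, ?_, ?_, ?_⟩
  · rw [← SimpleGraph.Walk.getVert_map, hpq]
    rfl
  · simpa using p.adj_getVert_succ (i := 0) (by omega)
  · have := p.adj_getVert_succ (i := 1) (by omega)
    rwa [show 1 + 1 = p.length by omega, SimpleGraph.Walk.getVert_length] at this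

/-- Adding vertices with at most one neighbour to an acyclic graph gives an acyclic graph. -/
theorem isAcyclic_of_induce (s : Set V) (hs : (H.induce s).IsAcyclic)
    (h : ∀ v ∉ s, ∀ a b, H.Adj v a → H.Adj v b → a = b) : H.IsAcyclic := by
  intro v p hp
  -- A vertex on a cycle has two distinct neighbours there, so a cycle avoids all the added
  -- vertices.
  have hsupp : ∀ x ∈ p.support, x ∈ s := by
    intro x hx
    by_contra hxs
    have h2 := hp.ncard_neighborSet_toSubgraph_eq_two hx
    obtain ⟨a, b, hab, hN⟩ := Set.ncard_eq_two.1 h2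
    have ha : a ∈ p.toSubgraph.neighborSet x := by rw [hN]; simp
    have hb : b ∈ p.toSubgraph.neighborSet x := by rw [hN]; simp
    exact hab (h x hxs a b (p.toSubgraph.adj_sub ha) (p.toSubgraph.adj_sub hb))
  refine hs (p.induce s hsupp) (SimpleGraph.Walk.IsCycle.of_map
    (f := (SimpleGraph.Embedding.induce s).toHom) ?_)
  rwa [SimpleGraph.Walk.map_induce]

end Acyclic

/-! ### The vertices of a substitution -/

namespace BigraphOp

variable {L : ℕ} {d : Fin L → ℕ} {n : ℕ} {X : Type u} (g : BigraphOp L d n)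

/-- The bipartite graph underlying a bigraph operation. -/
def graph : SimpleGraph (Fin L ⊕ g.C) :=
  bipartiteGraph fun ℓ c => ∃ k, g.nbr ℓ k = c

variable (t : ∀ ℓ, PreMonomial X (d ℓ))

/-- The vertex of a substitution given by a vertex of one of the graphs. -/
def incl (ℓ : Fin L) (x : (t ℓ).V) : (g.subst t).V :=
  Quot.mk _ (Sum.inr ⟨ℓ, x⟩)

/-- The vertex of a substitution given by a connector. -/
def conVtx (c : g.C) : (g.subst t).V :=
  Quot.mk _ (Sum.inl c)

theorem conVtx_nbr (ℓ : Fin L) (k : Fin (d ℓ)) :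
    g.conVtx t (g.nbr ℓ k) = g.incl t ℓ ((t ℓ).out k) :=
  Quot.sound (SubstRel.mk ℓ k)

variable {t}

theorem subst_vtx_cases (x : (g.subst t).V) :
    (∃ c, x = g.conVtx t c) ∨ ∃ ℓ y, x = g.incl t ℓ y := by
  induction x using Quot.ind with | mk x => ?_
  rcases x with c | ⟨ℓ, y⟩
  · exact Or.inl ⟨c, rfl⟩
  · exact Or.inr ⟨ℓ, y, rfl⟩

theorem exists_nbr_eq (g : BigraphOp L d 0) (c : g.C) : ∃ ℓ k, g.nbr ℓ k = c := by
  have h := g.two_le_degree c fun i => i.elim0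
  have : {ℓ : Fin L | ∃ k, g.nbr ℓ k = c}.Nonempty := by
    rw [← Set.ncard_pos]
    omega
  exact this

theorem exists_eq_incl (g : BigraphOp L d 0) {t : ∀ ℓ, PreMonomial X (d ℓ)} (x : (g.subst t).V) :
    ∃ ℓ y, x = g.incl t ℓ y := by
  rcases g.subst_vtx_cases x with ⟨c, rfl⟩ | h
  · obtain ⟨ℓ, k, rfl⟩ := g.exists_nbr_eq c
    exact ⟨ℓ, _, g.conVtx_nbr t ℓ k⟩
  · exact h

open Classical in
/-- A normal form for the vertices of a substitution into graphs with distinct outputs. -/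
noncomputable def normalForm (t : ∀ ℓ, PreMonomial X (d ℓ)) :
    (g.C ⊕ Σ ℓ, (t ℓ).V) → (g.C ⊕ Σ ℓ, (t ℓ).V)
  | Sum.inl c => Sum.inl c
  | Sum.inr ⟨ℓ, x⟩ => if h : ∃ k, (t ℓ).out k = x then Sum.inl (g.nbr ℓ h.choose)
      else Sum.inr ⟨ℓ, x⟩

theorem normalForm_of_not {ℓ : Fin L} {x : (t ℓ).V} (h : ¬ ∃ k, (t ℓ).out k = x) :
    g.normalForm t (Sum.inr ⟨ℓ, x⟩) = Sum.inr ⟨ℓ, x⟩ :=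
  dif_neg h

section NormalForm

variable (ht : ∀ ℓ, Function.Injective (t ℓ).out)
include ht

theorem normalForm_out (ℓ : Fin L) (k : Fin (d ℓ)) :
    g.normalForm t (Sum.inr ⟨ℓ, (t ℓ).out k⟩) = Sum.inl (g.nbr ℓ k) := by
  have h : ∃ k', (t ℓ).out k' = (t ℓ).out k := ⟨k, rfl⟩
  exact (dif_pos h).trans (by rw [ht ℓ h.choose_spec])

/-- Sending each output to its connector is well defined when the outputs are distinct, and is
constant on glued pairs. It therefore descends to the substitution and decides equality of its
vertices. -/
theorem normalForm_eq {x y : g.C ⊕ Σ ℓ, (t ℓ).V}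
    (h : (Quot.mk _ x : (g.subst t).V) = Quot.mk _ y) : g.normalForm t x = g.normalForm t y := by
  refine congrArg (Quot.lift (g.normalForm t) ?_) h
  rintro _ _ ⟨ℓ, k⟩
  rw [g.normalForm_out ht]
  rfl

theorem incl_eq_conVtx {ℓ : Fin L} {x : (t ℓ).V} {c : g.C} (h : g.incl t ℓ x = g.conVtx t c) :
    ∃ k, (t ℓ).out k = x ∧ g.nbr ℓ k = c := by
  have := g.normalForm_eq ht h
  by_cases hx : ∃ k, (t ℓ).out k = x
  · obtain ⟨k, rfl⟩ := hx
    rw [g.normalForm_out ht] at this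
    exact ⟨k, rfl, Sum.inl_injective this⟩
  · rw [g.normalForm_of_not hx] at this
    cases this

theorem incl_injective (ℓ : Fin L) : Function.Injective (g.incl t ℓ) := by
  intro x y h
  by_cases hx : ∃ k, (t ℓ).out k = x
  · obtain ⟨k, rfl⟩ := hx
    rw [← conVtx_nbr] at h
    obtain ⟨k', rfl, hk'⟩ := g.incl_eq_conVtx ht h.symm
    rw [g.nbr_inj ℓ hk']
  by_cases hy : ∃ k, (t ℓ).out k = y
  · obtain ⟨k, rfl⟩ := hy
    rw [← conVtx_nbr] at h
    obtain ⟨k', rfl, hk'⟩ := g.incl_eq_conVtx ht h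
    exact (hx ⟨k', rfl⟩).elim
  have := g.normalForm_eq ht h
  rw [g.normalForm_of_not hx, g.normalForm_of_not hy] at this
  simpa using this

/-- Two pieces meet only at common connectors: a vertex which is not an output is its own normal
form, which remembers the piece. -/
theorem exists_nbr_of_incl_eq {ℓ ℓ' : Fin L} (hne : ℓ ≠ ℓ') {x : (t ℓ).V} {y : (t ℓ').V}
    (h : g.incl t ℓ x = g.incl t ℓ' y) :
    ∃ k k', g.nbr ℓ k = g.nbr ℓ' k' ∧ (t ℓ).out k = x ∧ (t ℓ').out k' = y := by
  by_cases hx : ∃ k, (t ℓ).out k = x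
  · obtain ⟨k, rfl⟩ := hx
    rw [← conVtx_nbr] at h
    obtain ⟨k', rfl, hk'⟩ := g.incl_eq_conVtx ht h.symm
    exact ⟨k, k', hk'.symm, rfl, rfl⟩
  by_cases hy : ∃ k, (t ℓ').out k = y
  · obtain ⟨k, rfl⟩ := hy
    rw [← conVtx_nbr] at h
    obtain ⟨k', rfl, hk'⟩ := g.incl_eq_conVtx ht h
    exact ⟨k', k, hk', rfl, rfl⟩
  have := g.normalForm_eq ht h
  rw [g.normalForm_of_not hx, g.normalForm_of_not hy] at this
  exact (hne (congrArg Sigma.fst (Sum.inr_injective this))).elim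

end NormalForm

/-- The map between the vertices of substitutions given by maps compatible with the outputs. -/
def substVtx {s : ∀ ℓ, PreMonomial X (d ℓ)} (q : ∀ ℓ, (t ℓ).V → (s ℓ).V)
    (hq : ∀ ℓ k, q ℓ ((t ℓ).out k) = (s ℓ).out k) : (g.subst t).V → (g.subst s).V :=
  Quot.map (Sum.map id (Sigma.map id q)) (by
    rintro _ _ ⟨ℓ, k⟩
    have := SubstRel.mk (g := g) (t := s) ℓ k
    rw [← hq] at this
    exact this)

theorem substVtx_surjective {s : ∀ ℓ, PreMonomial X (d ℓ)} (q : ∀ ℓ, (t ℓ).V → (s ℓ).V)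
    (hq : ∀ ℓ k, q ℓ ((t ℓ).out k) = (s ℓ).out k) (h : ∀ ℓ, Function.Surjective (q ℓ)) :
    Function.Surjective (g.substVtx q hq) := by
  intro x
  induction x using Quot.ind with | mk x => ?_
  rcases x with x | ⟨ℓ, x⟩
  · exact ⟨Quot.mk _ (Sum.inl x), rfl⟩
  · obtain ⟨x, rfl⟩ := h ℓ x
    exact ⟨Quot.mk _ (Sum.inr ⟨ℓ, x⟩), rfl⟩

/-- Contracting the graphs contracts their substitution. -/
def substContraction {s : ∀ ℓ, PreMonomial X (d ℓ)} (c : ∀ ℓ, Contraction (t ℓ) (s ℓ)) :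
    Contraction (g.subst t) (g.subst s) where
  vtx := g.substVtx (fun ℓ => (c ℓ).vtx) fun ℓ => (c ℓ).out
  edge := Equiv.sigmaCongrRight fun ℓ => (c ℓ).edge
  surj := g.substVtx_surjective _ _ fun ℓ => (c ℓ).surj
  src e := congrArg (g.incl s e.1) ((c e.1).src e.2)
  tgt e := congrArg (g.incl s e.1) ((c e.1).tgt e.2)
  label e := (c e.1).label e.2
  out _ := rfl

/-- The kernel of the contraction is generated by the kernels on the pieces: if `σ` contains these,
the projection modulo `σ` factors through the contracted substitution, by means of `F`. -/
theorem ker_substContraction_le {s : ∀ ℓ, PreMonomial X (d ℓ)}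
    (c : ∀ ℓ, Contraction (t ℓ) (s ℓ)) (σ : Setoid (g.subst t).V)
    (h : ∀ ℓ, Setoid.ker (c ℓ).vtx ≤ σ.comap (g.incl t ℓ)) :
    Setoid.ker (g.substContraction c).vtx ≤ σ := by
  have hσ : ∀ ℓ x, σ (g.incl t ℓ (Function.surjInv (c ℓ).surj ((c ℓ).vtx x))) (g.incl t ℓ x) :=
    fun ℓ x => h ℓ (Function.surjInv_eq (c ℓ).surj _)
  let F : (g.subst s).V → Quotient σ := Quot.lift (fun z => match z with
    | Sum.inl c => Quotient.mk σ (g.conVtx t c)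
    | Sum.inr ⟨ℓ, x⟩ => Quotient.mk σ (g.incl t ℓ (Function.surjInv (c ℓ).surj x))) (by
      rintro _ _ ⟨ℓ, k⟩
      refine Quotient.sound ?_
      change σ _ _
      rw [conVtx_nbr, ← (c ℓ).out]
      exact σ.symm (hσ ℓ _))
  have hF : ∀ x, F ((g.substContraction c).vtx x) = Quotient.mk σ x := by
    intro x
    rcases g.subst_vtx_cases x with ⟨c, rfl⟩ | ⟨ℓ, x, rfl⟩
    · rfl
    · exact Quotient.sound (hσ ℓ x)
  intro x y h
  have := congrArg F h
  rw [hF, hF] at this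
  exact Quotient.exact this

end BigraphOp

/-! ### The coloured components of a substitution -/

namespace BigraphOp

variable {J : Type v} {X : J → Type u} {L : ℕ} {d : Fin L → ℕ} {g : BigraphOp L d 0}
  {t : ∀ ℓ, PreMonomial (Σ j, X j) (d ℓ)} {γ : Fin L → J}

theorem compOf_subst_eq (hγ : ∀ ℓ e, ((t ℓ).label e).1 = γ ℓ) (ℓ : Fin L) (e f : (t ℓ).E) :
    (g.subst t).compOf ⟨ℓ, e⟩ = (g.subst t).compOf ⟨ℓ, f⟩ :=
  compOf_eq_of_isConn (t := g.subst t) (t ℓ).conn (g.incl t ℓ) (fun e => (⟨ℓ, e⟩ : Σ ℓ, (t ℓ).E)) (fun _ => rfl)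
    (fun _ => rfl) (fun e f => (hγ ℓ e).trans (hγ ℓ f).symm) e f

/-- Edges of two distinct pieces can only share a connector, and then alternation gives them
different colours. So no component spreads over two pieces. -/
theorem fst_eq_of_compOf_subst_eq (hg : g.Alternated γ) (hγ : ∀ ℓ e, ((t ℓ).label e).1 = γ ℓ)
    (ht : ∀ ℓ, Function.Injective (t ℓ).out) {e f : (g.subst t).E}
    (h : (g.subst t).compOf e = (g.subst t).compOf f) : e.1 = f.1 := by
  refine congrArg (Quot.lift (fun e : (g.subst t).E => e.1) ?_) h
  rintro ⟨ℓ, e⟩ ⟨ℓ', e'⟩ ⟨hc, x, hx, hx'⟩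
  by_contra hne
  change ℓ ≠ ℓ' at hne
  have hx : ∃ y, g.incl t ℓ y = x := by rcases hx with rfl | rfl <;> exact ⟨_, rfl⟩
  have hx' : ∃ y, g.incl t ℓ' y = x := by rcases hx' with rfl | rfl <;> exact ⟨_, rfl⟩
  obtain ⟨y, rfl⟩ := hx
  obtain ⟨y', hy'⟩ := hx'
  obtain ⟨k, k', hk, -⟩ := g.exists_nbr_of_incl_eq ht hne hy'.symm
  exact hg ℓ ℓ' hne ⟨k, k', hk⟩ ((hγ ℓ e).symm.trans (hc.trans (hγ ℓ' e')))

/-- The coloured components of a substitution into graphs with distinct outputs, each of a single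
colour, are these graphs. -/
theorem treeWeight_subst (W : GraphMonomial (Σ j, X j) 0 → ℂ)
    (hW : W (GraphMonomial.mk (point _ 0)) = 1) (hg : g.Alternated γ)
    (hγ : ∀ ℓ e, ((t ℓ).label e).1 = γ ℓ) (ht : ∀ ℓ, Function.Injective (t ℓ).out)
    (hgr : g.graph.IsAcyclic) :
    treeWeight W (g.subst t) = ∏ ℓ, W (GraphMonomial.mk (t ℓ).forget) := by
  classical
  have hfst := fun e f => fst_eq_of_compOf_subst_eq (e := e) (f := f) hg hγ ht
  let idx : (g.subst t).Component → Fin L := Quot.lift (fun e : (g.subst t).E => e.1) fun e f h =>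
    hfst e f (Quot.sound h)
  have hidx : ∀ e, idx ((g.subst t).compOf e) = e.1 := fun _ => rfl
  have hinj : Function.Injective idx := by
    intro S S' h
    obtain ⟨⟨ℓ, e⟩, rfl⟩ := Quot.exists_rep S
    obtain ⟨⟨ℓ', f⟩, rfl⟩ := Quot.exists_rep S'
    change ℓ = ℓ' at h
    subst h
    exact compOf_subst_eq hγ ℓ e f
  have hmem : ∀ S x, (g.subst t).Mem S x → ∃ y, g.incl t (idx S) y = x := by
    rintro S x ⟨e, rfl, hx⟩
    rw [hidx]
    rcases hx with rfl | rfl <;> exact ⟨_, rfl⟩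
  have hcon : ∀ x : {x // (g.subst t).IsConnector x}, ∃ c, g.conVtx t c = x.1 := by
    rintro ⟨x, S, S', hne, hS, hS'⟩
    obtain ⟨y, rfl⟩ := hmem S x hS
    obtain ⟨y', hy'⟩ := hmem S' _ hS'
    obtain ⟨k, k', hk, h, h'⟩ := g.exists_nbr_of_incl_eq ht (hinj.ne hne) hy'.symm
    exact ⟨g.nbr _ k, by rw [conVtx_nbr, h]⟩
  choose con hcon using hcon
  have hadj : ∀ S x, (g.subst t).Mem S x.1 → ∃ k, g.nbr (idx S) k = con x := by
    intro S x hS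
    obtain ⟨y, hy⟩ := hmem S _ hS
    rw [← hcon] at hy
    obtain ⟨k, -, hk⟩ := g.incl_eq_conVtx ht hy
    exact ⟨k, hk⟩
  -- This is an embedding and not an isomorphism in general: pieces without edges give no component,
  -- and a connector of `g` next to such pieces may cease to be a connector of the substitution.
  let φ : (g.subst t).compGraph →g g.graph := ⟨Sum.map idx con, by
    rintro (a | a) (b | b) h
    · exact h
    · exact hadj a b h
    · exact hadj b a h
    · exact h⟩
  have hφ : Function.Injective φ := by
    refine Function.Injective.sumMap hinj fun x y h => Subtype.ext ?_
    rw [← hcon, ← hcon, h]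
  unfold treeWeight
  rw [if_pos (hgr.comap φ hφ)]
  refine Fintype.prod_of_injective idx hinj _ _ ?_ ?_
  -- An input which is not the index of a component carries a graph without edges, of weight `1`.
  · intro ℓ hℓ
    have hE : IsEmpty (t ℓ).E := ⟨fun e => hℓ ⟨(g.subst t).compOf ⟨ℓ, e⟩, rfl⟩⟩
    rw [GraphMonomial.mk_eq.2 (iso_point (t ℓ).forget hE), hW]
  · intro S
    obtain ⟨⟨ℓ, e⟩, rfl⟩ := Quot.exists_rep S
    refine congrArg W (GraphMonomial.mk_eq.2 (Setoid.symm ?_))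
    refine iso_colored (s := (t ℓ).forget) _ (g.incl t ℓ) (fun e => (⟨ℓ, e⟩ : Σ ℓ, (t ℓ).E)) (g.incl_injective ht ℓ)
      (fun e f h => eq_of_heq (Sigma.mk.inj h).2) (fun _ => rfl) (fun _ => rfl) (fun _ => rfl) ?_
    rintro ⟨ℓ', f⟩
    constructor
    · intro h
      have : ℓ' = ℓ := hfst _ _ h
      subst this
      exact ⟨f, rfl⟩
    · rintro ⟨f', h⟩
      rw [← h]
      exact compOf_subst_eq hγ ℓ _ _

/-- If the coloured components of a quotient of an alternated substitution form a tree, and if the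
outputs of each of the graphs remain distinct, then the quotient identifies vertices of two of the
graphs only through a common connector. -/
theorem exists_nbr_of_isAcyclic (hg : g.Alternated γ) (hγ : ∀ ℓ e, ((t ℓ).label e).1 = γ ℓ)
    (σ : Setoid (g.subst t).V)
    (hσ : ∀ ℓ k k', σ (g.incl t ℓ ((t ℓ).out k)) (g.incl t ℓ ((t ℓ).out k')) → k = k')
    (hac : ((g.subst t).quotient σ).compGraph.IsAcyclic) :
    g.graph.IsAcyclic ∧ ∀ ℓ ℓ', ℓ ≠ ℓ' → ∀ x y, σ (g.incl t ℓ x) (g.incl t ℓ' y) →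
      ∃ k k', g.nbr ℓ k = g.nbr ℓ' k' ∧ σ (g.incl t ℓ x) (g.incl t ℓ ((t ℓ).out k)) ∧
        σ (g.incl t ℓ' y) (g.incl t ℓ' ((t ℓ').out k')) := by
  classical
  set r := (g.subst t).quotient σ with hr
  let cl : (g.subst t).V → r.V := Quot.mk _
  have hcl : ∀ a b, cl a = cl b ↔ σ a b := fun a b => mk_quotient_eq σ
  have hcomp : ∀ ℓ (e f : (t ℓ).E), r.compOf ⟨ℓ, e⟩ = r.compOf ⟨ℓ, f⟩ := fun ℓ =>
    compOf_eq_of_isConn (t := r) (t ℓ).conn (fun x => cl (g.incl t ℓ x)) (fun e => (⟨ℓ, e⟩ : Σ ℓ, (t ℓ).E))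
      (fun _ => rfl) (fun _ => rfl) (fun e f => (hγ ℓ e).trans (hγ ℓ f).symm)
  let H₀ : SimpleGraph (r.Component ⊕ r.V) := bipartiteGraph fun S x => r.Mem S x
  have hH₀ : H₀.IsAcyclic := by
    refine isAcyclic_of_induce {z | ∀ x, z = Sum.inr x → r.IsConnector x} ?_ ?_
    · let f : {z : r.Component ⊕ r.V | ∀ x, z = Sum.inr x → r.IsConnector x} →
          r.Component ⊕ {x : r.V // r.IsConnector x} := fun z =>
        match z with
        | ⟨Sum.inl S, _⟩ => Sum.inl S
        | ⟨Sum.inr x, h⟩ => Sum.inr ⟨x, h x rfl⟩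
      refine hac.comap ⟨f, ?_⟩ ?_
      · rintro ⟨a | a, ha⟩ ⟨b | b, hb⟩ h <;> exact h
      · rintro ⟨a | a, ha⟩ ⟨b | b, hb⟩ h
        · exact Subtype.ext (congrArg Sum.inl (Sum.inl_injective h))
        · cases h
        · cases h
        · exact Subtype.ext (congrArg Sum.inr (Subtype.ext_iff.1 (Sum.inr_injective h)))
    · rintro (S | x) hx a b ha hb
      · exact (hx fun x h => by cases h).elim
      · rcases a with S | a
        · rcases b with S' | b
          · by_contra hne
            refine hx fun y hy => ?_
            cases hy
            exact ⟨S, S', fun h => hne (congrArg _ h), ha, hb⟩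
          · exact hb.elim
        · exact ha.elim
  -- Pieces without edges have no component; a node is added for each of them. Such a piece has a
  -- single vertex by connectedness, so the new node has only one neighbour and no cycle appears.
  let R : r.Component ⊕ Fin L → r.V → Prop := fun S x =>
    Sum.elim (fun S => r.Mem S x) (fun ℓ => IsEmpty (t ℓ).E ∧ ∃ y, cl (g.incl t ℓ y) = x) S
  let H := bipartiteGraph R
  have hH : H.IsAcyclic := by
    refine isAcyclic_of_induce {z | ∀ ℓ, z ≠ Sum.inl (Sum.inr ℓ)} ?_ ?_
    · let f : {z : (r.Component ⊕ Fin L) ⊕ r.V | ∀ ℓ, z ≠ Sum.inl (Sum.inr ℓ)} →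
          r.Component ⊕ r.V := fun z =>
        match z with
        | ⟨Sum.inl (Sum.inl S), _⟩ => Sum.inl S
        | ⟨Sum.inl (Sum.inr ℓ), h⟩ => (h ℓ rfl).elim
        | ⟨Sum.inr x, h⟩ => Sum.inr x
      refine hH₀.comap ⟨f, ?_⟩ ?_
      · rintro ⟨(a | a) | a, ha⟩ ⟨(b | b) | b, hb⟩ h
        all_goals first
          | exact h
          | exact (ha _ rfl).elim
          | exact (hb _ rfl).elim
      · rintro ⟨(a | a) | a, ha⟩ ⟨(b | b) | b, hb⟩ h
        all_goals first
          | exact (ha _ rfl).elim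
          | exact (hb _ rfl).elim
          | (cases h; rfl)
          | cases h
    · rintro ((S | ℓ) | x) hx a b ha hb
      · exact (hx fun ℓ h => by cases h).elim
      · rcases a with a | a
        · exact ha.elim
        rcases b with b | b
        · exact hb.elim
        obtain ⟨hE, y, rfl⟩ := ha
        obtain ⟨-, y', rfl⟩ := hb
        have := (t ℓ).conn.subsingleton
        rw [Subsingleton.elim y y']
      · exact (hx fun ℓ h => by cases h).elim
  let node : Fin L → r.Component ⊕ Fin L := fun ℓ =>
    if h : Nonempty (t ℓ).E then Sum.inl (r.compOf ⟨ℓ, h.some⟩) else Sum.inr ℓ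
  have hnode : ∀ ℓ y, R (node ℓ) (cl (g.incl t ℓ y)) := by
    intro ℓ y
    by_cases h : Nonempty (t ℓ).E
    · obtain ⟨e, he⟩ := (t ℓ).conn.exists_incident y
      simp only [node, dif_pos h]
      refine ⟨⟨ℓ, e⟩, hcomp ℓ _ _, ?_⟩
      rcases he with rfl | rfl
      · exact Or.inl rfl
      · exact Or.inr rfl
    · simp only [node, dif_neg h]
      exact ⟨not_nonempty_iff.1 h, y, rfl⟩
  -- Two pieces with edges are told apart by their colours, two pieces without edges by their
  -- indices.
  have hsep : ∀ ℓ ℓ', ℓ ≠ ℓ' → γ ℓ ≠ γ ℓ' → node ℓ ≠ node ℓ' := by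
    intro ℓ ℓ' hne hc heq
    simp only [node] at heq
    split_ifs at heq with h h' h'
    · have := congrArg r.color (Sum.inl_injective heq)
      exact hc ((hγ ℓ h.some).symm.trans (this.trans (hγ ℓ' h'.some)))
    · exact hne (Sum.inr_injective heq)
  have hcon : ∀ ℓ k, cl (g.conVtx t (g.nbr ℓ k)) = cl (g.incl t ℓ ((t ℓ).out k)) := fun ℓ k =>
    congrArg cl (g.conVtx_nbr t ℓ k)
  have hedge : ∀ ℓ c, (∃ k, g.nbr ℓ k = c) → R (node ℓ) (cl (g.conVtx t c)) := by
    rintro ℓ _ ⟨k, rfl⟩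
    rw [hcon]
    exact hnode ℓ _
  let f : g.graph →g H := ⟨Sum.map node fun c => cl (g.conVtx t c), by
    rintro (a | a) (b | b) h
    · exact h
    · exact hedge a b h
    · exact hedge b a h
    · exact h⟩
  -- Around an input, the separation of its outputs gives local injectivity; around a connector,
  -- alternation does. Acyclicity of the target makes it global.
  have hf : Function.Injective f := by
    refine injective_of_locally_injective g.conn.preconnected hH f ?_
    rintro (ℓ | c) (a | a) (b | b) ha hb hab
    · exact ha.elim
    · exact ha.elim
    · exact hb.elim
    · obtain ⟨k, rfl⟩ := ha
      obtain ⟨k', rfl⟩ := hb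
      have hab : cl (g.conVtx t (g.nbr ℓ k)) = cl (g.conVtx t (g.nbr ℓ k')) :=
        Sum.inr_injective hab
      rw [hcon, hcon, hcl] at hab
      rw [hσ ℓ k k' hab]
    · by_contra hne
      have hne : a ≠ b := fun h => hne (congrArg _ h)
      obtain ⟨k, rfl⟩ := ha
      obtain ⟨k', hk'⟩ := hb
      exact hsep a b hne (hg a b hne ⟨k, k', hk'.symm⟩) (Sum.inl_injective hab)
    · exact hb.elim
    · exact ha.elim
    · exact ha.elim
  refine ⟨hH.comap f hf, fun ℓ ℓ' hne x y hxy => ?_⟩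
  -- The class of `x` and `y` is the middle of a path of length two in the forest `H` between the
  -- nodes of `ℓ` and `ℓ'`. By uniqueness of paths it is the image of a connector adjacent to both
  -- inputs.
  obtain ⟨c, hc, h1, h2⟩ := exists_adj_adj_of_injective g.conn.preconnected hH f hf
    (u := Sum.inl ℓ) (v := Sum.inl ℓ') (fun h => hne (Sum.inl_injective h))
    (w := Sum.inr (cl (g.incl t ℓ x))) (hnode ℓ x)
    (by rw [(hcl _ _).2 hxy]; exact hnode ℓ' y)
  rcases c with c | c
  · cases hc
  obtain ⟨k, rfl⟩ := h1
  obtain ⟨k', hk'⟩ := h2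
  have hc : cl (g.conVtx t (g.nbr ℓ k)) = cl (g.incl t ℓ x) := Sum.inr_injective hc
  refine ⟨k, k', hk'.symm, ?_, ?_⟩
  · rw [← hcl, ← hc, hcon]
  · rw [← hcl, ← (hcl _ _).2 hxy, ← hc, ← hk', hcon]

end BigraphOp

end Traffic

namespace Traffic

open Finset PreMonomial

/-- The partition `σ` of the vertices does not identify two outputs. -/
def PreMonomial.Separates {X : Type u} {n : ℕ} (t : PreMonomial X n) (σ : Setoid t.V) : Prop :=
  ∀ k k', σ (t.out k) (t.out k') → k = k'

namespace BigraphOp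

/-! ### Partitions of a substitution generated by partitions of its pieces -/

section Join

variable {X : Type u} {L : ℕ} {d : Fin L → ℕ} {n : ℕ} (g : BigraphOp L d n)
  (t : ∀ ℓ, PreMonomial X (d ℓ))

/-- The contraction of a substitution given by partitions of the vertices of the graphs. -/
def quotientContraction (s : ∀ ℓ, Setoid (t ℓ).V) :
    Contraction (g.subst t) (g.subst fun ℓ => (t ℓ).quotient (s ℓ)) :=
  g.substContraction fun ℓ => Contraction.ofQuotient (t ℓ) (s ℓ)

/-- The partition of the vertices of a substitution generated by partitions of the vertices of the
graphs. -/
def joinSetoid (s : ∀ ℓ, Setoid (t ℓ).V) : Setoid (g.subst t).V :=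
  Setoid.ker (g.quotientContraction t s).vtx

variable {t}

theorem quotient_joinSetoid_iso (s : ∀ ℓ, Setoid (t ℓ).V) :
    (g.subst t).quotient (g.joinSetoid t s) ≈ g.subst fun ℓ => (t ℓ).quotient (s ℓ) :=
  Contraction.iso_of_ker (Contraction.ofQuotient _ _) (g.quotientContraction t s) fun a b =>
    Contraction.ofQuotient_vtx _ _ a b

theorem joinSetoid_incl {s : ∀ ℓ, Setoid (t ℓ).V} {ℓ : Fin L} {x y : (t ℓ).V} (h : s ℓ x y) :
    g.joinSetoid t s (g.incl t ℓ x) (g.incl t ℓ y) :=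
  congrArg (g.incl (fun ℓ => (t ℓ).quotient (s ℓ)) ℓ)
    ((Contraction.ofQuotient_vtx (t ℓ) (s ℓ) x y).2 h)

theorem quotient_out_injective {s : ∀ ℓ, Setoid (t ℓ).V} (hs : ∀ ℓ, (t ℓ).Separates (s ℓ))
    (ℓ : Fin L) : Function.Injective ((t ℓ).quotient (s ℓ)).out := fun k k' h =>
  hs ℓ k k' ((Contraction.ofQuotient_vtx (t ℓ) (s ℓ) _ _).1 h)

/-- When the outputs of each quotient piece stay distinct, gluing along connectors creates no
further identification inside a piece. -/
theorem comap_joinSetoid {s : ∀ ℓ, Setoid (t ℓ).V} (hs : ∀ ℓ, (t ℓ).Separates (s ℓ))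
    (ℓ : Fin L) : (g.joinSetoid t s).comap (g.incl t ℓ) = s ℓ := by
  refine Setoid.ext fun x y => ⟨fun h => ?_, fun h => g.joinSetoid_incl h⟩
  exact (Contraction.ofQuotient_vtx (t ℓ) (s ℓ) x y).1
    (g.incl_injective (quotient_out_injective hs) ℓ h)

end Join

/-! ### Factorization over partitions which separate the outputs -/

variable {J : Type v} {X : J → Type u} {L : ℕ} {d : Fin L → ℕ} {g : BigraphOp L d 0}
  {t : ∀ ℓ, PreMonomial (Σ j, X j) (d ℓ)} {γ : Fin L → J}

/-- Identifications between two pieces pass through a common connector, which the substitution has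
already glued. Hence `σ` is generated by its restrictions to the pieces. -/
theorem eq_joinSetoid_of_isAcyclic (hg : g.Alternated γ)
    (hγ : ∀ ℓ e, ((t ℓ).label e).1 = γ ℓ) (σ : Setoid (g.subst t).V)
    (hσ : ∀ ℓ, (t ℓ).Separates (σ.comap (g.incl t ℓ)))
    (hac : ((g.subst t).quotient σ).compGraph.IsAcyclic) :
    g.joinSetoid t (fun ℓ => σ.comap (g.incl t ℓ)) = σ := by
  have key := (exists_nbr_of_isAcyclic hg hγ σ hσ hac).2
  set ρ := g.joinSetoid t (fun ℓ => σ.comap (g.incl t ℓ)) with hρ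
  have hle : ∀ ℓ x y, σ (g.incl t ℓ x) (g.incl t ℓ y) → ρ (g.incl t ℓ x) (g.incl t ℓ y) :=
    fun ℓ x y h => g.joinSetoid_incl h
  refine Setoid.ext fun x y => ⟨fun h => ?_, fun h => ?_⟩
  · refine g.ker_substContraction_le _ σ (fun ℓ x y hxy => ?_) h
    exact (Contraction.ofQuotient_vtx _ _ _ _).1 hxy
  · obtain ⟨ℓ, x, rfl⟩ := g.exists_eq_incl x
    obtain ⟨ℓ', y, rfl⟩ := g.exists_eq_incl y
    by_cases hne : ℓ = ℓ'
    · subst hne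
      exact hle ℓ x y h
    · obtain ⟨k, k', hk, h1, h2⟩ := key ℓ ℓ' hne x y h
      refine ρ.trans (hle _ _ _ h1) ?_
      rw [← conVtx_nbr, hk, conVtx_nbr]
      exact ρ.symm (hle _ _ _ h2)

open Classical in
-- If `g` is a tree, the `σ` of nonzero weight correspond to families of partitions of the pieces,
-- and the weight is multiplicative in the family. If `g` has a cycle, so does every graph of
-- components in the sum.
theorem sum_treeWeight_subst (W : GraphMonomial (Σ j, X j) 0 → ℂ)
    (hW : W (GraphMonomial.mk (point _ 0)) = 1) (hg : g.Alternated γ)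
    (hγ : ∀ ℓ e, ((t ℓ).label e).1 = γ ℓ) :
    ∑ σ : Setoid (g.subst t).V with ∀ ℓ, (t ℓ).Separates (σ.comap (g.incl t ℓ)),
        treeWeight W ((g.subst t).quotient σ) =
      if g.graph.IsAcyclic then
        ∏ ℓ, ∑ s : Setoid (t ℓ).V with (t ℓ).Separates s,
          W (GraphMonomial.mk ((t ℓ).quotient s).forget)
      else 0 := by
  split_ifs with hac
  · rw [Finset.prod_univ_sum]
    symm
    refine Finset.sum_of_injOn (g.joinSetoid t) ?_ ?_ ?_ ?_
    · intro s hs s' hs' h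
      have hs := fun ℓ => (Finset.mem_filter.1 (Fintype.mem_piFinset.1 (Finset.mem_coe.1 hs) ℓ)).2
      have hs' := fun ℓ =>
        (Finset.mem_filter.1 (Fintype.mem_piFinset.1 (Finset.mem_coe.1 hs') ℓ)).2
      funext ℓ
      rw [← g.comap_joinSetoid hs, ← g.comap_joinSetoid hs', h]
    · intro s hs
      have hs := fun ℓ => (Finset.mem_filter.1 (Fintype.mem_piFinset.1 (Finset.mem_coe.1 hs) ℓ)).2
      refine Finset.mem_coe.2 (Finset.mem_filter.2 ⟨Finset.mem_univ _, fun ℓ => ?_⟩)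
      rw [g.comap_joinSetoid hs]
      exact hs ℓ
    · intro σ hσ hnot
      have hσ : ∀ ℓ, (t ℓ).Separates (σ.comap (g.incl t ℓ)) := by simpa using hσ
      unfold treeWeight
      refine if_neg fun h => hnot ⟨fun ℓ => σ.comap (g.incl t ℓ), ?_,
        eq_joinSetoid_of_isAcyclic hg hγ σ hσ h⟩
      simpa using hσ
    · intro s hs
      have hs : ∀ ℓ, (t ℓ).Separates (s ℓ) := by simpa using hs
      rw [treeWeight_iso W (g.quotient_joinSetoid_iso s)]
      exact (treeWeight_subst W hW hg (t := fun ℓ => (t ℓ).quotient (s ℓ)) (fun ℓ e => hγ ℓ e)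
        (quotient_out_injective hs) hac).symm
  · refine Finset.sum_eq_zero fun σ hσ => ?_
    have hσ : ∀ ℓ, (t ℓ).Separates (σ.comap (g.incl t ℓ)) := by simpa using hσ
    unfold treeWeight
    exact if_neg fun h => hac (exists_nbr_of_isAcyclic hg hγ σ hσ h).1

end BigraphOp

end Traffic

namespace Traffic

open Finset PreMonomial

/-! ### Multilinear sums -/

section MultilinearSum

variable {ι : Type} [Fintype ι] [DecidableEq ι] {α : ι → Type u}

/-- The multilinear extension of `f`, evaluated at `t`. -/
noncomputable def multiSum (t : ∀ i, α i →₀ ℂ) (f : (∀ i, α i) → ℂ) : ℂ :=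
  ∑ m ∈ Fintype.piFinset fun i => (t i).support, (∏ i, t i (m i)) * f m

/-- Since `f` depends on the entry at `i₀` only through its image by `h`, the sum over this entry is
linear in `mapDomain h (t i₀)`, for each choice of the other entries. -/
theorem multiSum_eq_zero {t : ∀ i, α i →₀ ℂ} {f : (∀ i, α i) → ℂ} (i₀ : ι) (h : α i₀ → α i₀)
    (ht : Finsupp.mapDomain h (t i₀) = 0)
    (hf : ∀ m, f m = f (Function.update m i₀ (h (m i₀)))) : multiSum t f = 0 := by
  let e := Equiv.piSplitAt i₀ α
  have h1 : multiSum t f = ∑ p ∈ (t i₀).support ×ˢ Fintype.piFinset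
      (fun i : {i // i ≠ i₀} => (t i).support), (∏ i, t i (e.symm p i)) * f (e.symm p) := by
    refine Finset.sum_equiv e (fun m => ?_) fun m _ => by rw [e.symm_apply_apply]
    simp only [Fintype.mem_piFinset, Finset.mem_product]
    constructor
    · exact fun hm => ⟨hm i₀, fun i => hm i⟩
    · intro hm i
      by_cases hi : i = i₀
      · subst hi
        exact hm.1
      · exact hm.2 ⟨i, hi⟩
  rw [h1, Finset.sum_product_right]
  refine Finset.sum_eq_zero fun q _ => ?_
  have e1 : ∀ a, e.symm (a, q) i₀ = a := fun a => by simp [e, Equiv.piSplitAt]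
  have e2 : ∀ a (i : {i // i ≠ i₀}), e.symm (a, q) i = q i := fun a i => by
    simp [e, Equiv.piSplitAt, i.2]
  have e3 : ∀ a b, Function.update (e.symm (a, q)) i₀ b = e.symm (b, q) := by
    intro a b
    funext i
    by_cases hi : i = i₀
    · subst hi
      rw [Function.update_self, e1]
    · rw [Function.update_of_ne hi, e2 a ⟨i, hi⟩, e2 b ⟨i, hi⟩]
  have h2 : ∀ a, (∏ i, t i (e.symm (a, q) i)) * f (e.symm (a, q)) =
      t i₀ a * ((∏ i : {i // i ≠ i₀}, t i (q i)) * f (e.symm (h a, q))) := by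
    intro a
    rw [hf, e1, e3, Fintype.prod_eq_mul_prod_subtype_ne _ i₀, e1, mul_assoc]
    simp only [e2]
  simp_rw [h2]
  have h3 := Finsupp.sum_mapDomain_index (f := h) (s := t i₀) (h := fun b c =>
    c * ((∏ i : {i // i ≠ i₀}, t i (q i)) * f (e.symm (b, q)))) (fun b => zero_mul _)
    (fun b c c' => add_mul _ _ _)
  rw [ht, Finsupp.sum_zero_index] at h3
  exact h3.symm

theorem multiSum_prod (t : ∀ i, α i →₀ ℂ) (F : ∀ i, α i → ℂ) :
    multiSum t (fun m => ∏ i, F i (m i)) = ∏ i, (t i).sum fun a c => c * F i a := by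
  unfold multiSum Finsupp.sum
  rw [Finset.prod_univ_sum]
  exact Finset.sum_congr rfl fun m _ => Finset.prod_mul_distrib.symm

theorem multiSum_sum {κ : Type} [Fintype κ] (t : ∀ i, α i →₀ ℂ) (f : κ → (∀ i, α i) → ℂ) :
    multiSum t (fun m => ∑ k, f k m) = ∑ k, multiSum t (f k) := by
  unfold multiSum
  rw [Finset.sum_comm]
  exact Finset.sum_congr rfl fun m _ => Finset.mul_sum _ _ _

theorem multiSum_congr {t : ∀ i, α i →₀ ℂ} {f f' : (∀ i, α i) → ℂ} (h : ∀ m, f m = f' m) :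
    multiSum t f = multiSum t f' := by
  rw [funext h]

end MultilinearSum

/-- This holds uniformly in `n`: with one output there is no partition other than `⊥`, and with none
no polynomial is reduced. -/
theorem IsReduced.glueOut_eq_zero {X : Type u} {φ : GraphPoly X 1 →ₗ[ℂ] ℂ} {n : ℕ}
    {t : GraphPoly X n} (h : IsReduced φ n t) {π : Setoid (Fin n)} (hπ : π ≠ ⊥) :
    GraphPoly.glueOut π t = 0 := by
  match n, t, h, π, hπ with
  | 0, _, h, _, _ => exact h.elim
  | 1, _, _, π, hπ =>
    exact (hπ (Setoid.ext fun a b => ⟨fun _ => Subsingleton.elim a b,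
      fun _ => Subsingleton.elim a b ▸ π.refl _⟩)).elim
  | n + 2, t, h, π, hπ => exact h π hπ

theorem IsReduced.forget_eq_zero {X : Type u} {τ : GraphPoly X 0 →ₗ[ℂ] ℂ} {n : ℕ}
    {t : GraphPoly X n} (h : IsReduced (τ ∘ₗ GraphPoly.forget) n t) (hn : n = 1) :
    τ (GraphPoly.forget t) = 0 := by
  subst hn
  exact h

/-! ### Leaves of bigraphs, and partitions sorted by their traces on the outputs -/

namespace BigraphOp

/-- A finite tree with at least two vertices has a leaf. In the absence of outputs every connector
has degree at least two, so the leaf is an input. -/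
theorem exists_degree_eq_one {L : ℕ} {d : Fin L → ℕ} (g : BigraphOp L d 0)
    (hg : g.graph.IsAcyclic) : ∃ ℓ, d ℓ = 1 := by
  classical
  have := g.finC
  let _ : Fintype g.C := Fintype.ofFinite _
  have hnt : Nontrivial (Fin L ⊕ g.C) := by
    obtain ⟨ℓ | c⟩ := g.conn.nonempty
    · exact ⟨Sum.inl ℓ, Sum.inr (g.nbr ℓ ⟨0, g.d_pos ℓ⟩), by simp⟩
    · obtain ⟨ℓ, -, -⟩ := g.exists_nbr_eq c
      exact ⟨Sum.inl ℓ, Sum.inr c, by simp⟩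
  have htree : g.graph.IsTree := ⟨g.conn, hg⟩
  obtain ⟨v, hv⟩ := htree.exists_vert_degree_one_of_nontrivial
  obtain ⟨w, hw, huniq⟩ := SimpleGraph.degree_eq_one_iff_existsUnique_adj.1 hv
  rcases v with ℓ | c
  · refine ⟨ℓ, ?_⟩
    have hsub : Subsingleton (Fin (d ℓ)) := ⟨fun k k' => g.nbr_inj ℓ (Sum.inr_injective
      ((huniq (Sum.inr (g.nbr ℓ k)) ⟨k, rfl⟩).trans
        (huniq (Sum.inr (g.nbr ℓ k')) ⟨k', rfl⟩).symm))⟩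
    have := Fin.subsingleton_iff_le_one.1 hsub
    have := g.d_pos ℓ
    omega
  · have h2 := g.two_le_degree c fun i => i.elim0
    obtain ⟨a, ha, b, hb, hab⟩ := (Set.one_lt_ncard (Set.toFinite _)).1 h2
    exact (hab (Sum.inl_injective ((huniq (Sum.inl a) ha).trans (huniq (Sum.inl b) hb).symm))).elim

variable {J : Type v} {X : J → Type u} {L : ℕ} {d : Fin L → ℕ} (g : BigraphOp L d 0)

/-- The partition of the outputs of the graph `ℓ` induced by a partition of the vertices of a
substitution. -/
def inducedOut {Y : Type u} (t : ∀ ℓ, PreMonomial Y (d ℓ)) (σ : Setoid (g.subst t).V) :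
    ∀ ℓ, Setoid (Fin (d ℓ)) :=
  fun ℓ => (σ.comap (g.incl t ℓ)).comap (t ℓ).out

theorem inducedOut_comap {Y : Type u} {t s : ∀ ℓ, PreMonomial Y (d ℓ)}
    (c : ∀ ℓ, Contraction (t ℓ) (s ℓ)) (σ : Setoid (g.subst s).V) :
    g.inducedOut t (σ.comap (g.substContraction c).vtx) = g.inducedOut s σ := by
  funext ℓ
  refine Setoid.ext fun i k => ?_
  change σ (g.incl s ℓ ((c ℓ).vtx _)) (g.incl s ℓ ((c ℓ).vtx _)) ↔
    σ (g.incl s ℓ ((s ℓ).out i)) (g.incl s ℓ ((s ℓ).out k))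
  rw [(c ℓ).out, (c ℓ).out]

open Classical in
/-- The contribution to the free product of the partitions of the vertices of a substitution which
induce the partitions `θ` of the outputs. -/
noncomputable def inducedSum (W : GraphMonomial (Σ j, X j) 0 → ℂ) (θ : ∀ ℓ, Setoid (Fin (d ℓ)))
    (t : ∀ ℓ, PreMonomial (Σ j, X j) (d ℓ)) : ℂ :=
  ∑ σ : Setoid (g.subst t).V with g.inducedOut t σ = θ, treeWeight W ((g.subst t).quotient σ)

/-- By `hc`, every partition inducing `θ` contains the kernel of the contraction, so it is the
pullback of a partition of the contracted substitution, with the same quotient and the same trace on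
the outputs. -/
theorem inducedSum_contraction (W : GraphMonomial (Σ j, X j) 0 → ℂ)
    (θ : ∀ ℓ, Setoid (Fin (d ℓ))) {t s : ∀ ℓ, PreMonomial (Σ j, X j) (d ℓ)}
    (c : ∀ ℓ, Contraction (t ℓ) (s ℓ))
    (hc : ∀ ℓ (ρ : Setoid (t ℓ).V), (∀ i k, θ ℓ i k → ρ ((t ℓ).out i) ((t ℓ).out k)) →
      Setoid.ker (c ℓ).vtx ≤ ρ) :
    g.inducedSum W θ t = g.inducedSum W θ s := by
  classical
  unfold inducedSum
  rw [← (g.substContraction c).sum_comap (fun σ => g.inducedOut t σ = θ)]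
  · refine Finset.sum_congr ?_ fun σ _ => treeWeight_iso W (Contraction.quotient_comap_iso _ σ)
    simp only [inducedOut_comap]
  · rintro σ rfl
    exact g.ker_substContraction_le c σ fun ℓ => hc ℓ _ fun i k h => h

theorem inducedSum_iso (W : GraphMonomial (Σ j, X j) 0 → ℂ)
    (θ : ∀ ℓ, Setoid (Fin (d ℓ))) {t s : ∀ ℓ, PreMonomial (Σ j, X j) (d ℓ)}
    (h : ∀ ℓ, t ℓ ≈ s ℓ) : g.inducedSum W θ t = g.inducedSum W θ s := by
  choose c hc using fun ℓ => Contraction.exists_of_iso (h ℓ)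
  refine g.inducedSum_contraction W θ c fun ℓ ρ _ => ?_
  rw [Setoid.ker_eq_bot_iff.2 (hc ℓ)]
  exact bot_le

/-- A partition inducing `θ` already identifies the outputs of the piece `ℓ₀` along `θ ℓ₀`, so they
may be glued beforehand. This is how `Δ_{θ ℓ₀}` enters. -/
theorem inducedSum_update (W : GraphMonomial (Σ j, X j) 0 → ℂ)
    (θ : ∀ ℓ, Setoid (Fin (d ℓ))) (t : ∀ ℓ, PreMonomial (Σ j, X j) (d ℓ)) (ℓ₀ : Fin L) :
    g.inducedSum W θ t =
      g.inducedSum W θ (Function.update t ℓ₀ ((t ℓ₀).glueOut (θ ℓ₀))) := by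
  have h : ∀ ℓ, ∃ c : Contraction (t ℓ) (Function.update t ℓ₀ ((t ℓ₀).glueOut (θ ℓ₀)) ℓ),
      ∀ ρ : Setoid (t ℓ).V, (∀ i k, θ ℓ i k → ρ ((t ℓ).out i) ((t ℓ).out k)) →
        Setoid.ker c.vtx ≤ ρ := by
    intro ℓ
    by_cases hℓ : ℓ = ℓ₀
    · subst hℓ
      rw [Function.update_self]
      refine ⟨Contraction.ofGlue _ _, fun ρ hρ a b hab => ?_⟩
      have hgen := Quot.eqvGen_exact (show Quot.mk _ a = Quot.mk _ b from hab)
      clear hab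
      induction hgen with
      | rel x y h =>
        obtain ⟨i, k, hik, rfl, rfl⟩ := h
        exact hρ i k hik
      | refl x => exact ρ.refl x
      | symm x y _ ih => exact ρ.symm ih
      | trans x y z _ _ ih ih' => exact ρ.trans ih ih'
    · rw [Function.update_of_ne hℓ]
      refine ⟨⟨id, Equiv.refl _, Function.surjective_id, fun _ => rfl, fun _ => rfl, fun _ => rfl,
        fun _ => rfl⟩, fun ρ _ => ?_⟩
      rw [Setoid.ker_eq_bot_iff.2 Function.injective_id]
      exact bot_le
  choose c hc using h
  exact g.inducedSum_contraction W θ c hc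

open Classical in
theorem inducedSum_bot {t : ∀ ℓ, PreMonomial (Σ j, X j) (d ℓ)} {γ : Fin L → J}
    (W : GraphMonomial (Σ j, X j) 0 → ℂ)
    (hW : W (GraphMonomial.mk (point _ 0)) = 1) (hg : g.Alternated γ)
    (hγ : ∀ ℓ e, ((t ℓ).label e).1 = γ ℓ) :
    g.inducedSum W (fun _ => ⊥) t = if g.graph.IsAcyclic then
        ∏ ℓ, ∑ s : Setoid (t ℓ).V with (t ℓ).Separates s,
          W (GraphMonomial.mk ((t ℓ).quotient s).forget)
      else 0 := by
  rw [← sum_treeWeight_subst W hW hg hγ]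
  unfold inducedSum
  congr 1
  ext σ
  simp only [Finset.mem_filter, Finset.mem_univ, true_and]
  constructor
  · intro h ℓ k k' hk
    have : (⊥ : Setoid (Fin (d ℓ))) k k' := by
      rw [← congrFun h ℓ]
      exact hk
    exact this
  · intro h
    funext ℓ
    exact Setoid.ext fun k k' => ⟨h ℓ k k', by rintro rfl; exact Setoid.refl' _ _⟩

theorem sum_treeWeight_eq_sum_inducedSum (W : GraphMonomial (Σ j, X j) 0 → ℂ)
    (t : ∀ ℓ, PreMonomial (Σ j, X j) (d ℓ)) [Fintype (∀ ℓ, Setoid (Fin (d ℓ)))] :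
    ∑ σ : Setoid (g.subst t).V, treeWeight W ((g.subst t).quotient σ) =
      ∑ θ : ∀ ℓ, Setoid (Fin (d ℓ)), g.inducedSum W θ t := by
  classical
  unfold inducedSum
  exact (Finset.sum_fiberwise _ _ _).symm

end BigraphOp

/-! ### Alternated substitutions of reduced polynomials -/

section Alternated

variable {J : Type v} {X : J → Type u} {L : ℕ} {d : Fin L → ℕ} (g : BigraphOp L d 0)

/-- The substitution of graphs with labels of colours `γ`. -/
noncomputable def BigraphOp.colouredSubst (γ : Fin L → J)
    (m : ∀ ℓ, GraphMonomial (X (γ ℓ)) (d ℓ)) : GraphMonomial (Σ j, X j) 0 :=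
  g.substMonomial fun ℓ => (m ℓ).mapLabel (Sigma.mk (γ ℓ))

theorem BigraphOp.colouredSubst_mk (γ : Fin L → J) (t : ∀ ℓ, PreMonomial (X (γ ℓ)) (d ℓ)) :
    g.colouredSubst γ (fun ℓ => GraphMonomial.mk (t ℓ)) =
      GraphMonomial.mk (g.subst fun ℓ => (t ℓ).mapLabel (Sigma.mk (γ ℓ))) :=
  g.substMonomial_mk _

theorem BigraphOp.colouredSubst_eq (γ : Fin L → J) (m : ∀ ℓ, GraphMonomial (X (γ ℓ)) (d ℓ)) :
    g.colouredSubst γ m =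
      GraphMonomial.mk (g.subst fun ℓ => (m ℓ).rep.mapLabel (Sigma.mk (γ ℓ))) := by
  rw [← colouredSubst_mk]
  simp only [GraphMonomial.mk_rep]

variable {τ : ∀ j, GraphPoly (X j) 0 →ₗ[ℂ] ℂ}

theorem GraphPoly.sum_forget_single {Y : Type u} {n : ℕ} (φ : GraphPoly Y 0 →ₗ[ℂ] ℂ)
    (t : GraphPoly Y n) :
    (t.sum fun a c => c * φ (Finsupp.single a.forget 1)) = φ (GraphPoly.forget t) := by
  conv_rhs => rw [← Finsupp.sum_single t]
  rw [map_finsuppSum, map_finsuppSum]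
  refine Finsupp.sum_congr fun a _ => ?_
  unfold GraphPoly.forget
  rw [Finsupp.lmapDomain_apply, Finsupp.mapDomain_single, ← smul_eq_mul, ← map_smul,
    Finsupp.smul_single, smul_eq_mul, mul_one]

/-- The free product vanishes at the alternated substitutions of reduced polynomials. -/
theorem multiSum_freeProduct_eq_zero
    (hτ : ∀ j, τ j (Finsupp.single (GraphMonomial.mk (point (X j) 0)) 1) = 1)
    {γ : Fin L → J} (hg : g.Alternated γ) (t : ∀ ℓ, GraphPoly (X (γ ℓ)) (d ℓ))
    (ht : ∀ ℓ, IsReduced (τ (γ ℓ) ∘ₗ GraphPoly.forget) (d ℓ) (t ℓ)) :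
    multiSum t (fun m => freeProduct τ (Finsupp.single (g.colouredSubst γ m) 1)) = 0 := by
  classical
  let W := injWeight τ
  have hW := injWeight_point hτ
  have hfin : ∀ n, Finite (Setoid (Fin n)) := fun n =>
    Finite.of_injective (fun (π : Setoid (Fin n)) (a b : Fin n) => π a b)
      fun _ _ h => Setoid.ext fun a b => iff_of_eq (congrFun (congrFun h a) b)
  let _ : Fintype (∀ ℓ, Setoid (Fin (d ℓ))) := Fintype.ofFinite _
  let u : (∀ ℓ, GraphMonomial (X (γ ℓ)) (d ℓ)) → ∀ ℓ, PreMonomial (Σ j, X j) (d ℓ) :=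
    fun m ℓ => (m ℓ).rep.mapLabel (Sigma.mk (γ ℓ))
  have h1 : ∀ m, freeProduct τ (Finsupp.single (g.colouredSubst γ m) 1) =
      ∑ θ : ∀ ℓ, Setoid (Fin (d ℓ)), g.inducedSum W θ (u m) := by
    intro m
    rw [g.colouredSubst_eq, freeProduct_single hτ, g.sum_treeWeight_eq_sum_inducedSum]
  rw [multiSum_congr h1, multiSum_sum]
  refine Finset.sum_eq_zero fun θ _ => ?_
  by_cases hθ : ∀ ℓ, θ ℓ = ⊥
  · obtain rfl : θ = fun _ => ⊥ := funext hθ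
    rw [multiSum_congr fun m => g.inducedSum_bot W hW hg (t := u m) (γ := γ) fun _ _ => rfl]
    split_ifs with hac
    · rw [multiSum_prod t fun ℓ (a : GraphMonomial (X (γ ℓ)) (d ℓ)) =>
        ∑ s : Setoid (a.rep.mapLabel (Sigma.mk (γ ℓ))).V with
          (a.rep.mapLabel (Sigma.mk (γ ℓ))).Separates s,
          W (GraphMonomial.mk ((a.rep.mapLabel (Sigma.mk (γ ℓ))).quotient s).forget)]
      obtain ⟨ℓ, hℓ⟩ := g.exists_degree_eq_one hac
      refine Finset.prod_eq_zero (Finset.mem_univ ℓ) ?_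
      rw [← (ht ℓ).forget_eq_zero hℓ, ← GraphPoly.sum_forget_single]
      refine Finsupp.sum_congr fun a _ => congrArg _ ?_
      have hsub : Subsingleton (Fin (d ℓ)) := Fin.subsingleton_iff_le_one.2 hℓ.le
      -- With a single output the separation condition is void, so the factor sums over all
      -- partitions and equals `τ (γ ℓ)` of the graph with its output forgotten.
      rw [Finset.filter_true_of_mem fun s _ k k' _ => Subsingleton.elim k k']
      have : a.forget = GraphMonomial.mk a.rep.forget := by
        conv_lhs => rw [← a.mk_rep]
        rfl
      rw [this, ← sum_injVersion_quotient]
      refine Finset.sum_congr rfl fun s _ => ?_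
      rw [← injWeight_mapLabel hτ]
      exact congrArg W (GraphMonomial.mk_eq.2 ⟨Equiv.refl _, Equiv.refl _, fun _ => rfl,
        fun _ => rfl, fun _ => rfl, fun i => i.elim0⟩)
    · simp [multiSum]
  · obtain ⟨ℓ, hℓ⟩ := not_forall.1 hθ
    -- Some `θ ℓ` is nontrivial: the summand depends on `m ℓ` only through its gluing along `θ ℓ`,
    -- which kills the reduced polynomial `t ℓ`.
    refine multiSum_eq_zero ℓ (GraphMonomial.glueOut (θ ℓ)) ((ht ℓ).glueOut_eq_zero hℓ) fun m => ?_
    rw [g.inducedSum_update W θ (u m) ℓ]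
    refine g.inducedSum_iso W θ fun k => ?_
    by_cases hk : k = ℓ
    · subst hk
      rw [Function.update_self]
      simp only [u]
      rw [Function.update_self]
      have : (m k).glueOut (θ k) = GraphMonomial.mk ((m k).rep.glueOut (θ k)) := by
        conv_lhs => rw [← (m k).mk_rep]
        rfl
      rw [this]
      exact Setoid.symm (PreMonomial.mapLabel_iso (Sigma.mk (γ k)) (GraphMonomial.rep_mk ((m k).rep.glueOut (θ k))))
    · rw [Function.update_of_ne hk]
      simp only [u]
      rw [Function.update_of_ne hk]

end Alternated

end Traffic

namespace Traffic

open Finset PreMonomial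

/-! ### Gluing outputs -/

section GlueOut

variable {X : Type u} {n : ℕ}

/-- Gluing outputs, as a contraction. -/
def PreMonomial.Contraction.ofGlueOut (t : PreMonomial X n) (π : Setoid (Fin n)) :
    Contraction t (t.glueOut π) :=
  ofGlue t _

/-- Gluing twice is gluing along the relation generated by both partitions. This description is
symmetric in `ρ` and `π`, whence the operators `Δ_π` are commuting idempotents. -/
theorem glueOut_glueOut_vtx (t : PreMonomial X n) (ρ π : Setoid (Fin n)) (a b : t.V) :
    ((Contraction.ofGlueOut t ρ).trans (Contraction.ofGlueOut (t.glueOut ρ) π)).vtx a =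
      ((Contraction.ofGlueOut t ρ).trans (Contraction.ofGlueOut (t.glueOut ρ) π)).vtx b ↔
      Relation.EqvGen (fun a b => ∃ i k, (ρ i k ∨ π i k) ∧ t.out i = a ∧ t.out k = b) a b := by
  constructor
  · intro h
    let F : ((t.glueOut ρ).glueOut π).V →
        Quot (fun a b => ∃ i k, (ρ i k ∨ π i k) ∧ t.out i = a ∧ t.out k = b) :=
      Quot.lift (Quot.lift (Quot.mk _) (by
        rintro _ _ ⟨i, k, hik, rfl, rfl⟩
        exact Quot.sound ⟨i, k, Or.inl hik, rfl, rfl⟩)) (by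
        rintro _ _ ⟨i, k, hik, rfl, rfl⟩
        exact Quot.sound ⟨i, k, Or.inr hik, rfl, rfl⟩)
    exact Quot.eqvGen_exact (congrArg F h)
  · intro h
    induction h with
    | rel x y h =>
      obtain ⟨i, k, hik | hik, rfl, rfl⟩ := h
      · exact congrArg (Quot.mk _) (Quot.sound ⟨i, k, hik, rfl, rfl⟩)
      · exact Quot.sound ⟨i, k, hik, rfl, rfl⟩
    | refl x => rfl
    | symm x y _ ih => exact ih.symm
    | trans x y z _ _ ih ih' => exact ih.trans ih'

theorem GraphMonomial.glueOut_comm (ρ π : Setoid (Fin n)) (a : GraphMonomial X n) :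
    (a.glueOut ρ).glueOut π = (a.glueOut π).glueOut ρ := by
  induction a using Quotient.ind with | _ t => ?_
  refine GraphMonomial.mk_eq.2 (Contraction.iso_of_ker
    ((Contraction.ofGlueOut t ρ).trans (Contraction.ofGlueOut (t.glueOut ρ) π))
    ((Contraction.ofGlueOut t π).trans (Contraction.ofGlueOut (t.glueOut π) ρ)) fun a b => ?_)
  rw [glueOut_glueOut_vtx, glueOut_glueOut_vtx]
  refine iff_of_eq (congrArg (fun r => Relation.EqvGen r a b) (funext₂ fun x y => propext ?_))
  exact ⟨fun ⟨i, k, h, h'⟩ => ⟨i, k, h.symm, h'⟩, fun ⟨i, k, h, h'⟩ => ⟨i, k, h.symm, h'⟩⟩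

theorem GraphMonomial.glueOut_self (π : Setoid (Fin n)) (a : GraphMonomial X n) :
    (a.glueOut π).glueOut π = a.glueOut π := by
  induction a using Quotient.ind with | _ t => ?_
  refine GraphMonomial.mk_eq.2 (Contraction.iso_of_ker
    ((Contraction.ofGlueOut t π).trans (Contraction.ofGlueOut (t.glueOut π) π))
    (Contraction.ofGlueOut t π) fun a b => ?_)
  rw [glueOut_glueOut_vtx]
  simp only [or_self]
  exact ⟨Quot.eqvGen_sound, Quot.eqvGen_exact⟩

theorem GraphPoly.glueOut_comm (ρ π : Setoid (Fin n)) (t : GraphPoly X n) :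
    GraphPoly.glueOut π (GraphPoly.glueOut ρ t) = GraphPoly.glueOut ρ (GraphPoly.glueOut π t) := by
  unfold GraphPoly.glueOut
  simp only [Finsupp.lmapDomain_apply, ← Finsupp.mapDomain_comp]
  congr 1
  exact funext fun a => GraphMonomial.glueOut_comm ρ π a

theorem GraphPoly.glueOut_self (π : Setoid (Fin n)) (t : GraphPoly X n) :
    GraphPoly.glueOut π (GraphPoly.glueOut π t) = GraphPoly.glueOut π t := by
  unfold GraphPoly.glueOut
  simp only [Finsupp.lmapDomain_apply, ← Finsupp.mapDomain_comp]
  congr 1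
  exact funext fun a => GraphMonomial.glueOut_self π a

end GlueOut

/-! ### Reduced polynomials with a given leading term -/

section Reduction

variable {X : Type u} {n : ℕ}

/-- The graph `s` has at most as many edges as `t`, and its vertices are a quotient of those
of `t`. -/
structure Shrinking (t s : PreMonomial X n) where
  vtx : t.V → s.V
  surj : Function.Surjective vtx
  out : ∀ i, vtx (t.out i) = s.out i
  card_le : Nat.card s.E ≤ Nat.card t.E

/-- A graph obtained by shrinking `t`, with less edges or fewer outputs. -/
def StrictlyShrinks (t s : PreMonomial X n) : Prop :=
  Nonempty (Shrinking t s) ∧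
    (Nat.card s.E < Nat.card t.E ∨ ∃ i k, i ≠ k ∧ s.out i = s.out k)

theorem StrictlyShrinks.ne {t s : PreMonomial X n} (h : StrictlyShrinks t s)
    (ht : Function.Injective t.out) : GraphMonomial.mk s ≠ GraphMonomial.mk t := by
  intro heq
  obtain ⟨f, e, -, -, -, h4⟩ := GraphMonomial.mk_eq.1 heq
  obtain ⟨-, h | ⟨i, k, hik, h⟩⟩ := h
  · rw [Nat.card_congr e] at h
    exact lt_irrefl _ h
  · refine hik (ht ?_)
    rw [← h4, ← h4, h]

theorem Shrinking.strictlyShrinks_glueOut {t s : PreMonomial X n} (q : Shrinking t s)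
    {π : Setoid (Fin n)} (hπ : π ≠ ⊥) : StrictlyShrinks t (s.glueOut π) := by
  refine ⟨⟨⟨fun x => Quot.mk _ (q.vtx x), Quot.mk_surjective.comp q.surj,
    fun i => congrArg (Quot.mk _) (q.out i), q.card_le⟩⟩, Or.inr ?_⟩
  by_contra! h
  refine hπ (eq_bot_iff.2 fun i k hik => ?_)
  by_contra hne
  exact h i k hne (Quot.sound ⟨i, k, hik, rfl, rfl⟩)

/-- The coefficient of `t` in `r` is `1`, and the other monomials of `r` are smaller than `t`. -/
def HasLeadingTerm (r : GraphPoly X n) (t : PreMonomial X n) : Prop :=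
  r (GraphMonomial.mk t) = 1 ∧ ∀ a ∈ r.support, a ≠ GraphMonomial.mk t →
    ∃ s, GraphMonomial.mk s = a ∧ StrictlyShrinks t s

/-- Every monomial of `Δ_π r` has two identified outputs, whereas those of `t` are distinct; the
subtraction does not affect the coefficient of `t`. -/
theorem HasLeadingTerm.sub_glueOut {r : GraphPoly X n} {t : PreMonomial X n}
    (h : HasLeadingTerm r t) (ht : Function.Injective t.out) {π : Setoid (Fin n)} (hπ : π ≠ ⊥) :
    HasLeadingTerm (r - GraphPoly.glueOut π r) t := by
  classical
  have key : ∀ a ∈ (GraphPoly.glueOut π r).support,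
      ∃ s, GraphMonomial.mk s = a ∧ StrictlyShrinks t s := by
    intro a ha
    obtain ⟨b, hb, rfl⟩ := Finset.mem_image.1 (Finsupp.mapDomain_support ha)
    by_cases hbt : b = GraphMonomial.mk t
    · subst hbt
      exact ⟨t.glueOut π, rfl, Shrinking.strictlyShrinks_glueOut
        ⟨id, Function.surjective_id, fun _ => rfl, le_rfl⟩ hπ⟩
    · obtain ⟨s, rfl, ⟨q⟩, -⟩ := h.2 b hb hbt
      exact ⟨s.glueOut π, rfl, q.strictlyShrinks_glueOut hπ⟩
  constructor
  · have : GraphMonomial.mk t ∉ (GraphPoly.glueOut π r).support := fun h' => by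
      obtain ⟨s, hs, hst⟩ := key _ h'
      exact hst.ne ht hs
    rw [Finsupp.sub_apply, h.1, Finsupp.notMem_support_iff.1 this, sub_zero]
  · intro a ha hat
    rcases Finset.mem_union.1 (Finsupp.support_sub ha) with ha | ha
    · exact h.2 a ha hat
    · exact key a ha

/-- The polynomial is the product of the operators `1 - Δ_π`, `π ∈ l`, applied to `t`. As the `Δ_π`
are commuting idempotents, each of them annihilates it. -/
theorem exists_glueOut_eq_zero {t : PreMonomial X n} (ht : Function.Injective t.out)
    (l : List (Setoid (Fin n))) (hl : ∀ π ∈ l, π ≠ ⊥) :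
    ∃ r, HasLeadingTerm r t ∧ ∀ π ∈ l, GraphPoly.glueOut π r = 0 := by
  induction l with
  | nil =>
    refine ⟨Finsupp.single (GraphMonomial.mk t) 1, ⟨Finsupp.single_eq_same, fun a ha hat => ?_⟩,
      by simp⟩
    exact (hat (Finset.mem_singleton.1 (Finsupp.support_single_subset ha))).elim
  | cons ρ l ih =>
    obtain ⟨r, hr, h0⟩ := ih fun π hπ => hl π (List.mem_cons_of_mem _ hπ)
    refine ⟨r - GraphPoly.glueOut ρ r, hr.sub_glueOut ht (hl ρ List.mem_cons_self), ?_⟩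
    intro π hπ
    rcases List.mem_cons.1 hπ with rfl | hπ
    · rw [map_sub, GraphPoly.glueOut_self, sub_self]
    · rw [map_sub, GraphPoly.glueOut_comm, h0 π hπ, map_zero, sub_zero]

/-- With one output, center `t` by subtracting a multiple of the one-vertex graph, which is smaller
because `t` has an edge. With more outputs, apply `1 - Δ_π` for all `π ≠ ⊥`. -/
theorem exists_isReduced {τ : GraphPoly X 0 →ₗ[ℂ] ℂ}
    (hτ : τ (Finsupp.single (GraphMonomial.mk (point X 0)) 1) = 1) {t : PreMonomial X n}
    (hn : 0 < n) (ht : Function.Injective t.out) (hE : Nonempty t.E) :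
    ∃ r, HasLeadingTerm r t ∧ IsReduced (τ ∘ₗ GraphPoly.forget) n r := by
  classical
  match n, t, hn, ht, hE with
  | 1, t, _, ht, hE =>
    have hpt : StrictlyShrinks t (point X 1) := by
      refine ⟨⟨⟨fun _ => (), fun _ => ?_, fun _ => rfl, ?_⟩⟩, Or.inl ?_⟩
      · obtain ⟨x⟩ := t.conn.1
        exact ⟨x, rfl⟩
      · simp
      · have := t.finE
        simp
    have hne := hpt.ne ht
    set c := τ (GraphPoly.forget (Finsupp.single (GraphMonomial.mk t) 1)) with hc
    refine ⟨Finsupp.single (GraphMonomial.mk t) 1 -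
      c • Finsupp.single (GraphMonomial.mk (point X 1)) 1, ⟨?_, ?_⟩, ?_⟩
    · simp [Finsupp.single_eq_of_ne hne.symm]
    · intro a ha hat
      rcases Finset.mem_union.1 (Finsupp.support_sub ha) with ha | ha
      · exact (hat (Finset.mem_singleton.1 (Finsupp.support_single_subset ha))).elim
      · exact ⟨point X 1, (Finset.mem_singleton.1
          (Finsupp.support_single_subset (Finsupp.support_smul ha))).symm, hpt⟩
    · change τ (GraphPoly.forget _) = 0
      have hf : GraphPoly.forget (Finsupp.single (GraphMonomial.mk (point X 1)) (1 : ℂ)) =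
          Finsupp.single (GraphMonomial.mk (point X 0)) 1 := by
        unfold GraphPoly.forget
        rw [Finsupp.lmapDomain_apply, Finsupp.mapDomain_single]
        refine congrArg (fun a => Finsupp.single a (1 : ℂ)) ?_
        exact GraphMonomial.mk_eq.2 (iso_point (point X 1).forget (inferInstanceAs (IsEmpty Empty)))
      rw [map_sub, map_sub, map_smul, map_smul, hf, hτ, ← hc]
      simp
  | n + 2, t, _, ht, _ =>
    have : Finite (Setoid (Fin (n + 2))) :=
      Finite.of_injective (fun (π : Setoid (Fin (n + 2))) (a b : Fin (n + 2)) => π a b)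
        fun _ _ h => Setoid.ext fun a b => iff_of_eq (congrFun (congrFun h a) b)
    let _ : Fintype (Setoid (Fin (n + 2))) := Fintype.ofFinite _
    obtain ⟨r, hr, h0⟩ := exists_glueOut_eq_zero ht
      (Finset.univ.filter fun π : Setoid (Fin (n + 2)) => π ≠ ⊥).toList (by simp)
    exact ⟨r, hr, fun π hπ => h0 π (by simpa using hπ)⟩

end Reduction

/-! ### Substitutions of smaller graphs -/

/-- The number of vertices and edges. -/
noncomputable def PreMonomial.size {X : Type u} {n : ℕ} (t : PreMonomial X n) : ℕ :=
  Nat.card t.V + Nat.card t.E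

/-- No piece gains edges and the vertices form a quotient of the former ones. In the piece `ℓ`,
either an edge is lost, or two outputs, which were distinct vertices of the substitution, become
equal. -/
theorem BigraphOp.size_subst_lt {X : Type u} {L : ℕ} {d : Fin L → ℕ} {n : ℕ}
    (g : BigraphOp L d n) {t s : ∀ ℓ, PreMonomial X (d ℓ)}
    (ht : ∀ ℓ, Function.Injective (t ℓ).out) (q : ∀ ℓ, Shrinking (t ℓ) (s ℓ)) (ℓ : Fin L)
    (h : StrictlyShrinks (t ℓ) (s ℓ)) : (g.subst s).size < (g.subst t).size := by
  have := fun ℓ => (t ℓ).finE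
  have := fun ℓ => (s ℓ).finE
  have := (g.subst t).finV
  have hE : ∀ u : ∀ ℓ, PreMonomial X (d ℓ), Nat.card (g.subst u).E = ∑ ℓ, Nat.card (u ℓ).E := by
    intro u
    have := fun ℓ => (u ℓ).finE
    exact Nat.card_sigma
  have hsurj := g.substVtx_surjective (fun ℓ => (q ℓ).vtx) (fun ℓ => (q ℓ).out)
    fun ℓ => (q ℓ).surj
  have hle : ∀ ℓ ∈ Finset.univ, Nat.card (s ℓ).E ≤ Nat.card (t ℓ).E := fun ℓ _ => (q ℓ).card_le
  unfold PreMonomial.size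
  rcases h.2 with h | ⟨i, k, hik, h⟩
  · refine add_lt_add_of_le_of_lt (Nat.card_le_card_of_surjective _ hsurj) ?_
    rw [hE, hE]
    exact Finset.sum_lt_sum hle ⟨ℓ, Finset.mem_univ _, h⟩
  · refine add_lt_add_of_lt_of_le ?_ ?_
    · refine lt_of_le_of_ne (Nat.card_le_card_of_surjective _ hsurj) fun hcard => ?_
      have hbij := (Nat.bijective_iff_surjective_and_card _).2 ⟨hsurj, hcard.symm⟩
      refine hik (ht ℓ (g.incl_injective ht ℓ (hbij.1 ?_)))
      change g.incl s ℓ ((q ℓ).vtx _) = g.incl s ℓ ((q ℓ).vtx _)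
      rw [(q ℓ).out, (q ℓ).out, h]
    · rw [hE, hE]
      exact Finset.sum_le_sum hle

end Traffic

namespace Traffic

open Finset PreMonomial

/-! ### Decomposition of a graph into its coloured components -/

section Decomposition

variable {J : Type v} {X : J → Type u} (t : PreMonomial (Σ j, X j) 0)

/-- Two components through a common vertex are equal or joined by that connector. So whether the
components through a vertex are reachable from a given one does not change along the edges of `t`.
-/
theorem PreMonomial.compGraph_preconnected : t.compGraph.Preconnected := by
  have hmem : ∀ e x, t.Incident e x → t.Mem (t.compOf e) x := fun e x h => ⟨e, rfl, h⟩
  have hx : ∀ S S' x, t.Mem S x → t.Mem S' x →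
      t.compGraph.Reachable (Sum.inl S) (Sum.inl S') := by
    intro S S' x hS hS'
    by_cases hne : S = S'
    · rw [hne]
    · let c : {x : t.V // t.IsConnector x} := ⟨x, S, S', hne, hS, hS'⟩
      have h1 : t.compGraph.Adj (Sum.inl S) (Sum.inr c) := hS
      have h2 : t.compGraph.Adj (Sum.inr c) (Sum.inl S') := hS'
      exact h1.reachable.trans h2.reachable
  have hS : ∀ S S', t.compGraph.Reachable (Sum.inl S) (Sum.inl S') := by
    intro S S'
    have key : ∀ e x, t.Incident e x →
        ((∃ S', t.Mem S' x ∧ t.compGraph.Reachable (Sum.inl S) (Sum.inl S')) ↔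
          t.compGraph.Reachable (Sum.inl S) (Sum.inl (t.compOf e))) := fun e x h =>
      ⟨fun ⟨S', hS', hr⟩ => hr.trans (hx _ _ x hS' (hmem e x h)),
        fun hr => ⟨_, hmem e x h, hr⟩⟩
    obtain ⟨e, rfl⟩ := Quot.exists_rep S
    obtain ⟨f, rfl⟩ := Quot.exists_rep S'
    have := t.conn.eq_of_forall_edge
      (fun x => ∃ S', t.Mem S' x ∧ t.compGraph.Reachable (Sum.inl (t.compOf e)) (Sum.inl S'))
      (fun e' => propext ((key e' _ (Or.inl rfl)).trans (key e' _ (Or.inr rfl)).symm))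
      (t.src e) (t.src f)
    refine (key f _ (Or.inl rfl)).1 (this.mp ?_)
    exact ⟨_, hmem e _ (Or.inl rfl), SimpleGraph.Reachable.refl _⟩
  have hc : ∀ a, ∃ S, t.compGraph.Reachable a (Sum.inl S) := by
    rintro (S | ⟨x, S, S', hne, hS, hS'⟩)
    · exact ⟨S, SimpleGraph.Reachable.refl _⟩
    · have : t.compGraph.Adj (Sum.inr ⟨x, S, S', hne, hS, hS'⟩) (Sum.inl S) := hS
      exact ⟨S, this.reachable⟩
  intro a b
  obtain ⟨S, ha⟩ := hc a
  obtain ⟨S', hb⟩ := hc b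
  exact ha.trans ((hS S S').trans hb.symm)

/-- Ensures that the inputs of the bigraph of components have positive degree, which fails for a
graph with a single component. -/
theorem PreMonomial.exists_mem_connector [Nontrivial t.Component] (S : t.Component) :
    ∃ x : {x : t.V // t.IsConnector x}, t.Mem S x := by
  obtain ⟨S', hne⟩ := exists_ne S
  have : Nontrivial (t.Component ⊕ {x : t.V // t.IsConnector x}) := Sum.inl_injective.nontrivial
  obtain ⟨w, hw⟩ := t.compGraph_preconnected.exists_adj_of_nontrivial (Sum.inl S)
  rcases w with w | x
  · exact hw.elim
  · exact ⟨x, hw⟩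

/-- An enumeration of the coloured components. -/
noncomputable def PreMonomial.compEnum : Fin (Nat.card t.Component) ≃ t.Component :=
  (Finite.equivFin _).symm

instance (S : t.Component) : Finite {x : {x : t.V // t.IsConnector x} // t.Mem S x} :=
  have := t.finV
  inferInstance

/-- An enumeration of the connectors of a coloured component. -/
noncomputable def PreMonomial.connectorEnum (S : t.Component) :
    Fin (Nat.card {x : {x : t.V // t.IsConnector x} // t.Mem S x}) ≃
      {x : {x : t.V // t.IsConnector x} // t.Mem S x} :=
  (Finite.equivFin _).symm

theorem PreMonomial.exists_connectorEnum (S : t.Component) (x : {x : t.V // t.IsConnector x}) :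
    (∃ k, (t.connectorEnum S k).1 = x) ↔ t.Mem S x := by
  constructor
  · rintro ⟨k, rfl⟩
    exact (t.connectorEnum S k).2
  · intro h
    exact ⟨(t.connectorEnum S).symm ⟨x, h⟩, by simp⟩

/-- The bigraph operation of the coloured components of a graph. -/
noncomputable def PreMonomial.compOp [Nontrivial t.Component] :
    BigraphOp (Nat.card t.Component)
      (fun ℓ => Nat.card {x : {x : t.V // t.IsConnector x} // t.Mem (t.compEnum ℓ) x}) 0 where
  C := {x : t.V // t.IsConnector x}
  finC := by
    have := t.finV
    infer_instance
  d_pos ℓ := by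
    obtain ⟨x, hx⟩ := t.exists_mem_connector (t.compEnum ℓ)
    have : Nonempty {x : {x : t.V // t.IsConnector x} // t.Mem (t.compEnum ℓ) x} := ⟨⟨x, hx⟩⟩
    exact Nat.card_pos
  nbr ℓ k := (t.connectorEnum (t.compEnum ℓ) k).1
  nbr_inj ℓ := Subtype.val_injective.comp (t.connectorEnum _).injective
  out i := i.elim0
  out_inj i := i.elim0
  conn := by
    let i : (bipartiteGraph fun ℓ (c : {x : t.V // t.IsConnector x}) =>
        ∃ k, (t.connectorEnum (t.compEnum ℓ) k).1 = c) ≃g t.compGraph :=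
      ⟨Equiv.sumCongr t.compEnum (Equiv.refl _), by
        rintro (a | a) (b | b)
        · exact Iff.rfl
        · exact (t.exists_connectorEnum _ _).symm
        · exact (t.exists_connectorEnum _ _).symm
        · exact Iff.rfl⟩
    rw [i.connected_iff]
    have : Nonempty (t.Component ⊕ {x : t.V // t.IsConnector x}) :=
      (inferInstance : Nonempty t.Component).map Sum.inl
    exact ⟨t.compGraph_preconnected⟩
  two_le_degree := by
    rintro ⟨x, S, S', hne, hS, hS'⟩ -
    refine (Set.one_lt_ncard (Set.toFinite _)).2 ⟨t.compEnum.symm S, ?_, t.compEnum.symm S', ?_, ?_⟩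
    · refine (t.exists_connectorEnum _ _).2 ?_
      rwa [Equiv.apply_symm_apply]
    · refine (t.exists_connectorEnum _ _).2 ?_
      rwa [Equiv.apply_symm_apply]
    · exact t.compEnum.symm.injective.ne hne

/-- A coloured component, its outputs being the connectors. -/
noncomputable def PreMonomial.componentOut (S : t.Component) : PreMonomial (X (t.color S))
    (Nat.card {x : {x : t.V // t.IsConnector x} // t.Mem S x}) :=
  { t.component S with
    out := fun k => ⟨(t.connectorEnum S k).1.1, (t.connectorEnum S k).2⟩ }

theorem PreMonomial.componentOut_out_injective (S : t.Component) :
    Function.Injective (t.componentOut S).out := by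
  intro k k' h
  refine (t.connectorEnum S).injective (Subtype.ext (Subtype.ext ?_))
  exact congrArg (Subtype.val : {x : t.V // t.Mem S x} → t.V) h

theorem PreMonomial.compOp_alternated [Nontrivial t.Component] :
    t.compOp.Alternated fun ℓ => t.color (t.compEnum ℓ) := by
  rintro p q hne ⟨k, l, hkl⟩ hc
  have hp : t.Mem (t.compEnum p) (t.compOp.nbr p k).1 := (t.connectorEnum _ k).2
  have hq : t.Mem (t.compEnum q) (t.compOp.nbr q l).1 := (t.connectorEnum _ l).2
  rw [← hkl] at hq
  obtain ⟨e, he, hex⟩ := hp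
  obtain ⟨f, hf, hfx⟩ := hq
  refine hne (t.compEnum.injective ?_)
  change t.color (t.compEnum p) = t.color (t.compEnum q) at hc
  rw [← he, ← hf] at hc ⊢
  exact Quot.sound ⟨hc, _, hex, hfx⟩

theorem PreMonomial.subst_compOp_iso [Nontrivial t.Component] :
    t.compOp.subst (fun ℓ => (t.componentOut (t.compEnum ℓ)).mapLabel
      (Sigma.mk (t.color (t.compEnum ℓ)))) ≈ t := by
  set s := fun ℓ => (t.componentOut (t.compEnum ℓ)).mapLabel (Sigma.mk (t.color (t.compEnum ℓ)))
  let f : (t.compOp.subst s).V → t.V := Quot.lift (fun z => match z with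
    | Sum.inl c => c.1
    | Sum.inr ⟨ℓ, x⟩ => x.1) (by
      rintro _ _ ⟨ℓ, k⟩
      rfl)
  have hE : Nonempty t.E := by
    obtain ⟨S⟩ := (inferInstance : Nonempty t.Component)
    obtain ⟨e, -⟩ := Quot.exists_rep S
    exact ⟨e⟩
  have hincl : ∀ ℓ (x : (s ℓ).V), f (t.compOp.incl s ℓ x) = x.1 := fun _ _ => rfl
  have hf : Function.Bijective f := by
    constructor
    · intro a b hab
      obtain ⟨ℓ, x, rfl⟩ := t.compOp.exists_eq_incl a
      obtain ⟨ℓ', y, rfl⟩ := t.compOp.exists_eq_incl b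
      rw [hincl, hincl] at hab
      by_cases hne : ℓ = ℓ'
      · subst hne
        rw [Subtype.ext hab]
      -- A vertex common to two distinct components is a connector, and both copies of it are glued
      -- to this connector in the substitution.
      · let c : t.compOp.C := ⟨x.1, t.compEnum ℓ, t.compEnum ℓ', t.compEnum.injective.ne hne, x.2,
          hab ▸ y.2⟩
        have key : ∀ ℓ (z : (s ℓ).V), z.1 = c.1 → t.compOp.incl s ℓ z = t.compOp.conVtx s c := by
          intro ℓ z hz
          obtain ⟨k, hk⟩ := (t.exists_connectorEnum (t.compEnum ℓ) c).2 (hz ▸ z.2)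
          have hk : t.compOp.nbr ℓ k = c := hk
          rw [← hk, t.compOp.conVtx_nbr]
          refine congrArg _ (Subtype.ext ?_)
          rw [hz, ← hk]
          rfl
        rw [key ℓ x rfl, key ℓ' y hab.symm]
    · intro x
      obtain ⟨e, he⟩ := t.conn.exists_incident x
      obtain ⟨ℓ, hℓ⟩ := t.compEnum.surjective (t.compOf e)
      exact ⟨t.compOp.incl s ℓ ⟨x, e, hℓ.symm, he⟩, rfl⟩
  let h : (t.compOp.subst s).E → t.E := fun e => e.2.1
  have hh : Function.Bijective h := by
    constructor
    · rintro ⟨ℓ, e, he⟩ ⟨ℓ', e', he'⟩ hee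
      change e = e' at hee
      subst hee
      obtain rfl : ℓ = ℓ' := t.compEnum.injective (he.symm.trans he')
      rfl
    · intro e
      obtain ⟨ℓ, hℓ⟩ := t.compEnum.surjective (t.compOf e)
      exact ⟨⟨ℓ, e, hℓ.symm⟩, rfl⟩
  exact ⟨Equiv.ofBijective f hf, Equiv.ofBijective h hh, fun _ => rfl, fun _ => rfl,
    fun _ => sigma_castLabel _ _, fun i => i.elim0⟩

/-- A function on the monomials which vanishes on the graphs of a single colour and at the
alternated substitutions of reduced polynomials is zero. -/
theorem eq_zero_of_alternated {τ : ∀ j, GraphPoly (X j) 0 →ₗ[ℂ] ℂ}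
    (hτ : ∀ j, τ j (Finsupp.single (GraphMonomial.mk (point (X j) 0)) 1) = 1)
    (D : GraphMonomial (Σ j, X j) 0 → ℂ) (hpt : D (GraphMonomial.mk (point _ 0)) = 0)
    (hmono : ∀ j (t : PreMonomial (X j) 0), D (GraphMonomial.mk (t.mapLabel (Sigma.mk j))) = 0)
    (halt : ∀ (L : ℕ) (d : Fin L → ℕ) (g : BigraphOp L d 0) (γ : Fin L → J), g.Alternated γ →
      ∀ t : ∀ ℓ, GraphPoly (X (γ ℓ)) (d ℓ),
        (∀ ℓ, IsReduced (τ (γ ℓ) ∘ₗ GraphPoly.forget) (d ℓ) (t ℓ)) →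
        multiSum t (fun m => D (g.colouredSubst γ m)) = 0) :
    D (GraphMonomial.mk t) = 0 := by
  classical
  induction hN : t.size using Nat.strong_induction_on generalizing t with
  | _ N ih =>
    rcases isEmpty_or_nonempty t.E with hE | hE
    · rw [GraphMonomial.mk_eq.2 (iso_point t hE), hpt]
    rcases subsingleton_or_nontrivial t.Component with hS | hS
    · obtain ⟨e⟩ := hE
      have : t ≈ t.colored (t.compOf e) := iso_colored _ id id (fun _ _ h => h) (fun _ _ h => h)
        (fun _ => rfl) (fun _ => rfl) (fun _ => rfl)
        fun f => ⟨fun _ => ⟨f, rfl⟩, fun _ => Subsingleton.elim _ _⟩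
      rw [GraphMonomial.mk_eq.2 this]
      exact hmono _ _
    let γ := fun ℓ => t.color (t.compEnum ℓ)
    let s := fun ℓ => t.componentOut (t.compEnum ℓ)
    have hout : ∀ ℓ, Function.Injective (s ℓ).out := fun ℓ => t.componentOut_out_injective _
    have hsE : ∀ ℓ, Nonempty (s ℓ).E := by
      intro ℓ
      obtain ⟨e, he⟩ := Quot.exists_rep (t.compEnum ℓ)
      exact ⟨⟨e, he⟩⟩
    choose r hr hred using fun ℓ => exists_isReduced (hτ (γ ℓ)) (t.compOp.d_pos ℓ) (hout ℓ) (hsE ℓ)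
    have h0 := halt _ _ t.compOp γ t.compOp_alternated r hred
    have hsize : (t.compOp.subst fun ℓ => (s ℓ).mapLabel (Sigma.mk (γ ℓ))).size = N := by
      obtain ⟨f, h, -⟩ := t.subst_compOp_iso
      rw [← hN]
      exact congrArg₂ _ (Nat.card_congr f) (Nat.card_congr h)
    have hcol : t.compOp.colouredSubst γ (fun ℓ => GraphMonomial.mk (s ℓ)) = GraphMonomial.mk t := by
      rw [BigraphOp.colouredSubst_mk]
      exact GraphMonomial.mk_eq.2 t.subst_compOp_iso
    unfold multiSum at h0
    -- The leading terms together give back `t`, with coefficient `1`; every other term is the value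
    -- of `D` at a smaller graph.
    rw [Finset.sum_eq_single fun ℓ => GraphMonomial.mk (s ℓ)] at h0
    · rw [Finset.prod_eq_one fun ℓ _ => (hr ℓ).1, one_mul] at h0
      rw [← hcol]
      exact h0
    · intro m hm hne
      have hm := Fintype.mem_piFinset.1 hm
      have hq : ∀ ℓ, ∃ s', GraphMonomial.mk s' = m ℓ ∧ Nonempty (Shrinking (s ℓ) s') ∧
          (m ℓ ≠ GraphMonomial.mk (s ℓ) → StrictlyShrinks (s ℓ) s') := by
        intro ℓ
        by_cases h : m ℓ = GraphMonomial.mk (s ℓ)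
        · exact ⟨s ℓ, h.symm, ⟨⟨id, Function.surjective_id, fun _ => rfl, le_rfl⟩⟩,
            fun h' => (h' h).elim⟩
        · obtain ⟨s', h1, h2⟩ := (hr ℓ).2 (m ℓ) (hm ℓ) h
          exact ⟨s', h1, h2.1, fun _ => h2⟩
      choose s' hs' q hstrict using hq
      -- One piece shrinks strictly and the others do not grow, so the induction hypothesis applies
      -- to the substitution.
      obtain ⟨ℓ, hℓ⟩ := Function.ne_iff.1 hne
      have hlt := t.compOp.size_subst_lt
        (t := fun ℓ => (s ℓ).mapLabel (Sigma.mk (γ ℓ)))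
        (s := fun ℓ => (s' ℓ).mapLabel (Sigma.mk (γ ℓ))) hout
        (fun ℓ => ⟨(q ℓ).some.vtx, (q ℓ).some.surj, (q ℓ).some.out, (q ℓ).some.card_le⟩) ℓ
        ⟨⟨⟨(q ℓ).some.vtx, (q ℓ).some.surj, (q ℓ).some.out, (q ℓ).some.card_le⟩⟩,
          (hstrict ℓ hℓ).2⟩
      rw [hsize] at hlt
      have := ih _ hlt _ rfl
      rw [← BigraphOp.colouredSubst_mk, funext hs'] at this
      exact mul_eq_zero_of_right _ this
    · intro h
      refine (h (Fintype.mem_piFinset.2 fun ℓ => Finsupp.mem_support_iff.2 ?_)).elim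
      rw [(hr ℓ).1]
      exact one_ne_zero

end Decomposition

/-! ### Characterization of traffic independence -/

section Main

theorem GraphPoly.mapLabel_single {X : Type u} {Y : Type v} {n : ℕ} (f : X → Y)
    (a : GraphMonomial X n) (c : ℂ) :
    GraphPoly.mapLabel f (Finsupp.single a c) = Finsupp.single (a.mapLabel f) c :=
  Finsupp.mapDomain_single

theorem GraphPoly.mapLabel_injective {X : Type u} {Y : Type v} {n : ℕ} {f : X → Y}
    (hf : Function.Injective f) :
    Function.Injective (GraphPoly.mapLabel f : GraphPoly X n →ₗ[ℂ] GraphPoly Y n) :=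
  Finsupp.mapDomain_injective (GraphMonomial.mapLabel_injective hf)

theorem GraphPoly.glueOut_mapLabel {X : Type u} {Y : Type v} {n : ℕ} (f : X → Y)
    (π : Setoid (Fin n)) (t : GraphPoly X n) :
    GraphPoly.glueOut π (GraphPoly.mapLabel f t) = GraphPoly.mapLabel f (GraphPoly.glueOut π t) := by
  unfold GraphPoly.glueOut GraphPoly.mapLabel
  simp only [Finsupp.lmapDomain_apply, ← Finsupp.mapDomain_comp]
  congr 1
  funext a
  induction a using Quotient.ind with | _ t => rfl

theorem GraphPoly.forget_mapLabel {X : Type u} {Y : Type v} {n : ℕ} (f : X → Y)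
    (t : GraphPoly X n) :
    GraphPoly.forget (GraphPoly.mapLabel f t) = GraphPoly.mapLabel f (GraphPoly.forget t) := by
  unfold GraphPoly.forget GraphPoly.mapLabel
  simp only [Finsupp.lmapDomain_apply, ← Finsupp.mapDomain_comp]
  congr 1
  funext a
  induction a using Quotient.ind with | _ t => rfl

/-- Being reduced means the same for labels in a subset and in the whole space: an injective
relabelling commutes with gluing and forgetting outputs and loses no coefficient. -/
theorem isReduced_mapLabel {X : Type u} {Y : Type v} {f : X → Y} (hf : Function.Injective f)
    (τ : GraphPoly Y 0 →ₗ[ℂ] ℂ) {n : ℕ} (t : GraphPoly X n) :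
    IsReduced (τ ∘ₗ GraphPoly.forget) n (GraphPoly.mapLabel f t) ↔
      IsReduced ((τ ∘ₗ GraphPoly.mapLabel f) ∘ₗ GraphPoly.forget) n t := by
  match n, t with
  | 0, _ => exact Iff.rfl
  | 1, t =>
    change τ (GraphPoly.forget _) = 0 ↔ τ (GraphPoly.mapLabel f (GraphPoly.forget t)) = 0
    rw [GraphPoly.forget_mapLabel]
  | n + 2, t =>
    refine forall₂_congr fun π _ => ?_
    rw [GraphPoly.glueOut_mapLabel]
    exact map_eq_zero_iff _ (GraphPoly.mapLabel_injective hf)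

/-! ### Passing from labels in the disjoint union to labels in the algebra -/

variable {A : Type u} {J : Type v} {X : J → Type w} {f : ∀ j, X j → A} {L : ℕ} {d : Fin L → ℕ}

theorem BigraphOp.subst_mapLabel_iso {Y : Type w} {Z : Type u} (h : Y → Z) (g : BigraphOp L d 0)
    (t : ∀ ℓ, PreMonomial Y (d ℓ)) :
    g.subst (fun ℓ => (t ℓ).mapLabel h) ≈ (g.subst t).mapLabel h := by
  refine ⟨Quot.congr (Equiv.refl _) fun x y => ⟨?_, ?_⟩, Equiv.refl _, fun _ => rfl,
    fun _ => rfl, fun _ => rfl, fun i => i.elim0⟩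
  · rintro ⟨ℓ, k⟩
    exact SubstRel.mk (t := t) ℓ k
  · intro h
    exact match x, y, h with
    | _, _, .mk ℓ k => SubstRel.mk (t := fun ℓ => (t ℓ).mapLabel _) ℓ k

theorem BigraphOp.substMonomial_mapLabel (g : BigraphOp L d 0) (γ : Fin L → J)
    (m : ∀ ℓ, GraphMonomial (X (γ ℓ)) (d ℓ)) :
    g.substMonomial (fun ℓ => (m ℓ).mapLabel (f (γ ℓ))) =
      (g.colouredSubst γ m).mapLabel fun y : Σ j, X j => f y.1 y.2 := by
  have : m = fun ℓ => GraphMonomial.mk (m ℓ).rep := funext fun ℓ => (m ℓ).mk_rep.symm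
  rw [this, colouredSubst_mk]
  exact (g.substMonomial_mk fun ℓ => (m ℓ).rep.mapLabel (f (γ ℓ))).trans (GraphMonomial.mk_eq.2
    (g.subst_mapLabel_iso (fun y : Σ j, X j => f y.1 y.2)
      fun ℓ => (m ℓ).rep.mapLabel (Sigma.mk (γ ℓ))))

/-- Within one colour, distinct monomials stay distinct after relabelling, so coefficients are
transported unchanged. The disjoint union retains the colours, which are lost in `A` when the images
of the `f j` overlap. -/
theorem BigraphOp.map_apply_mapLabel (g : BigraphOp L d 0) (hf : ∀ j, Function.Injective (f j))
    (τ : GraphPoly A 0 →ₗ[ℂ] ℂ) (γ : Fin L → J) (t : ∀ ℓ, GraphPoly (X (γ ℓ)) (d ℓ)) :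
    τ (g.apply fun ℓ => GraphPoly.mapLabel (f (γ ℓ)) (t ℓ)) =
      multiSum t fun m => (τ ∘ₗ GraphPoly.mapLabel fun y : Σ j, X j => f y.1 y.2)
        (Finsupp.single (g.colouredSubst γ m) 1) := by
  classical
  have hinj := fun ℓ => GraphMonomial.mapLabel_injective (n := d ℓ) (hf (γ ℓ))
  have key : ∀ ℓ a, GraphPoly.mapLabel (f (γ ℓ)) (t ℓ) (a.mapLabel (f (γ ℓ))) = t ℓ a :=
    fun ℓ a => Finsupp.mapDomain_apply (hinj ℓ) _ _
  unfold BigraphOp.apply multiSum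
  rw [map_sum]
  symm
  refine Finset.sum_bij (fun m _ ℓ => (m ℓ).mapLabel (f (γ ℓ))) ?_ ?_ ?_ ?_
  · intro m hm
    refine Fintype.mem_piFinset.2 fun ℓ => ?_
    have := Finsupp.mem_support_iff.1 (Fintype.mem_piFinset.1 hm ℓ)
    exact Finsupp.mem_support_iff.2 ((key ℓ (m ℓ)).trans_ne this)
  · intro m _ m' _ h
    exact funext fun ℓ => hinj ℓ (congrFun h ℓ)
  · intro m hm
    have hm : ∀ ℓ, ∃ a ∈ (t ℓ).support, GraphMonomial.mapLabel (f (γ ℓ)) a = m ℓ := fun ℓ =>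
      Finset.mem_image.1 (Finsupp.mapDomain_support (Fintype.mem_piFinset.1 hm ℓ))
    choose a ha ham using hm
    exact ⟨a, Fintype.mem_piFinset.2 ha, funext ham⟩
  · intro m _
    rw [BigraphOp.substMonomial_mapLabel, Finset.prod_congr rfl fun ℓ _ => key ℓ (m ℓ)]
    beta_reduce
    rw [LinearMap.comp_apply, GraphPoly.mapLabel_single, ← smul_eq_mul, ← map_smul,
      Finsupp.smul_single, smul_eq_mul, mul_one]

theorem AlgTrafficSpace.τ_point {A : Type u} [AddCommGroup A] [Module ℂ A] [GAlgebra A]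
    (T : AlgTrafficSpace A) :
    T.τ (Finsupp.single (GraphMonomial.mk (point A 0)) 1) = 1 := by
  let e : Fin 0 ≃ (point A 0).E := Equiv.equivOfIsEmpty _ _
  rw [T.τ_single (point A 0) e (), ← T.unital]
  refine congrArg T.Φ ?_
  unfold GAlgebra.unit
  rw [GAlgebra.Z_iso ((point A 0).toOp e ()) GraphOp.point
    ⟨Equiv.refl _, fun i => i.elim0, fun i => i.elim0, rfl, rfl⟩]
  exact congrArg _ (funext fun i => i.elim0)

theorem AlgTrafficSpace.τ_mapLabel_point {A : Type u} [AddCommGroup A] [Module ℂ A] [GAlgebra A]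
    (T : AlgTrafficSpace A) {Y : Type v} (f : Y → A) :
    (T.τ ∘ₗ GraphPoly.mapLabel f) (Finsupp.single (GraphMonomial.mk (point Y 0)) 1) = 1 := by
  have h : GraphPoly.mapLabel f (Finsupp.single (GraphMonomial.mk (point Y 0)) 1) =
      Finsupp.single (GraphMonomial.mk (point A 0)) 1 :=
    (GraphPoly.mapLabel_single _ _ _).trans (congrArg (fun a => Finsupp.single a 1)
      (GraphMonomial.mk_eq.2 (iso_point ((point Y 0).mapLabel f) (inferInstanceAs (IsEmpty Empty)))))
  rw [LinearMap.comp_apply, h, T.τ_point]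

/-- Traffic independence in terms of alternated substitutions of reduced polynomials. -/
theorem trafficIndep_iff {A : Type u} [AddCommGroup A] [Module ℂ A] [GAlgebra A]
    (T : AlgTrafficSpace A) {J : Type v} (S : J → Submodule ℂ A) :
    TrafficIndep T.τ S ↔
      ∀ (L : ℕ) (d : Fin L → ℕ) (g : BigraphOp L d 0) (γ : Fin L → J), g.Alternated γ →
        ∀ t : ∀ ℓ, GraphPoly (S (γ ℓ)) (d ℓ),
          (∀ ℓ, IsReduced T.φ (d ℓ) (GraphPoly.mapLabel (fun a : S (γ ℓ) => (a : A)) (t ℓ))) →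
          T.τ (g.apply fun ℓ => GraphPoly.mapLabel (fun a : S (γ ℓ) => (a : A)) (t ℓ)) = 0 := by
  let τ : ∀ j, GraphPoly (S j) 0 →ₗ[ℂ] ℂ := fun j =>
    T.τ ∘ₗ GraphPoly.mapLabel (fun a : S j => (a : A))
  have hτ : ∀ j, τ j (Finsupp.single (GraphMonomial.mk (point (S j) 0)) 1) = 1 :=
    fun j => T.τ_mapLabel_point _
  let τ' : GraphPoly (Σ j, S j) 0 →ₗ[ℂ] ℂ := T.τ ∘ₗ GraphPoly.mapLabel fun y => (y.2 : A)
  have hred : ∀ {n : ℕ} (j : J) (t : GraphPoly (S j) n),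
      IsReduced T.φ n (GraphPoly.mapLabel (fun a : S j => (a : A)) t) ↔
        IsReduced (τ j ∘ₗ GraphPoly.forget) n t := fun j t =>
    isReduced_mapLabel Subtype.val_injective T.τ t
  have happ : ∀ {L : ℕ} {d : Fin L → ℕ} (g : BigraphOp L d 0) (γ : Fin L → J)
      (t : ∀ ℓ, GraphPoly (S (γ ℓ)) (d ℓ)),
      T.τ (g.apply fun ℓ => GraphPoly.mapLabel (fun a : S (γ ℓ) => (a : A)) (t ℓ)) =
        multiSum t fun m => τ' (Finsupp.single (g.colouredSubst γ m) 1) := fun g γ t =>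
    g.map_apply_mapLabel (f := fun j (a : S j) => (a : A)) (fun j => Subtype.val_injective) T.τ γ t
  have hfree : ∀ {L : ℕ} {d : Fin L → ℕ} (g : BigraphOp L d 0) (γ : Fin L → J),
      g.Alternated γ → ∀ t : ∀ ℓ, GraphPoly (S (γ ℓ)) (d ℓ),
      (∀ ℓ, IsReduced (τ (γ ℓ) ∘ₗ GraphPoly.forget) (d ℓ) (t ℓ)) →
        multiSum t (fun m => freeProduct τ (Finsupp.single (g.colouredSubst γ m) 1)) = 0 :=
    fun g γ hg t ht => multiSum_freeProduct_eq_zero g hτ hg t ht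
  constructor
  · intro h L d g γ hg t ht
    have h : τ' = freeProduct τ := h
    rw [happ, h]
    exact hfree g γ hg t fun ℓ => (hred _ _).1 (ht ℓ)
  · intro h
    change τ' = freeProduct τ
    -- It suffices to compare the two forms on monomials. Their difference vanishes on graphs of one
    -- colour, where both are given by `τ j`, and at alternated substitutions of reduced
    -- polynomials, where each of them vanishes.
    refine Finsupp.lhom_ext' fun a => LinearMap.ext_ring ?_
    induction a using Quotient.ind with | _ t => ?_
    refine sub_eq_zero.1 (eq_zero_of_alternated t hτ
      (fun a => τ' (Finsupp.single a 1) - freeProduct τ (Finsupp.single a 1)) ?_ ?_ ?_)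
    · rw [freeProduct_point hτ, T.τ_mapLabel_point, sub_self]
    · intro j s
      rw [freeProduct_monochrome hτ, sub_eq_zero]
      refine congrArg T.τ ?_
      rw [GraphPoly.mapLabel_single, GraphPoly.mapLabel_single]
      rfl
    · intro L d g γ hg r hr
      have h1 := h L d g γ hg r fun ℓ => (hred _ _).2 (hr ℓ)
      rw [happ] at h1
      have h2 := hfree g γ hg r hr
      unfold multiSum at h1 h2 ⊢
      simp only [mul_sub, Finset.sum_sub_distrib]
      rw [h1, h2, sub_zero]

end Main

end Traffic

theorem proposition3p11 {A : Type u} [AddCommGroup A] [Module ℂ A] [StarAddMonoid A]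
    [StarModule ℂ A] [Traffic.GStarAlgebra A] (T : Traffic.TrafficSpace A)
    {J : Type v} (S : J → Submodule ℂ A) (hS : ∀ j, Traffic.IsGSubalgebra (S j)) :
    Traffic.TrafficIndep T.τ S ↔
      ∀ (L : ℕ) (d : Fin L → ℕ) (g : Traffic.BigraphOp L d 0) (γ : Fin L → J),
        g.Alternated γ →
        ∀ t : ∀ ℓ, Traffic.GraphPoly (S (γ ℓ)) (d ℓ),
          (∀ ℓ, Traffic.IsReduced T.φ (d ℓ)
            (Traffic.GraphPoly.mapLabel (fun a : S (γ ℓ) => (a : A)) (t ℓ))) →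
          T.τ (g.apply fun ℓ =>
            Traffic.GraphPoly.mapLabel (fun a : S (γ ℓ) => (a : A)) (t ℓ)) = 0 := by
  exact Traffic.trafficIndep_iff T.toAlgTrafficSpace S
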